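/- Let $T>0$, let $H$ be a real separable Hilbert space and $E$ a real separable Banach space, densely and continuously embedded in $H$. A map $G:D(G)\subseteq V\to V$ on a Banach space $V$ is called m-dissipative if $\|x-y\|_V\le\|x-y-\alpha(G(x)-G(y))\|_V$ for all $\alpha>0$, $x,y\in D(G)$, and $\lambda I-G$ is onto $V$ for some $\lambda>0$. The part $G_E$ in $E$ of a map $G:D(G)\subseteq H\to H$ is its restriction to $\{x\in D(G)\cap E: G(x)\in E\}$. Write $\Delta=\{0\le s<t\le T\}$ and $\overline\Delta=\{0\le s\le t\le T\}$. **Standing hypothesis.** (1) $F:[0,T]\times D_F\to H$ with $E\subseteq D_F\subseteq H$; for every $t\in[0,T]$, $F(t,\cdot)$ maps bounded sets of $E$ into bounded sets of $H$; for every $x\in E$, $F(t,x)\in E$ for all $t\in[0,T]$ and $t\mapsto F_E(t,x)\in E$ is continuous on $[0,T]$; and $\zeta\in\mathbb R$ is such that, for all $t\in[0,T]$, $F(t,\cdot)-\zeta I$ is m-dissipative in $H$ and $F_E(t,\cdot)-\zeta I$ is m-dissipative in $E$. (2) For every $t\in[0,T]$, $A(t):D(A(t))\subseteq H\to H$ is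 a closed linear operator that is m-dissipative in $H$, and its part $A_E(t)$ is m-dissipative in $E$. (3) $\{U(t,s)\}_{(s,t)\in\overline\Delta}\subseteq\mathscr L(H)$ satisfies $U(t,t)=I$ and $U(t,s)=U(t,r)U(r,s)$ for $s\le r\le t$, and $(s,t)\mapsto U(t,s)x\in H$ is continuous on $\overline\Delta$ for every $x\in H$. Each $U(t,s)$ restricts to a bounded operator on $E$, and $(s,t)\mapsto U(t,s)x\in E$ is continuous on $\Delta$ for every $x\in E$. For every integer $n\ge1$ the map $t\mapsto A_n(t):=nA_E(t)(nI-A_E(t))^{-1}\in\mathscr L(E)$ is continuous on $[0,T]$, and $\lim_{n\to\infty}\|U_n(t,s)-U(t,s)\|_{\mathscr L(E)}=0$ for all $(s,t)\in\overline\Delta$, where $U_n(\cdot,s)x$ is the $C^1([s,T];E)$ solution of $u'=A_n(t)u$, $u(s)=x$. (4) For every continuous $g:[0,T]\to E$ the function $t\mapsto F_E(t,g(t))\in E$ is measurable and $\int_0^T\|F_E(r,g(r))\|_E\,dr<\infty$. Assume the standing hypothesis and at least one of the following. * **(Hyp1)** $E$ is reflexive; there is $x_0\in E$ with $F(t,x_0)=\zeta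 x_0$ for all $t\in[0,T]$; and whenever $(y_n)\subseteq E$ is bounded in $E$, $y\in E$ and $y_n\to y$ in $H$, then $\langle F(t,y_n)-F(t,y),z\rangle_H\to0$ for all $t\in[0,T]$, $z\in E$. * **(Hyp2)** $F(t,\cdot)$ maps $E$ into itself for all $t\in[0,T]$, and for every bounded $B\subseteq E$ there is $L_B>0$ with $\|F(t,z_1)-F(t,z_2)\|_E\le L_B\|z_1-z_2\|_E$ for all $t\in[0,T]$, $z_1,z_2\in B$. Let $s\in[0,T)$ and let $f:[s,T]\to E$ be continuous. For $\Phi=F$, or $\Phi=F_k$ below, and $x\in E$, a *mild solution* of $y'=A(t)y+\Phi(t,y+f(t))$, $y(s)=x$, is a function $y:[s,T]\to E$ in $C([s,T];H)\cap C_b((s,T];E)$ with $\Phi(\cdot,y+f)\in L^1((s,T);H)$ and $$y(t)=U(t,s)x+\int_s^tU(t,r)\Phi(r,y(r)+f(r))\,dr,\qquad t\in[s,T].$$ For an integer $k\ge1$ let $F_k(t,x):=F(t,J_k(t,x))$, where $z=J_k(t,x)\in D_F$ is the unique solution of $z-\frac1k\big(F(t,z)-\zeta z\big)=x$. **Theorem.**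 For every $x\in E$ the equation $y'=A(t)y+F(t,y+f(t))$, $y(s)=x$, has a unique mild solution $y_{s,x}$; for every integer $k\ge1$ with $k>\zeta$ the equation with $F_k$ in place of $F$ has a unique mild solution $y^k_{s,x}$; and $$\lim_{k\to\infty}\sup_{t\in[s,T]}\|y^k_{s,x}(t)-y_{s,x}(t)\|_H=0 .$$ Moreover, for all $x,z\in E$ and $t\in[s,T]$, $$\|y_{s,x}(t)\|_H\le e^{\zeta(t-s)}\|x\|_H+3\int_s^te^{\zeta(t-r)}\big(\|F(r,f(r))\|_H+\max\{0,\zeta\}\|f(r)\|_H\big)dr,$$ $$\|y_{s,x}(t)\|_E\le e^{\zeta(t-s)}\|x\|_E+3\int_s^te^{\zeta(t-r)}\big(\|F(r,f(r))\|_E+\max\{0,\zeta\}\|f(r)\|_E\big)dr,$$ $$\|y_{s,x}(t)-y_{s,z}(t)\|_H\le e^{\zeta(t-s)}\|x-z\|_H,\qquad \|y_{s,x}(t)-y_{s,z}(t)\|_E\le e^{\zeta(t-s)}\|x-z\|_E .$$ If (Hyp2) holds, then in addition, for every $x\in E$ and every $\varepsilon>0$, $$\lim_{k\to\infty}\sup_{t\in[s+\varepsilon,T]}\|y^k_{s,x}(t)-y_{s,x}(t)\|_E=0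 .$$ -/

import Mathlib

open Set Filter Topology MeasureTheory

noncomputable section

/-- A single-valued, not necessarily linear, partial map `f : D(f) ⊆ V → V`, given by its graph `G`,
is m-dissipative: `‖x - y‖ ≤ ‖x - y - α (f x - f y)‖` for all `α > 0` and `x, y ∈ D(f)`, and
`l I - f` is onto `V` for some `l > 0`. -/
def MDissipative {V : Type*} [NormedAddCommGroup V] [NormedSpace ℝ V] (G : Set (V × V)) : Prop :=
  (∀ p ∈ G, ∀ q ∈ G, ∀ α : ℝ, 0 < α → ‖p.1 - q.1‖ ≤ ‖p.1 - q.1 - α • (p.2 - q.2)‖) ∧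
  ∃ l : ℝ, 0 < l ∧ ∀ v : V, ∃ p ∈ G, l • p.1 - p.2 = v

/-- The graph of `x ↦ f x - ζ x` with domain `D`. -/
def shiftedGraph {V : Type*} [NormedAddCommGroup V] [NormedSpace ℝ V]
    (D : Set V) (f : V → V) (ζ : ℝ) : Set (V × V) :=
  {p | p.1 ∈ D ∧ p.2 = f p.1 - ζ • p.1}

/-- The part in `E` of a partial map of `H` with graph `G`, where `E` is embedded in `H` by the
injection `ι`: its domain consists of those `x ∈ E` in the domain whose image lies in `E`. -/
def partGraph {E H : Type*} [NormedAddCommGroup E] [NormedSpace ℝ E]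
    [NormedAddCommGroup H] [NormedSpace ℝ H] (ι : E →L[ℝ] H) (G : Set (H × H)) : Set (E × E) :=
  {p | (ι p.1, ι p.2) ∈ G}

/-- The values of the part in `E` of `f`: the element `u` of `E` with `ι u = f (ι x)`
(meaningful when `f (ι x)` lies in the range of `ι`). -/
def partMap {E H : Type*} [NormedAddCommGroup E] [NormedSpace ℝ E]
    [NormedAddCommGroup H] [NormedSpace ℝ H] (ι : E →L[ℝ] H) (f : H → H) (x : E) : E :=
  Function.invFun ι (f (ι x))

/-- The nonlinear resolvent `J_k x`: the solution `z ∈ D` of `z - (1/k) (f z - ζ z) = x`. -/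
def yosidaResolvent {V : Type*} [NormedAddCommGroup V] [NormedSpace ℝ V]
    (D : Set V) (f : V → V) (ζ : ℝ) (k : ℕ) (x : V) : V :=
  Function.invFunOn (fun z : V => z - (1 / (k : ℝ)) • (f z - ζ • z)) D x

/-- The Yosida approximation `F_k x = F (J_k x)`. -/
def yosidaMap {V : Type*} [NormedAddCommGroup V] [NormedSpace ℝ V]
    (D : Set V) (f : V → V) (ζ : ℝ) (k : ℕ) (x : V) : V :=
  f (yosidaResolvent D f ζ k x)

/-- `B` is the Yosida approximation `n A R(n, A)` of the linear operator `A` with graph `G`: if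
`z = R(n, A) x`, that is `n z - A z = x`, then `B x = n A z`. -/
def IsLinearYosida {V : Type*} [NormedAddCommGroup V] [NormedSpace ℝ V]
    (G : Set (V × V)) (n : ℕ) (B : V →L[ℝ] V) : Prop :=
  ∀ x : V, ∃ p ∈ G, (n : ℝ) • p.1 - p.2 = x ∧ B x = (n : ℝ) • p.2

/-- `W t s` (`0 ≤ s ≤ t ≤ T`) is the evolution operator of the bounded operators `B t`: the function
`t ↦ W t s x` is the strict solution of `u' = B(t) u` on `[s, T]`, `u(s) = x`. -/
def IsEvolutionOfBounded {V : Type*} [NormedAddCommGroup V] [NormedSpace ℝ V]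
    (T : ℝ) (B : ℝ → V →L[ℝ] V) (W : ℝ → ℝ → V →L[ℝ] V) : Prop :=
  ∀ s ∈ Icc 0 T, ∀ x : V, W s s x = x ∧
    ∀ t ∈ Icc s T, HasDerivWithinAt (fun τ => W τ s x) (B t (W t s x)) (Icc s T) t

/-- `U t s` (`0 ≤ s ≤ t ≤ T`) is a strongly continuous (forward) evolution operator. -/
structure IsStronglyContinuousEvolution {V : Type*} [NormedAddCommGroup V] [NormedSpace ℝ V]
    (T : ℝ) (U : ℝ → ℝ → V →L[ℝ] V) : Prop where
  refl : ∀ t ∈ Icc 0 T, U t t = ContinuousLinearMap.id ℝ V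
  comp : ∀ s r t : ℝ, 0 ≤ s → s ≤ r → r ≤ t → t ≤ T → U t s = (U t r).comp (U r s)
  cont : ∀ x : V, ContinuousOn (fun p : ℝ × ℝ => U p.2 p.1 x)
    {p : ℝ × ℝ | 0 ≤ p.1 ∧ p.1 ≤ p.2 ∧ p.2 ≤ T}

/-- The standing assumptions. `ι` is the embedding of `E` in `H`, `D` is the domain of `F t`,
`A t` is the linear operator with its domain, and `U` is the evolution operator on `H`. -/
structure StandingHypothesis {E H : Type*} [NormedAddCommGroup E] [NormedSpace ℝ E]
    [NormedAddCommGroup H] [InnerProductSpace ℝ H]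
    (T : ℝ) (ι : E →L[ℝ] H) (D : Set H) (F : ℝ → H → H) (ζ : ℝ)
    (A : ℝ → H →ₗ.[ℝ] H) (U : ℝ → ℝ → H →L[ℝ] H) : Prop where
  embedding_injective : Function.Injective ι
  embedding_dense : DenseRange ι
  range_subset : range ι ⊆ D
  /-- `F(t, ·)` maps bounded sets of `E` into bounded sets of `H`. -/
  F_bounded : ∀ t ∈ Icc 0 T, ∀ S : Set E, Bornology.IsBounded S →
    Bornology.IsBounded ((fun x => F t (ι x)) '' S)
  /-- For `x ∈ E` the map `t ↦ F_E(t, x)` takes values in `E` and is continuous. -/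
  F_mem : ∀ t ∈ Icc 0 T, ∀ x : E, F t (ι x) ∈ range ι
  F_cont : ∀ x : E, ContinuousOn (fun t => partMap ι (F t) x) (Icc 0 T)
  F_mdissipative : ∀ t ∈ Icc 0 T, MDissipative (shiftedGraph D (F t) ζ)
  F_part_mdissipative : ∀ t ∈ Icc 0 T, MDissipative (partGraph ι (shiftedGraph D (F t) ζ))
  A_closed : ∀ t ∈ Icc 0 T, (A t).IsClosed
  A_mdissipative : ∀ t ∈ Icc 0 T, MDissipative ((A t).graph : Set (H × H))
  A_part_mdissipative : ∀ t ∈ Icc 0 T, MDissipative (partGraph ι ((A t).graph : Set (H × H)))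
  evolution : IsStronglyContinuousEvolution T U
  /-- `UE` is the restriction of `U` to `E`, `An n` the Yosida approximations of the part of `A` in
  `E`, and `Un n` the evolution operator of `An n`. -/
  evolution_part : ∃ (UE : ℝ → ℝ → E →L[ℝ] E) (An : ℕ → ℝ → E →L[ℝ] E)
      (Un : ℕ → ℝ → ℝ → E →L[ℝ] E),
    (∀ s t : ℝ, 0 ≤ s → s ≤ t → t ≤ T → ∀ x : E, ι (UE t s x) = U t s (ι x)) ∧
    (∀ x : E, ContinuousOn (fun p : ℝ × ℝ => UE p.2 p.1 x)
      {p : ℝ × ℝ | 0 ≤ p.1 ∧ p.1 < p.2 ∧ p.2 ≤ T}) ∧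
    (∀ n : ℕ, 1 ≤ n → ∀ t ∈ Icc 0 T,
      IsLinearYosida (partGraph ι ((A t).graph : Set (H × H))) n (An n t)) ∧
    (∀ n : ℕ, 1 ≤ n → ContinuousOn (An n) (Icc 0 T)) ∧
    (∀ n : ℕ, 1 ≤ n → IsEvolutionOfBounded T (An n) (Un n)) ∧
    (∀ s t : ℝ, 0 ≤ s → s ≤ t → t ≤ T →
      Tendsto (fun n => ‖Un n t s - UE t s‖) atTop (𝓝 0))
  /-- Measurability and integrability of `t ↦ F_E(t, f(t)) ∈ E` for continuous `f`. -/
  F_integrable : ∀ f : ℝ → E, ContinuousOn f (Icc 0 T) →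
    IntegrableOn (fun t => partMap ι (F t) (f t)) (Icc 0 T)

/-- First alternative: `E` is reflexive, `F(t, x₀) = ζ x₀`, and `F(t, ·)` is weakly continuous along
sequences that are bounded in `E` and convergent in `H`. -/
structure ReflexiveCase {E H : Type*} [NormedAddCommGroup E] [NormedSpace ℝ E]
    [NormedAddCommGroup H] [InnerProductSpace ℝ H]
    (T : ℝ) (ι : E →L[ℝ] H) (F : ℝ → H → H) (ζ : ℝ) : Prop where
  reflexive : Function.Surjective (NormedSpace.inclusionInDoubleDual ℝ E)
  fixed : ∃ x₀ : E, ∀ t ∈ Icc 0 T, F t (ι x₀) = ζ • ι x₀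
  weak_cont : ∀ (v : ℕ → E) (y : E), Bornology.IsBounded (range v) →
    Tendsto (fun n => ι (v n)) atTop (𝓝 (ι y)) →
    ∀ t ∈ Icc 0 T, ∀ z : E,
      Tendsto (fun n => |inner ℝ (F t (ι (v n)) - F t (ι y)) (ι z)|) atTop (𝓝 0)

/-- Second alternative: `F(t, ·)` maps `E` into itself and is Lipschitz continuous in `E` on bounded
sets, uniformly in `t`. -/
structure LipschitzCase {E H : Type*} [NormedAddCommGroup E] [NormedSpace ℝ E]
    [NormedAddCommGroup H] [InnerProductSpace ℝ H]
    (T : ℝ) (ι : E →L[ℝ] H) (F : ℝ → H → H) : Prop where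
  maps : ∀ t ∈ Icc 0 T, ∀ x : E, F t (ι x) ∈ range ι
  lipschitz : ∀ S : Set E, Bornology.IsBounded S → ∃ L : ℝ, 0 < L ∧
    ∀ t ∈ Icc 0 T, ∀ z₁ ∈ S, ∀ z₂ ∈ S,
      ‖partMap ι (F t) z₁ - partMap ι (F t) z₂‖ ≤ L * ‖z₁ - z₂‖

/-- `y` is a mild solution on `[s, T]` of `y' = A(t) y + Φ(t, y + f(t))`, `y(s) = x`, in the class
`C([s, T]; H) ∩ C_b((s, T]; E)`; only the values of `y` on `[s, T]` matter. -/
structure IsMildSolution {E H : Type*} [NormedAddCommGroup E] [NormedSpace ℝ E]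
    [NormedAddCommGroup H] [InnerProductSpace ℝ H]
    (ι : E →L[ℝ] H) (U : ℝ → ℝ → H →L[ℝ] H) (Φ : ℝ → H → H) (f : ℝ → E) (s T : ℝ) (x : E)
    (y : ℝ → E) : Prop where
  cont_H : ContinuousOn (fun t => ι (y t)) (Icc s T)
  cont_E : ContinuousOn y (Ioc s T)
  bounded_E : Bornology.IsBounded (y '' Ioc s T)
  integrable : IntegrableOn (fun r => Φ r (ι (y r + f r))) (Ioc s T)
  mild : ∀ t ∈ Icc s T,
    ι (y t) = U t s (ι x) + ∫ r in s..t, U t r (Φ r (ι (y r + f r)))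

/-- `y` is the unique mild solution in the class `C([s, T]; H) ∩ C_b((s, T]; E)`. -/
def IsUniqueMildSolution {E H : Type*} [NormedAddCommGroup E] [NormedSpace ℝ E]
    [NormedAddCommGroup H] [InnerProductSpace ℝ H]
    (ι : E →L[ℝ] H) (U : ℝ → ℝ → H →L[ℝ] H) (Φ : ℝ → H → H) (f : ℝ → E) (s T : ℝ) (x : E)
    (y : ℝ → E) : Prop :=
  IsMildSolution ι U Φ f s T x y ∧
    ∀ v : ℝ → E, IsMildSolution ι U Φ f s T x v → EqOn v y (Icc s T)

end

/-!
# Well-posedness in `C([s, T]; H) ∩ C_b((s, T]; E)` of a dissipative evolution equation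

Write `F_E(t, ·) = ζ + G t`. Then `G t` is an everywhere defined m-dissipative map of `E` which is
also dissipative for the norm of `H`, and the equation reads
`y' = A(t) y + ζ (y + f) + G(t, y + f)`.
Three ideas carry the proof.

*Dissipative estimates for mild solutions.* A mild solution `u` for the forcing term `g` satisfies
`‖u(t) - h g(t)‖ ≤ ‖u(t - h)‖ + o(h)` at every Lebesgue point `t` of `g`, because the evolution
operators are contractions. If `g` is `ω`-dissipative along `u` up to an error `m`, this bounds the
left difference quotients of `‖u‖` by `ω ‖u‖ + m`, and a Gronwall lemma
(`le_exp_add_integral_of_ae_left_slope`) gives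
`‖u(t)‖ ≤ e^{ω(t-s)} ‖u(s)‖ + ∫ e^{ω(t-r)} m(r) dr`
(`IsContractionEvolution.norm_le_of_dissipative`). In `H` this settles uniqueness, the two
estimates, and the convergence of the solutions for the Yosida approximations, whose consistency
error tends to `0` in `L¹`. In `E` the operators `U(t, s)` need not be strongly continuous at the
diagonal; the estimate is then derived for the approximations `U_n(t, s)` and passed to the limit,
for Lipschitz nonlinearities (`ApproximatedEvolution.norm_le_of_lipschitz`) and, through Yosida
approximations, in the reflexive case (`IsMildFor.norm_le_of_reflexive`).

*Recentring.* If `c` is a path, `v ↦ G(t, c + v) - G(t, c)` is again m-dissipative and vanishes at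
`0`. An a priori bound for `v' = A v + ζ v + G(c + v) - G(c) + q` thus contains the bound for `y`,
with `c = f`, and the contraction estimate for two solutions, with `c = y₂ + f` and `q = 0`.

*Existence.* In the locally Lipschitz case the nonlinearity is composed with the radial retraction
onto a ball of `E`, which keeps it dissipative at `0`; the a priori bound shows that the Picard
solution never leaves the ball. In the reflexive case no bound of `G` in `E` on bounded sets is
available. Instead, integrability along all continuous paths implies an integrable bound which is
common to all paths close to a given continuous path (`exists_lintegral_iSup_bound`): paths
violating it could be glued together. Hence the recentred equation is solvable for small `q`
(`exists_small_solution`): the Yosida solutions stay in a small ball of `E`, are Cauchy in `H` by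
monotonicity, and the equation passes to the weak limit, which lies in `E` by reflexivity. A
continuity method in the size of `q`, started from the path `U(t, s) x + f(t)`, then solves the
equation (`exists_recentred_solution`). That path is continuous in `E` up to `t = s` because
contractions of a separable reflexive space that converge strongly in `H` converge strongly in `E`
(`tendsto_of_tendsto_map_of_contraction`).
-/

noncomputable section

/-! ### Contraction evolution families and their convolutions -/

/-- `W t s`, `0 ≤ s ≤ t ≤ T`, is an evolution family of contractions of `V` that is strongly
continuous off the diagonal `s = t`; strong continuity at the diagonal is not required. -/
structure IsContractionEvolution {V : Type*} [NormedAddCommGroup V] [NormedSpace ℝ V]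
    (T : ℝ) (W : ℝ → ℝ → V →L[ℝ] V) : Prop where
  contr : ∀ s t : ℝ, 0 ≤ s → s ≤ t → t ≤ T → ∀ x, ‖W t s x‖ ≤ ‖x‖
  refl : ∀ t ∈ Icc 0 T, ∀ x, W t t x = x
  comp : ∀ s r t : ℝ, 0 ≤ s → s ≤ r → r ≤ t → t ≤ T → ∀ x, W t s x = W t r (W r s x)
  cont : ∀ x : V, ContinuousOn (fun p : ℝ × ℝ => W p.2 p.1 x)
    {p : ℝ × ℝ | 0 ≤ p.1 ∧ p.1 < p.2 ∧ p.2 ≤ T}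

namespace IsContractionEvolution

variable {V : Type*} [NormedAddCommGroup V] [NormedSpace ℝ V] {T : ℝ} {W : ℝ → ℝ → V →L[ℝ] V}

theorem aestronglyMeasurable (hW : IsContractionEvolution T W) {s t : ℝ} (hs : 0 ≤ s)
    (ht : t ≤ T) {g : ℝ → V} (hg : AEStronglyMeasurable g (volume.restrict (Ioc s t))) :
    AEStronglyMeasurable (fun r => W t r (g r)) (volume.restrict (Ioc s t)) := by
  have key : ∀ a, s ≤ a → a < t →
      AEStronglyMeasurable (fun r => W t r (g r)) (volume.restrict (Ioc s a)) := by
    intro a hsa hat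
    have hg' : AEStronglyMeasurable g (volume.restrict (Ioc s a)) :=
      hg.mono_measure (Measure.restrict_mono (Ioc_subset_Ioc_right hat.le) le_rfl)
    have hc : Continuous (fun p : ℝ × V => W t (max s (min p.1 a)) p.2) := by
      refine continuous_prod_of_continuous_lipschitzWith' _ 1 (fun r => ?_) (fun v => ?_)
      · refine LipschitzWith.of_dist_le_mul fun v w => ?_
        rw [dist_eq_norm, dist_eq_norm, ← map_sub, NNReal.coe_one, one_mul]
        exact hW.contr _ _ (hs.trans (le_max_left _ _))
          (max_le (hsa.trans hat.le) ((min_le_right _ _).trans hat.le)) ht _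
      · refine (hW.cont v).comp_continuous
          (f := fun r : ℝ => ((max s (min r a), t) : ℝ × ℝ)) (by fun_prop) fun r => ?_
        exact ⟨hs.trans (le_max_left _ _),
          max_lt (hsa.trans_lt hat) ((min_le_right _ _).trans_lt hat), ht⟩
    have h1 := hc.comp_aestronglyMeasurable
      ((continuous_id.aestronglyMeasurable (μ := volume.restrict (Ioc s a))).prodMk hg')
    refine h1.congr ?_
    filter_upwards [ae_restrict_mem measurableSet_Ioc] with r hr
    simp [min_eq_left hr.2, max_eq_right hr.1.le]
  rcases le_or_gt t s with hts | hst
  · simp [Ioc_eq_empty (not_lt.2 hts)]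
  rw [← restrict_Ioo_eq_restrict_Ioc]
  have : Ioo s t = ⋃ n : ℕ, Ioc s (t - (t - s) / (n + 1)) := by
    ext r
    simp only [mem_Ioo, mem_iUnion, mem_Ioc]
    constructor
    · rintro ⟨h1, h2⟩
      obtain ⟨n, hn⟩ := exists_nat_gt ((t - s) / (t - r))
      refine ⟨n, h1, ?_⟩
      have h3 : 0 < t - r := by linarith
      rw [div_lt_iff₀ h3] at hn
      have : (t - s) / (n + 1) ≤ t - r := by
        rw [div_le_iff₀ (by positivity)]
        nlinarith
      linarith
    · rintro ⟨n, h1, h2⟩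
      refine ⟨h1, h2.trans_lt ?_⟩
      have : 0 < (t - s) / (n + 1) := div_pos (by linarith) (by positivity)
      linarith
  rw [this, aestronglyMeasurable_iUnion_iff]
  intro n
  have h0 : 0 < (t - s) / (n + 1) := div_pos (by linarith) (by positivity)
  have h1 : (t - s) / (n + 1) ≤ t - s := div_le_self (by linarith) (by simp)
  exact key _ (by linarith) (by linarith)

theorem integrableOn (hW : IsContractionEvolution T W) {s t : ℝ} (hs : 0 ≤ s)
    (ht : t ≤ T) {g : ℝ → V} (hg : IntegrableOn g (Ioc s t)) :
    IntegrableOn (fun r => W t r (g r)) (Ioc s t) := by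
  refine Integrable.mono hg (hW.aestronglyMeasurable hs ht hg.aestronglyMeasurable) ?_
  filter_upwards [ae_restrict_mem measurableSet_Ioc] with r hr
  exact hW.contr _ _ (hs.trans hr.1.le) hr.2 ht _

theorem intervalIntegrable (hW : IsContractionEvolution T W) {s t a b : ℝ} (hs : 0 ≤ s)
    (ht : t ≤ T) (hsa : s ≤ a) (hab : a ≤ b) (hbt : b ≤ t) {g : ℝ → V}
    (hg : IntegrableOn g (Ioc s T)) :
    IntervalIntegrable (fun r => W t r (g r)) volume a b := by
  rw [intervalIntegrable_iff_integrableOn_Ioc_of_le hab]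
  exact (hW.integrableOn hs ht (hg.mono_set (Ioc_subset_Ioc_right ht))).mono_set
    (Ioc_subset_Ioc hsa hbt)

theorem norm_integral_le (hW : IsContractionEvolution T W) {s t a b : ℝ} (hs : 0 ≤ s)
    (ht : t ≤ T) (hsa : s ≤ a) (hab : a ≤ b) (hbt : b ≤ t) {g : ℝ → V}
    (hg : IntegrableOn g (Ioc s T)) :
    ‖∫ r in a..b, W t r (g r)‖ ≤ ∫ r in a..b, ‖g r‖ := by
  refine intervalIntegral.norm_integral_le_of_norm_le hab ?_ ?_
  · filter_upwards with r hr
    exact hW.contr _ _ (by linarith [hr.1]) (by linarith [hr.2]) ht _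
  · rw [intervalIntegrable_iff_integrableOn_Ioc_of_le hab]
    exact (hg.mono_set (Ioc_subset_Ioc hsa (hbt.trans ht))).norm

theorem continuousOn_convolution (hW : IsContractionEvolution T W) {s : ℝ} (hs : 0 ≤ s)
    {g : ℝ → V} (hg : IntegrableOn g (Ioc s T)) :
    ContinuousOn (fun t => ∫ r in s..t, W t r (g r)) (Icc s T) := by
  intro t₀ ht₀
  have hrep : ∀ t ∈ Icc s T, (∫ r in s..t, W t r (g r)) =
      ∫ r in Ioc s T, (Ioc s t).indicator (fun r => W t r (g r)) r := by
    intro t ht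
    rw [intervalIntegral.integral_of_le ht.1, integral_indicator measurableSet_Ioc,
      Measure.restrict_restrict measurableSet_Ioc,
      inter_eq_self_of_subset_left (Ioc_subset_Ioc_right ht.2)]
  refine ContinuousWithinAt.congr ?_ hrep (hrep t₀ ht₀)
  refine tendsto_integral_filter_of_dominated_convergence (fun r => ‖g r‖) ?_ ?_ hg.norm ?_
  · filter_upwards [self_mem_nhdsWithin] with t ht
    rw [aestronglyMeasurable_indicator_iff measurableSet_Ioc,
      Measure.restrict_restrict measurableSet_Ioc,
      inter_eq_self_of_subset_left (Ioc_subset_Ioc_right ht.2)]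
    exact hW.aestronglyMeasurable hs ht.2
      (hg.mono_set (Ioc_subset_Ioc_right ht.2)).aestronglyMeasurable
  · filter_upwards [self_mem_nhdsWithin] with t ht
    filter_upwards with r
    by_cases hr : r ∈ Ioc s t
    · rw [indicator_of_mem hr]
      exact hW.contr _ _ (hs.trans hr.1.le) hr.2 ht.2 _
    · rw [indicator_of_notMem hr]
      simp
  · have hne : ∀ᵐ r ∂(volume.restrict (Ioc s T)), r ≠ t₀ :=
      ae_restrict_of_ae (by simp [ae_iff])
    filter_upwards [hne, ae_restrict_mem measurableSet_Ioc] with r hr hrs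
    rcases lt_or_gt_of_ne hr with h | h
    · have hc : Tendsto (fun t => W t r (g r)) (𝓝[Icc s T] t₀) (𝓝 (W t₀ r (g r))) := by
        have := (hW.cont (g r)) (r, t₀) ⟨hs.trans hrs.1.le, h, ht₀.2⟩
        refine this.tendsto.comp (f := fun t : ℝ => ((r, t) : ℝ × ℝ)) ?_
        refine tendsto_nhdsWithin_iff.2 ⟨?_, ?_⟩
        · exact (by fun_prop :
            Continuous fun t : ℝ => ((r, t) : ℝ × ℝ)).continuousAt.tendsto.mono_left
              nhdsWithin_le_nhds
        · filter_upwards [self_mem_nhdsWithin, mem_nhdsWithin_of_mem_nhds (Ioi_mem_nhds h)]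
            with t ht htr
          exact ⟨hs.trans hrs.1.le, htr, ht.2⟩
      rw [indicator_of_mem (show r ∈ Ioc s t₀ from ⟨hrs.1, h.le⟩)]
      refine hc.congr' ?_
      filter_upwards [mem_nhdsWithin_of_mem_nhds (Ioi_mem_nhds h)] with t htr
      rw [indicator_of_mem (show r ∈ Ioc s t from ⟨hrs.1, le_of_lt htr⟩)]
    · rw [indicator_of_notMem (fun hh : r ∈ Ioc s t₀ => absurd hh.2 (not_le.2 h))]
      refine tendsto_const_nhds.congr' ?_
      filter_upwards [mem_nhdsWithin_of_mem_nhds (Iio_mem_nhds h)] with t htr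
      rw [indicator_of_notMem (fun hh : r ∈ Ioc s t => absurd hh.2 (not_le.2 htr))]

theorem continuousOn_orbit (hW : IsContractionEvolution T W) {s : ℝ} (hs : 0 ≤ s) (x : V) :
    ContinuousOn (fun t => W t s x) (Ioc s T) := by
  refine (hW.cont x).comp (f := fun t : ℝ => ((s, t) : ℝ × ℝ)) (by fun_prop) fun t ht => ?_
  exact ⟨hs, ht.1, ht.2⟩

/-- A mild solution can be restarted at any intermediate time. -/
theorem restart [CompleteSpace V] (hW : IsContractionEvolution T W) {s : ℝ} (hs : 0 ≤ s)
    {g : ℝ → V} (hg : IntegrableOn g (Ioc s T)) {x : V} {u : ℝ → V}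
    (hu : ∀ t ∈ Icc s T, u t = W t s x + ∫ r in s..t, W t r (g r)) {a b : ℝ}
    (hsa : s ≤ a) (hab : a ≤ b) (hb : b ≤ T) :
    u b = W b a (u a) + ∫ r in a..b, W b r (g r) := by
  rw [hu b ⟨hsa.trans hab, hb⟩, hu a ⟨hsa, hab.trans hb⟩, map_add,
    ← hW.comp s a b hs hsa hab hb,
    ← (W b a).intervalIntegral_comp_comm
      (hW.intervalIntegrable hs (hab.trans hb) le_rfl hsa le_rfl hg),
    ← intervalIntegral.integral_add_adjacent_intervals
      (hW.intervalIntegrable hs hb le_rfl hsa hab hg)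
      (hW.intervalIntegrable hs hb hsa hab le_rfl hg), add_assoc]
  congr 2
  refine intervalIntegral.integral_congr fun r hr => ?_
  rw [uIcc_of_le hsa] at hr
  exact hW.comp r a b (hs.trans hr.1) hr.2 hab hb _

end IsContractionEvolution

/-! ### Differential inequalities for mild solutions -/

/-- A Gronwall inequality from one-sided information. The function `p` may jump down and is not the
integral of its derivative; but an upper bound for its increments makes a primitive minus
`e^{-ω t} p(t)` monotone, a monotone function grows at least by the integral of its derivative, and
that derivative is controlled by the left slopes of `p`. -/
theorem le_exp_add_integral_of_ae_left_slope {p κ m : ℝ → ℝ} {s b ω M : ℝ} (hsb : s ≤ b)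
    (hp : ∀ t ∈ Icc s b, |p t| ≤ M) (hκ : IntegrableOn κ (Ioc s b))
    (hκ0 : ∀ r, 0 ≤ κ r)
    (hinc : ∀ a c, s ≤ a → a ≤ c → c ≤ b → p c - p a ≤ ∫ r in a..c, κ r)
    (hm : IntegrableOn m (Ioc s b))
    (hslope : ∀ᵐ t ∂volume.restrict (Ioo s b), ∀ ε > 0, ∀ᶠ h in 𝓝[>] (0 : ℝ),
      p t - p (t - h) ≤ h * (ω * p t + m t + ε)) :
    p b ≤ Real.exp (ω * (b - s)) * p s + ∫ r in s..b, Real.exp (ω * (b - r)) * m r := by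
  set e : ℝ → ℝ := fun t => Real.exp (-(ω * t)) with he
  have hed : ∀ t, HasDerivAt e (-ω * e t) t := by
    intro t
    have h1 : HasDerivAt (fun t : ℝ => -(ω * t)) (-ω) t := by
      simpa using ((hasDerivAt_id t).const_mul ω).fun_neg
    simpa [he, mul_comm] using h1.exp
  have hec : Continuous e := by fun_prop
  obtain ⟨C, hC⟩ : ∃ C, ∀ t ∈ Icc s b, e t ≤ C := by
    obtain ⟨C, hC⟩ := isCompact_Icc.exists_bound_of_continuousOn (hec.continuousOn (s := Icc s b))
    exact ⟨C, fun t ht => (le_abs_self _).trans (hC t ht)⟩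
  have hepos : ∀ t, 0 < e t := fun t => Real.exp_pos _
  have hC0 : 0 ≤ C := (hepos s).le.trans (hC s ⟨le_rfl, hsb⟩)
  have hM0 : 0 ≤ M := (abs_nonneg _).trans (hp s ⟨le_rfl, hsb⟩)
  have hκi : IntervalIntegrable κ volume s b :=
    (intervalIntegrable_iff_integrableOn_Ioc_of_le hsb).2 hκ
  set f : ℝ → ℝ := fun t => C * (∫ r in s..t, κ r) + |ω| * C * M * t - e t * p t with hf
  have hmono : MonotoneOn f (uIcc s b) := by
    rw [uIcc_of_le hsb]
    intro a ha c hc hac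
    have hsub : ∀ x y, s ≤ x → x ≤ y → y ≤ b → IntervalIntegrable κ volume x y :=
      fun x y h1 h2 h3 => hκi.mono_set (by rw [uIcc_of_le hsb, uIcc_of_le h2]; exact Icc_subset_Icc h1 h3)
    have h1 : (∫ r in s..c, κ r) = (∫ r in s..a, κ r) + ∫ r in a..c, κ r :=
      (intervalIntegral.integral_add_adjacent_intervals (hsub _ _ le_rfl ha.1 ha.2)
        (hsub _ _ ha.1 hac hc.2)).symm
    have h2 : e c * (p c - p a) ≤ C * ∫ r in a..c, κ r := by
      have h3 := hinc a c ha.1 hac hc.2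
      have h4 : 0 ≤ ∫ r in a..c, κ r :=
        intervalIntegral.integral_nonneg hac fun r _ => hκ0 r
      calc e c * (p c - p a) ≤ e c * ∫ r in a..c, κ r :=
            mul_le_mul_of_nonneg_left h3 (hepos c).le
        _ ≤ _ := mul_le_mul_of_nonneg_right (hC c hc) h4
    have h5 : |e c - e a| ≤ |ω| * C * (c - a) := by
      have := (convex_Icc s b).norm_image_sub_le_of_norm_hasDerivWithin_le (f := e)
        (f' := fun t => -ω * e t) (C := |ω| * C) (x := a) (y := c)
        (fun t _ => (hed t).hasDerivWithinAt) (fun t ht => by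
          rw [norm_mul, norm_neg, Real.norm_eq_abs, Real.norm_eq_abs, abs_of_pos (hepos t)]
          exact mul_le_mul_of_nonneg_left (hC t ht) (abs_nonneg _)) ha hc
      simpa [abs_of_nonneg (sub_nonneg.2 hac)] using this
    have h6 : (e c - e a) * p a ≤ |ω| * C * (c - a) * M := by
      calc (e c - e a) * p a ≤ |(e c - e a) * p a| := le_abs_self _
        _ = |e c - e a| * |p a| := abs_mul _ _
        _ ≤ _ := mul_le_mul h5 (hp a ha) (abs_nonneg _)
          (mul_nonneg (mul_nonneg (abs_nonneg _) hC0) (sub_nonneg.2 hac))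
    simp only [hf, h1]
    nlinarith
  have hle : (∫ t in s..b, deriv f t) ≤ f b - f s := by
    have := hmono.intervalIntegral_deriv_mem_uIcc
    rw [uIcc_of_le (sub_nonneg.2 (hmono left_mem_uIcc right_mem_uIcc hsb))] at this
    exact this.2
  have hderiv : ∀ᵐ t ∂volume.restrict (Ioo s b),
      C * κ t + |ω| * C * M - e t * m t ≤ deriv f t := by
    have h1 := hmono.ae_differentiableWithinAt_of_mem
    have h2 := hκi.ae_hasDerivAt_integral
    filter_upwards [ae_restrict_of_ae h1, ae_restrict_of_ae h2, hslope,
      ae_restrict_mem measurableSet_Ioo] with t ht1 ht2 ht3 ht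
    have htm : t ∈ uIcc s b := by rw [uIcc_of_le hsb]; exact Ioo_subset_Icc_self ht
    have hfd : DifferentiableAt ℝ f t := by
      refine (ht1 htm).differentiableAt ?_
      rw [uIcc_of_le hsb]
      exact Icc_mem_nhds ht.1 ht.2
    have hK : HasDerivAt (fun t => C * (∫ r in s..t, κ r) + |ω| * C * M * t)
        (C * κ t + |ω| * C * M) t := by
      have h3 := ((ht2 htm s left_mem_uIcc).const_mul C).fun_add
        ((hasDerivAt_id t).const_mul (|ω| * C * M))
      simpa using h3
    have hQ : HasDerivAt (fun t => e t * p t) (C * κ t + |ω| * C * M - deriv f t) t := by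
      have := hK.sub hfd.hasDerivAt
      refine this.congr_of_eventuallyEq (Eventually.of_forall fun r => ?_)
      simp [hf]
    set q := C * κ t + |ω| * C * M - deriv f t
    have hpd : HasDerivAt p (ω * p t + Real.exp (ω * t) * q) t := by
      have h4 : HasDerivAt (fun t : ℝ => Real.exp (ω * t)) (ω * Real.exp (ω * t)) t := by
        have h5 : HasDerivAt (fun t : ℝ => ω * t) ω t := by
          simpa using (hasDerivAt_id t).const_mul ω
        simpa [mul_comm] using h5.exp
      have h6 := h4.mul hQ
      have h7 : ∀ r, Real.exp (ω * r) * e r = 1 := fun r => by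
        simp only [he]; rw [← Real.exp_add]; simp
      have h8 : ω * Real.exp (ω * t) * (e t * p t) + Real.exp (ω * t) * q
          = ω * p t + Real.exp (ω * t) * q := by
        linear_combination (ω * p t) * h7 t
      rw [h8] at h6
      refine h6.congr_of_eventuallyEq (Eventually.of_forall fun r => ?_)
      simp only [Pi.mul_apply]
      rw [← mul_assoc, h7, one_mul]
    have hbound : ω * p t + Real.exp (ω * t) * q ≤ ω * p t + m t := by
      refine le_of_forall_pos_le_add fun ε hε => ?_
      have hlim : Tendsto (fun h => h⁻¹ * (p t - p (t - h))) (𝓝[>] (0 : ℝ))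
          (𝓝 (ω * p t + Real.exp (ω * t) * q)) := by
        have h9 := (hasDerivAt_iff_tendsto_slope_zero.1 hpd)
        have h10 : Tendsto (fun h : ℝ => -h) (𝓝[>] (0 : ℝ)) (𝓝[≠] (0 : ℝ)) := by
          refine tendsto_nhdsWithin_iff.2 ⟨?_, ?_⟩
          · have : Tendsto (fun h : ℝ => -h) (𝓝 0) (𝓝 0) := by
              simpa using (continuous_neg (G := ℝ)).tendsto 0
            exact this.mono_left nhdsWithin_le_nhds
          · filter_upwards [self_mem_nhdsWithin] with h hh
            simpa using (ne_of_gt hh)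
        refine (h9.comp h10).congr fun h => ?_
        simp only [Function.comp, smul_eq_mul, inv_neg, ← sub_eq_add_neg]
        ring
      refine le_of_tendsto hlim ?_
      filter_upwards [ht3 ε hε, self_mem_nhdsWithin] with h hh hpos
      have hpos' : (0 : ℝ) < h := hpos
      rw [inv_mul_le_iff₀ hpos']
      exact hh
    have h11 : q ≤ e t * m t := by
      have h12 : Real.exp (ω * t) * q ≤ m t := by linarith
      have h13 : e t * Real.exp (ω * t) = 1 := by
        simp only [he]; rw [← Real.exp_add]; simp
      calc q = e t * (Real.exp (ω * t) * q) := by rw [← mul_assoc, h13, one_mul]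
        _ ≤ _ := mul_le_mul_of_nonneg_left h12 (hepos t).le
    simp only [q] at h11
    linarith
  have hmi : IntervalIntegrable (fun t => e t * m t) volume s b := by
    have : IntervalIntegrable m volume s b :=
      (intervalIntegrable_iff_integrableOn_Ioc_of_le hsb).2 hm
    exact this.continuousOn_mul hec.continuousOn
  have hint : (∫ t in s..b, (C * κ t + |ω| * C * M - e t * m t)) ≤ ∫ t in s..b, deriv f t := by
    refine intervalIntegral.integral_mono_ae_restrict hsb
      (((hκi.const_mul C).add intervalIntegrable_const).sub hmi)
      hmono.intervalIntegrable_deriv ?_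
    rw [← restrict_Ioo_eq_restrict_Icc]
    exact hderiv
  rw [intervalIntegral.integral_sub ((hκi.const_mul C).add intervalIntegrable_const) hmi,
    intervalIntegral.integral_add (hκi.const_mul C) intervalIntegrable_const,
    intervalIntegral.integral_const_mul, intervalIntegral.integral_const] at hint
  have hfinal : e b * p b ≤ e s * p s + ∫ t in s..b, e t * m t := by
    simp only [hf, intervalIntegral.integral_same, smul_eq_mul] at hle hint
    linarith
  have hmul := mul_le_mul_of_nonneg_left hfinal (Real.exp_pos (ω * b)).le
  have h14 : ∀ r, Real.exp (ω * b) * e r = Real.exp (ω * (b - r)) := fun r => by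
    simp only [he]; rw [← Real.exp_add]; ring_nf
  rw [mul_add, ← mul_assoc, ← mul_assoc, h14, h14, sub_self, mul_zero, Real.exp_zero, one_mul,
    ← intervalIntegral.integral_const_mul] at hmul
  simpa only [← mul_assoc, h14] using hmul

namespace IsContractionEvolution

variable {V : Type*} [NormedAddCommGroup V] [NormedSpace ℝ V] [CompleteSpace V]
  {T : ℝ} {W : ℝ → ℝ → V →L[ℝ] V}

/-- At every Lebesgue point of the forcing term `g`, a mild solution `u` is comparable with one
step of the implicit Euler scheme for `u' = g`: the linear part only decreases norms. -/
theorem ae_norm_sub_smul_le (hW : IsContractionEvolution T W)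
    (hleft : ∀ t ∈ Ioc 0 T, ∀ x, Tendsto (fun r => W t r x) (𝓝[<] t) (𝓝 x)) {s : ℝ} (hs : 0 ≤ s)
    {g : ℝ → V} (hg : IntegrableOn g (Ioc s T)) {x : V} {u : ℝ → V}
    (hu : ∀ t ∈ Icc s T, u t = W t s x + ∫ r in s..t, W t r (g r)) :
    ∀ᵐ t ∂volume.restrict (Ioo s T), ∀ ε > 0, ∀ᶠ h in 𝓝[>] (0 : ℝ),
      ‖u t - h • g t‖ ≤ ‖u (t - h)‖ + h * ε := by
  set g' := (Ioc s T).indicator g with hg'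
  have hgi : Integrable g' := (integrable_indicator_iff measurableSet_Ioc).2 hg
  have hL := IsUnifLocDoublingMeasure.ae_tendsto_average_norm_sub (μ := (volume : Measure ℝ))
    hgi.locallyIntegrable 1
  filter_upwards [ae_restrict_of_ae hL, ae_restrict_mem measurableSet_Ioo] with t hLt ht ε hε
  have hlim := hLt (l := 𝓝[>] (0 : ℝ)) (fun h => t - h / 2) (fun h => h / 2) (by
      refine tendsto_nhdsWithin_iff.2 ⟨?_, ?_⟩
      · have : Tendsto (fun h : ℝ => h / 2) (𝓝 0) (𝓝 (0 / 2)) :=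
          (continuous_id.div_const 2).tendsto 0
        rw [zero_div] at this
        exact this.mono_left nhdsWithin_le_nhds
      · filter_upwards [self_mem_nhdsWithin] with h hh
        exact half_pos (show (0 : ℝ) < h from hh)) (by
      filter_upwards [self_mem_nhdsWithin] with h hh
      have hh' : (0 : ℝ) < h := hh
      rw [Metric.mem_closedBall, Real.dist_eq, one_mul]
      rw [show t - (t - h / 2) = h / 2 by ring, abs_of_pos (half_pos hh')])
  have hsmall : ∀ᶠ h in 𝓝[>] (0 : ℝ), h < t - s :=
    mem_nhdsWithin_of_mem_nhds (Iio_mem_nhds (by linarith [ht.1]))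
  have hWt : ∀ᶠ h in 𝓝[>] (0 : ℝ), ∀ r ∈ Ioo (t - h) t, ‖W t r (g t) - g t‖ ≤ ε / 2 := by
    have h1 := (hleft t ⟨hs.trans_lt ht.1, ht.2.le⟩ (g t))
    have h2 : ∀ᶠ r in 𝓝[<] t, ‖W t r (g t) - g t‖ ≤ ε / 2 := by
      filter_upwards [Metric.tendsto_nhds.1 h1 (ε / 2) (half_pos hε)] with r hr
      rw [dist_eq_norm] at hr
      exact hr.le
    obtain ⟨l, hl, hl2⟩ := (mem_nhdsLT_iff_exists_Ioo_subset).1 h2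
    have hl' : l < t := hl
    filter_upwards [mem_nhdsWithin_of_mem_nhds (Iio_mem_nhds (sub_pos.2 hl'))] with h hh r hr
    have hh' : h < t - l := hh
    exact hl2 ⟨by linarith [hr.1], hr.2⟩
  filter_upwards [hlim.eventually (gt_mem_nhds (half_pos hε)), hsmall, hWt, self_mem_nhdsWithin]
    with h h1 h2 h3 h4
  have h4' : (0 : ℝ) < h := h4
  have hball : Metric.closedBall (t - h / 2) (h / 2) = Icc (t - h) t := by
    rw [Real.closedBall_eq_Icc]; congr 1 <;> ring
  rw [hball, setAverage_eq, Measure.real, Real.volume_Icc, show t - (t - h) = h by ring,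
    ENNReal.toReal_ofReal h4'.le, integral_Icc_eq_integral_Ioc, smul_eq_mul,
    inv_mul_lt_iff₀ h4'] at h1
  have hcongr : (∫ r in Ioc (t - h) t, ‖g' r - g' t‖) = ∫ r in (t - h)..t, ‖g r - g t‖ := by
    rw [intervalIntegral.integral_of_le (by linarith)]
    refine setIntegral_congr_fun measurableSet_Ioc fun r hr => ?_
    simp only [hg']
    rw [indicator_of_mem (show r ∈ Ioc s T from ⟨by linarith [hr.1], hr.2.trans ht.2.le⟩),
      indicator_of_mem (show t ∈ Ioc s T from ⟨ht.1, ht.2.le⟩)]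
  rw [hcongr] at h1
  have hsub : IntervalIntegrable g volume (t - h) t := by
    rw [intervalIntegrable_iff_integrableOn_Ioc_of_le (by linarith)]
    exact hg.mono_set (Ioc_subset_Ioc (by linarith) ht.2.le)
  have hWi := hW.intervalIntegrable hs ht.2.le (show s ≤ t - h by linarith) (by linarith) le_rfl hg
  have heq : u t - h • g t = W t (t - h) (u (t - h)) + ∫ r in (t - h)..t, (W t r (g r) - g t) := by
    rw [hW.restart hs hg hu (show s ≤ t - h by linarith) (by linarith) ht.2.le,
      intervalIntegral.integral_sub hWi intervalIntegrable_const, intervalIntegral.integral_const,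
      show t - (t - h) = h by ring, add_sub_assoc]
  rw [heq]
  refine (norm_add_le _ _).trans (add_le_add
    (hW.contr _ _ (by linarith) (by linarith) ht.2.le _) ?_)
  have hbd : ‖∫ r in (t - h)..t, (W t r (g r) - g t)‖ ≤
      ∫ r in (t - h)..t, (‖g r - g t‖ + ε / 2) := by
    refine intervalIntegral.norm_integral_le_of_norm_le (by linarith) ?_
      ((hsub.sub intervalIntegrable_const).norm.add intervalIntegrable_const)
    have hne : ∀ᵐ r : ℝ, r ≠ t := by simp [ae_iff]
    filter_upwards [hne] with r hrt hr
    have hr' : r ∈ Ioo (t - h) t := ⟨hr.1, lt_of_le_of_ne hr.2 hrt⟩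
    calc ‖W t r (g r) - g t‖ = ‖W t r (g r - g t) + (W t r (g t) - g t)‖ := by
          rw [map_sub]; congr 1; abel
      _ ≤ _ := (norm_add_le _ _).trans (add_le_add
          (hW.contr _ _ (by linarith [hr.1]) hr.2 ht.2.le _) (h3 r hr'))
  refine hbd.trans ?_
  rw [intervalIntegral.integral_add (hsub.sub intervalIntegrable_const).norm
    intervalIntegrable_const, intervalIntegral.integral_const, show t - (t - h) = h by ring,
    smul_eq_mul]
  linarith

theorem norm_le_add_integral (hW : IsContractionEvolution T W) {s : ℝ} (hs : 0 ≤ s)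
    {g : ℝ → V} (hg : IntegrableOn g (Ioc s T)) {x : V} {u : ℝ → V}
    (hu : ∀ t ∈ Icc s T, u t = W t s x + ∫ r in s..t, W t r (g r)) {a b : ℝ}
    (hsa : s ≤ a) (hab : a ≤ b) (hb : b ≤ T) :
    ‖u b‖ ≤ ‖u a‖ + ∫ r in a..b, ‖g r‖ := by
  rw [hW.restart hs hg hu hsa hab hb]
  exact (norm_add_le _ _).trans (add_le_add (hW.contr _ _ (hs.trans hsa) hab hb _)
    (hW.norm_integral_le hs hb hsa hab le_rfl hg))

theorem norm_le_bound (hW : IsContractionEvolution T W) {s : ℝ} (hs : 0 ≤ s)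
    {g : ℝ → V} (hg : IntegrableOn g (Ioc s T)) {x : V} {u : ℝ → V}
    (hu : ∀ t ∈ Icc s T, u t = W t s x + ∫ r in s..t, W t r (g r)) :
    ∀ t ∈ Icc s T, ‖u t‖ ≤ ‖u s‖ + ∫ r in s..T, ‖g r‖ := by
  intro t ht
  refine (hW.norm_le_add_integral hs hg hu le_rfl ht.1 ht.2).trans (add_le_add le_rfl ?_)
  refine intervalIntegral.integral_mono_interval le_rfl ht.1 ht.2
    (Eventually.of_forall fun r => norm_nonneg _) ?_
  rw [intervalIntegrable_iff_integrableOn_Ioc_of_le (ht.1.trans ht.2)]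
  exact Integrable.norm hg

/-- The mild form of the estimate `‖u‖' ≤ ω ‖u‖ + m` for a forcing term `g` that is
`ω`-dissipative along `u` up to `m`. -/
theorem norm_le_of_dissipative (hW : IsContractionEvolution T W)
    (hleft : ∀ t ∈ Ioc 0 T, ∀ x, Tendsto (fun r => W t r x) (𝓝[<] t) (𝓝 x)) {s : ℝ} (hs : 0 ≤ s)
    {g : ℝ → V} (hg : IntegrableOn g (Ioc s T)) {x : V} {u : ℝ → V}
    (hu : ∀ t ∈ Icc s T, u t = W t s x + ∫ r in s..t, W t r (g r)) {ω : ℝ} {m : ℝ → ℝ}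
    (hm : IntegrableOn m (Ioc s T))
    (hdiss : ∀ᵐ r ∂volume.restrict (Ioc s T), ∀ α > 0,
      (1 - α * ω) * ‖u r‖ ≤ ‖u r - α • g r‖ + α * m r) {t : ℝ} (ht : t ∈ Icc s T) :
    ‖u t‖ ≤ Real.exp (ω * (t - s)) * ‖u s‖ + ∫ r in s..t, Real.exp (ω * (t - r)) * m r := by
  refine le_exp_add_integral_of_ae_left_slope (p := fun r => ‖u r‖) (κ := fun r => ‖g r‖)
    (M := ‖u s‖ + ∫ r in s..T, ‖g r‖) ht.1 (fun r hr => ?_)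
    (hg.mono_set (Ioc_subset_Ioc_right ht.2)).norm (fun r => norm_nonneg _)
    (fun a c h1 h2 h3 => ?_) (hm.mono_set (Ioc_subset_Ioc_right ht.2)) ?_
  · rw [abs_norm]
    exact hW.norm_le_bound hs hg hu r ⟨hr.1, hr.2.trans ht.2⟩
  · have := hW.norm_le_add_integral hs hg hu h1 h2 (h3.trans ht.2)
    linarith
  · have h1 := ae_mono (Measure.restrict_mono (Ioo_subset_Ioo_right ht.2) le_rfl)
      (hW.ae_norm_sub_smul_le hleft hs hg hu)
    have h2 := ae_mono (Measure.restrict_mono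
      (Ioo_subset_Ioc_self.trans (Ioc_subset_Ioc_right ht.2)) le_rfl) hdiss
    filter_upwards [h1, h2] with r hr1 hr2 ε hε
    filter_upwards [hr1 ε hε, self_mem_nhdsWithin] with h hh hpos
    have := hr2 h hpos
    linarith

/-- The Hilbert space version of `norm_le_of_dissipative` for squares: `⟪g, u⟫ ≤ ω ‖u‖² + m`
integrates to a bound for `‖u‖²`. -/
theorem norm_sq_le_of_inner_le {V : Type*} [NormedAddCommGroup V] [InnerProductSpace ℝ V]
    [CompleteSpace V] {W : ℝ → ℝ → V →L[ℝ] V} (hW : IsContractionEvolution T W)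
    (hleft : ∀ t ∈ Ioc 0 T, ∀ x, Tendsto (fun r => W t r x) (𝓝[<] t) (𝓝 x)) {s : ℝ} (hs : 0 ≤ s)
    {g : ℝ → V} (hg : IntegrableOn g (Ioc s T)) {x : V} {u : ℝ → V}
    (hu : ∀ t ∈ Icc s T, u t = W t s x + ∫ r in s..t, W t r (g r)) {ω : ℝ} {m : ℝ → ℝ}
    (hm : IntegrableOn m (Ioc s T))
    (hdiss : ∀ᵐ r ∂volume.restrict (Ioc s T), inner ℝ (g r) (u r) ≤ ω * ‖u r‖ ^ 2 + m r)
    {t : ℝ} (ht : t ∈ Icc s T) :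
    ‖u t‖ ^ 2 ≤ Real.exp (2 * ω * (t - s)) * ‖u s‖ ^ 2 +
      ∫ r in s..t, Real.exp (2 * ω * (t - r)) * (2 * m r) := by
  set M := ‖u s‖ + ∫ r in s..T, ‖g r‖ with hM
  have hbd := hW.norm_le_bound hs hg hu
  have hM0 : 0 ≤ M := (norm_nonneg _).trans (hbd t ht)
  refine le_exp_add_integral_of_ae_left_slope (p := fun r => ‖u r‖ ^ 2)
    (κ := fun r => (2 * M) * ‖g r‖)
    (M := M ^ 2) ht.1 (fun r hr => ?_)
    ((hg.mono_set (Ioc_subset_Ioc_right ht.2)).norm.const_mul _)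
    (fun r => by positivity)
    (fun a c h1 h2 h3 => ?_) ((hm.mono_set (Ioc_subset_Ioc_right ht.2)).const_mul _) ?_
  · rw [abs_of_nonneg (by positivity)]
    exact pow_le_pow_left₀ (norm_nonneg _) (hbd r ⟨hr.1, hr.2.trans ht.2⟩) 2
  · have h4 := hW.norm_le_add_integral hs hg hu h1 h2 (h3.trans ht.2)
    have h5 := hbd a ⟨h1, h2.trans (h3.trans ht.2)⟩
    have h6 := hbd c ⟨h1.trans h2, h3.trans ht.2⟩
    have h7 : 0 ≤ ∫ r in a..c, ‖g r‖ :=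
      intervalIntegral.integral_nonneg h2 fun r _ => norm_nonneg _
    rw [intervalIntegral.integral_const_mul]
    have h8 : ‖u c‖ ^ 2 - ‖u a‖ ^ 2 = (‖u c‖ - ‖u a‖) * (‖u c‖ + ‖u a‖) := by ring
    rw [h8]
    calc (‖u c‖ - ‖u a‖) * (‖u c‖ + ‖u a‖) ≤ (∫ r in a..c, ‖g r‖) * (‖u c‖ + ‖u a‖) :=
          mul_le_mul_of_nonneg_right (by linarith) (by positivity)
      _ ≤ (∫ r in a..c, ‖g r‖) * (2 * M) := mul_le_mul_of_nonneg_left (by linarith) h7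
      _ = _ := mul_comm _ _
  · have h1 := ae_mono (Measure.restrict_mono (Ioo_subset_Ioo_right ht.2) le_rfl)
      (hW.ae_norm_sub_smul_le hleft hs hg hu)
    have h2 := ae_mono (Measure.restrict_mono
      (Ioo_subset_Ioc_self.trans (Ioc_subset_Ioc_right ht.2)) le_rfl) hdiss
    filter_upwards [h1, h2, ae_restrict_mem measurableSet_Ioo] with r hr1 hr2 hrm ε hε
    -- the error `h ε'` of the slope enters the square with the factor `2 M + h ε'`
    have hε' : 0 < min 1 (ε / (2 * M + 1)) := lt_min one_pos (div_pos hε (by linarith))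
    filter_upwards [hr1 _ hε', self_mem_nhdsWithin,
      mem_nhdsWithin_of_mem_nhds (Iio_mem_nhds one_pos),
      mem_nhdsWithin_of_mem_nhds (Iio_mem_nhds (sub_pos.2 hrm.1))] with h hh hpos hlt1 hlt
    have hpos' : (0 : ℝ) < h := hpos
    have hlt1' : h < 1 := hlt1
    have hlt' : h < r - s := hlt
    set δ := min 1 (ε / (2 * M + 1)) with hδ
    have hδ1 : δ ≤ 1 := min_le_left _ _
    have hδ2 : δ * (2 * M + 1) ≤ ε := by
      rw [← le_div_iff₀ (by linarith)]; exact min_le_right _ _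
    have h3 : ‖u r - h • g r‖ ^ 2 = ‖u r‖ ^ 2 - 2 * h * inner ℝ (g r) (u r) + h ^ 2 * ‖g r‖ ^ 2 := by
      rw [norm_sub_sq_real, inner_smul_right, real_inner_comm, norm_smul, Real.norm_eq_abs,
        abs_of_pos hpos']
      ring
    have h4 : ‖u r - h • g r‖ ^ 2 ≤ (‖u (r - h)‖ + h * δ) ^ 2 :=
      pow_le_pow_left₀ (norm_nonneg _) hh 2
    have h5 : ‖u (r - h)‖ ≤ M := hbd _ ⟨by linarith, by linarith [hrm.2, ht.2]⟩
    have h6 : (‖u (r - h)‖ + h * δ) ^ 2 ≤ ‖u (r - h)‖ ^ 2 + h * ε := by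
      have : (‖u (r - h)‖ + h * δ) ^ 2 = ‖u (r - h)‖ ^ 2 + h * (δ * (2 * ‖u (r - h)‖ + h * δ)) := by
        ring
      rw [this]
      have h7 : δ * (2 * ‖u (r - h)‖ + h * δ) ≤ δ * (2 * M + 1) :=
        mul_le_mul_of_nonneg_left (by nlinarith) hε'.le
      nlinarith
    have h8 : 0 ≤ h ^ 2 * ‖g r‖ ^ 2 := by positivity
    have h9 : h * inner ℝ (g r) (u r) ≤ h * (ω * ‖u r‖ ^ 2 + m r) :=
      mul_le_mul_of_nonneg_left hr2 hpos'.le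
    nlinarith

end IsContractionEvolution

/-! ### The evolution families of the linear part -/

theorem tendsto_left_of_continuousOn_closed_triangle {V : Type*} [NormedAddCommGroup V]
    [NormedSpace ℝ V] {T : ℝ} {W : ℝ → ℝ → V →L[ℝ] V}
    (hrefl : ∀ t ∈ Icc 0 T, ∀ x, W t t x = x) (x : V)
    (hc : ContinuousOn (fun p : ℝ × ℝ => W p.2 p.1 x)
      {p : ℝ × ℝ | 0 ≤ p.1 ∧ p.1 ≤ p.2 ∧ p.2 ≤ T}) :
    ∀ t ∈ Ioc 0 T, Tendsto (fun r => W t r x) (𝓝[<] t) (𝓝 x) := by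
  intro t ht
  have h1 := hc (t, t) ⟨ht.1.le, le_rfl, ht.2⟩
  have h2 : Tendsto (fun r : ℝ => ((r, t) : ℝ × ℝ)) (𝓝[<] t)
      (𝓝[{p : ℝ × ℝ | 0 ≤ p.1 ∧ p.1 ≤ p.2 ∧ p.2 ≤ T}] (t, t)) := by
    refine tendsto_nhdsWithin_iff.2 ⟨?_, ?_⟩
    · exact (by fun_prop : Continuous fun r : ℝ => ((r, t) : ℝ × ℝ)).continuousAt.tendsto.mono_left
        nhdsWithin_le_nhds
    · filter_upwards [self_mem_nhdsWithin, mem_nhdsWithin_of_mem_nhds (Ioi_mem_nhds ht.1)]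
        with r hr hr0
      exact ⟨le_of_lt hr0, le_of_lt hr, ht.2⟩
  have h3 := h1.tendsto.comp h2
  simpa only [Function.comp_def, hrefl t ⟨ht.1.le, ht.2⟩ x] using h3

/-- If `‖L (B x + n x)‖ ≤ n ‖L x‖`, then `e^{n t} L u` grows at most like `e^{n t}` along solutions
of `u' = B u`, so that `‖L u‖` does not increase. -/
theorem norm_map_le_of_hasDerivWithinAt {V Z : Type*} [NormedAddCommGroup V] [NormedSpace ℝ V]
    [NormedAddCommGroup Z] [NormedSpace ℝ Z] {s T n : ℝ} {B : ℝ → V →L[ℝ] V} (L : V →L[ℝ] Z)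
    (hB : ∀ t ∈ Icc s T, ∀ x, ‖L (B t x) + n • L x‖ ≤ n * ‖L x‖) {u : ℝ → V}
    (hu : ∀ t ∈ Icc s T, HasDerivWithinAt u (B t (u t)) (Icc s T) t) {t : ℝ} (ht : t ∈ Icc s T) :
    ‖L (u t)‖ ≤ ‖L (u s)‖ := by
  have hexp : ∀ t, HasDerivAt (fun t : ℝ => Real.exp (n * (t - s))) (Real.exp (n * (t - s)) * n)
      t := by
    intro t
    have : HasDerivAt (fun t : ℝ => n * (t - s)) n t := by
      simpa using ((hasDerivAt_id t).sub_const s).const_mul n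
    exact this.exp
  have hv : ∀ t ∈ Icc s T, HasDerivWithinAt (fun t => Real.exp (n * (t - s)) • L (u t))
      (Real.exp (n * (t - s)) • L (B t (u t)) + (Real.exp (n * (t - s)) * n) • L (u t))
      (Icc s T) t := by
    intro t ht
    exact (hexp t).hasDerivWithinAt.fun_smul (L.hasFDerivAt.comp_hasDerivWithinAt t (hu t ht))
  have := norm_le_gronwallBound_of_norm_deriv_right_le (a := s) (b := T)
    (f := fun t => Real.exp (n * (t - s)) • L (u t))
    (f' := fun t => Real.exp (n * (t - s)) • L (B t (u t)) + (Real.exp (n * (t - s)) * n) • L (u t))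
    (δ := ‖L (u s)‖) (K := n) (ε := 0) (fun t ht => (hv t ht).continuousWithinAt)
    (fun t ht => (hv t ⟨ht.1, ht.2.le⟩).mono_of_mem_nhdsWithin (Icc_mem_nhdsGE_of_mem ht))
    (by simp) (fun t ht => by
      rw [mul_smul, ← smul_add, norm_smul, norm_smul, add_zero]
      have := mul_le_mul_of_nonneg_left (hB t ⟨ht.1, ht.2.le⟩ (u t))
        (norm_nonneg (Real.exp (n * (t - s))))
      linarith) t ht
  rw [gronwallBound_ε0, norm_smul, Real.norm_eq_abs, abs_of_pos (Real.exp_pos _), mul_comm] at this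
  exact le_of_mul_le_mul_right this (Real.exp_pos _)

/-- The evolution operator of bounded operators `B t` with `‖B + n‖ ≤ n` is a family of contractions
that is strongly continuous up to the diagonal. -/
theorem IsEvolutionOfBounded.isContractionEvolution {V : Type*} [NormedAddCommGroup V]
    [NormedSpace ℝ V] {T n : ℝ} {B : ℝ → V →L[ℝ] V} {W : ℝ → ℝ → V →L[ℝ] V}
    (hBc : ContinuousOn B (Icc 0 T)) (hB : ∀ t ∈ Icc 0 T, ∀ x, ‖B t x + n • x‖ ≤ n * ‖x‖)
    (hW : IsEvolutionOfBounded T B W) :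
    IsContractionEvolution T W ∧
      ∀ t ∈ Ioc 0 T, ∀ x, Tendsto (fun r => W t r x) (𝓝[<] t) (𝓝 x) := by
  obtain ⟨M, hM⟩ := isCompact_Icc.exists_bound_of_continuousOn hBc
  have hsol : ∀ s, 0 ≤ s → ∀ u : ℝ → V,
      (∀ t ∈ Icc s T, HasDerivWithinAt u (B t (u t)) (Icc s T) t) →
      ∀ t ∈ Icc s T, ‖u t‖ ≤ ‖u s‖ := by
    intro s hs u hu t ht
    exact norm_map_le_of_hasDerivWithinAt (n := n) (ContinuousLinearMap.id ℝ V)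
      (fun t ht x => hB t ⟨hs.trans ht.1, ht.2⟩ x) hu ht
  have hcontr : ∀ s t : ℝ, 0 ≤ s → s ≤ t → t ≤ T → ∀ x, ‖W t s x‖ ≤ ‖x‖ := by
    intro s t hs hst ht x
    have h := hW s ⟨hs, hst.trans ht⟩ x
    have := hsol s hs (fun τ => W τ s x) h.2 t ⟨hst, ht⟩
    simpa only [h.1] using this
  have hrefl : ∀ t ∈ Icc 0 T, ∀ x, W t t x = x := fun t ht x => (hW t ht x).1
  have hcomp : ∀ s r t : ℝ, 0 ≤ s → s ≤ r → r ≤ t → t ≤ T → ∀ x, W t s x = W t r (W r s x) := by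
    intro s r t hs hsr hrt ht x
    have h1 := (hW s ⟨hs, hsr.trans (hrt.trans ht)⟩ x).2
    have h2 := hW r ⟨hs.trans hsr, hrt.trans ht⟩ (W r s x)
    have h3 := hsol r (hs.trans hsr) (fun τ => W τ s x - W τ r (W r s x)) (fun τ hτ => by
      have := ((h1 τ ⟨hsr.trans hτ.1, hτ.2⟩).mono (Icc_subset_Icc_left hsr)).fun_sub (h2.2 τ hτ)
      rwa [← map_sub] at this) t ⟨hrt, ht⟩
    simp only [h2.1, sub_self, norm_zero, norm_le_zero_iff] at h3
    exact sub_eq_zero.1 h3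
  have hlip1 : ∀ x s t t', 0 ≤ s → s ≤ t → s ≤ t' → t ≤ T → t' ≤ T →
      ‖W t' s x - W t s x‖ ≤ M * ‖x‖ * |t' - t| := by
    intro x s t t' hs hst hst' ht ht'
    refine (convex_Icc s T).norm_image_sub_le_of_norm_hasDerivWithin_le (f := fun τ => W τ s x)
      (fun τ hτ => (hW s ⟨hs, hst.trans ht⟩ x).2 τ hτ) (fun τ hτ => ?_) ⟨hst, ht⟩ ⟨hst', ht'⟩
    exact (B τ).le_of_opNorm_le_of_le (hM τ ⟨hs.trans hτ.1, hτ.2⟩) (hcontr s τ hs hτ.1 hτ.2 x)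
  have hlip2 : ∀ x s s' t, 0 ≤ s → s ≤ s' → s' ≤ t → t ≤ T →
      ‖W t s x - W t s' x‖ ≤ M * ‖x‖ * |s' - s| := by
    intro x s s' t hs hss' hs't ht
    rw [hcomp s s' t hs hss' hs't ht, ← map_sub]
    refine (hcontr s' t (hs.trans hss') hs't ht _).trans ?_
    have := hlip1 x s s s' hs le_rfl hss' (hss'.trans (hs't.trans ht)) (hs't.trans ht)
    rwa [hrefl s ⟨hs, hss'.trans (hs't.trans ht)⟩] at this
  have hlip3 : ∀ x s s' t, 0 ≤ s → 0 ≤ s' → s ≤ t → s' ≤ t → t ≤ T →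
      ‖W t s x - W t s' x‖ ≤ M * ‖x‖ * |s' - s| := by
    intro x s s' t hs hs' hst hs't ht
    rcases le_total s s' with h | h
    · exact hlip2 x s s' t hs h hs't ht
    · rw [norm_sub_rev, abs_sub_comm]
      exact hlip2 x s' s t hs' h hst ht
  have hclosed : ∀ x, ContinuousOn (fun p : ℝ × ℝ => W p.2 p.1 x)
      {p : ℝ × ℝ | 0 ≤ p.1 ∧ p.1 ≤ p.2 ∧ p.2 ≤ T} := by
    rintro x ⟨s₀, t₀⟩ ⟨hs₀, hst₀, ht₀⟩
    simp only at hs₀ hst₀ ht₀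
    rw [ContinuousWithinAt, tendsto_iff_norm_sub_tendsto_zero]
    have hlim : Tendsto (fun p : ℝ × ℝ => M * ‖x‖ * (2 * |p.2 - t₀| + |p.1 - s₀|))
        (𝓝[{p : ℝ × ℝ | 0 ≤ p.1 ∧ p.1 ≤ p.2 ∧ p.2 ≤ T}] (s₀, t₀)) (𝓝 0) := by
      have : Continuous (fun p : ℝ × ℝ => M * ‖x‖ * (2 * |p.2 - t₀| + |p.1 - s₀|)) := by fun_prop
      have h := this.tendsto (s₀, t₀)
      simp only [sub_self, abs_zero, mul_zero, add_zero] at h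
      exact h.mono_left nhdsWithin_le_nhds
    refine squeeze_zero' (Eventually.of_forall fun _ => norm_nonneg _) ?_ hlim
    filter_upwards [self_mem_nhdsWithin] with p hp
    obtain ⟨h1, h2, h3⟩ := hp
    set t₁ := max p.2 t₀ with ht₁
    have h4 : t₁ ≤ T := max_le h3 ht₀
    have h5 : p.2 ≤ t₁ := le_max_left _ _
    have h6 : t₀ ≤ t₁ := le_max_right _ _
    have e1 := hlip1 x p.1 t₁ p.2 h1 (h2.trans h5) h2 h4 h3
    have e2 := hlip3 x p.1 s₀ t₁ h1 hs₀ (h2.trans h5) (hst₀.trans h6) h4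
    have e3 := hlip1 x s₀ t₀ t₁ hs₀ hst₀ (hst₀.trans h6) ht₀ h4
    have e4 : |p.2 - t₁| + |t₁ - t₀| ≤ 2 * |p.2 - t₀| := by
      rcases le_total p.2 t₀ with h | h
      · rw [ht₁, max_eq_right h]; simp; linarith [abs_nonneg (p.2 - t₀)]
      · rw [ht₁, max_eq_left h]; simp; linarith [abs_nonneg (p.2 - t₀)]
    have hM0 : 0 ≤ M * ‖x‖ := mul_nonneg ((norm_nonneg _).trans
      (hM s₀ ⟨hs₀, hst₀.trans ht₀⟩)) (norm_nonneg _)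
    have e5 : ‖W p.2 p.1 x - W t₀ s₀ x‖ ≤ ‖W p.2 p.1 x - W t₁ p.1 x‖ +
        ‖W t₁ p.1 x - W t₁ s₀ x‖ + ‖W t₁ s₀ x - W t₀ s₀ x‖ := by
      have := norm_add₃_le (a := W p.2 p.1 x - W t₁ p.1 x) (b := W t₁ p.1 x - W t₁ s₀ x)
        (c := W t₁ s₀ x - W t₀ s₀ x)
      simpa using this
    have e6 : |s₀ - p.1| = |p.1 - s₀| := abs_sub_comm _ _
    rw [e6] at e2
    nlinarith
  exact ⟨⟨hcontr, hrefl, hcomp, fun x => (hclosed x).mono fun p hp => ⟨hp.1, hp.2.1.le, hp.2.2⟩⟩,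
    fun t ht x => tendsto_left_of_continuousOn_closed_triangle hrefl x (hclosed x) t ht⟩

/-- What the argument uses of the linear part: the evolution family `U` on `H`, its restriction `UE`
to `E`, and the evolution families `Un n` of bounded operators that approximate `UE`; only `U` and
the `Un n` are strongly continuous at the diagonal. -/
structure ApproximatedEvolution {E H : Type*} [NormedAddCommGroup E] [NormedSpace ℝ E]
    [NormedAddCommGroup H] [InnerProductSpace ℝ H] (T : ℝ) (ι : E →L[ℝ] H)
    (U : ℝ → ℝ → H →L[ℝ] H) (UE : ℝ → ℝ → E →L[ℝ] E) (Un : ℕ → ℝ → ℝ → E →L[ℝ] E) : Prop where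
  evolH : IsContractionEvolution T U
  leftH : ∀ t ∈ Ioc 0 T, ∀ x, Tendsto (fun r => U t r x) (𝓝[<] t) (𝓝 x)
  orbitH : ∀ s, 0 ≤ s → ∀ x, ContinuousOn (fun t => U t s x) (Icc s T)
  evolE : IsContractionEvolution T UE
  evoln : ∀ n, IsContractionEvolution T (Un n)
  leftn : ∀ n, ∀ t ∈ Ioc 0 T, ∀ x, Tendsto (fun r => Un n t r x) (𝓝[<] t) (𝓝 x)
  lim : ∀ s t : ℝ, 0 ≤ s → s ≤ t → t ≤ T → ∀ x, Tendsto (fun n => Un n t s x) atTop (𝓝 (UE t s x))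
  comm : ∀ s t : ℝ, 0 ≤ s → s ≤ t → t ≤ T → ∀ x, ι (UE t s x) = U t s (ι x)

/-- The Yosida approximation `B` of a dissipative linear operator satisfies `B + n = n² R(n)`, whose
norm is at most `n`. -/
theorem norm_map_yosida_add_le {E V : Type*} [NormedAddCommGroup E] [NormedSpace ℝ E]
    [NormedAddCommGroup V] [NormedSpace ℝ V] (L : E →L[ℝ] V) {G : Set (E × E)}
    (hG : ∀ p ∈ G, ∀ α : ℝ, 0 < α → ‖L p.1‖ ≤ ‖L p.1 - α • L p.2‖) {n : ℕ} (hn : 1 ≤ n)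
    {B : E →L[ℝ] E} (hB : IsLinearYosida G n B) (x : E) :
    ‖L (B x) + (n : ℝ) • L x‖ ≤ n * ‖L x‖ := by
  obtain ⟨p, hp, h1, h2⟩ := hB x
  have hn0 : (0 : ℝ) < n := by exact_mod_cast hn
  have h3 := hG p hp (1 / n) (by positivity)
  have h4 : L x = (n : ℝ) • (L p.1 - (1 / (n : ℝ)) • L p.2) := by
    rw [← h1, smul_sub, smul_smul, mul_one_div_cancel hn0.ne', one_smul, map_sub, map_smul]
  have h5 : L (B x) + (n : ℝ) • L x = ((n : ℝ) * n) • L p.1 := by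
    rw [h2, ← h1, map_sub, map_smul, map_smul, smul_sub, smul_smul]; abel
  rw [h5, h4, norm_smul, norm_smul, Real.norm_of_nonneg (by positivity),
    Real.norm_of_nonneg hn0.le, mul_assoc]
  gcongr

theorem StandingHypothesis.exists_approximatedEvolution {E H : Type*} [NormedAddCommGroup E]
    [NormedSpace ℝ E] [NormedAddCommGroup H] [InnerProductSpace ℝ H]
    {T : ℝ} {ι : E →L[ℝ] H} {D : Set H} {F : ℝ → H → H} {ζ : ℝ}
    {A : ℝ → H →ₗ.[ℝ] H} {U : ℝ → ℝ → H →L[ℝ] H} (hS : StandingHypothesis T ι D F ζ A U) :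
    ∃ UE Un, ApproximatedEvolution T ι U UE Un := by
  obtain ⟨UE, An, Un, hcomm, hcont, hyos, hAc, hev, hlim⟩ := hS.evolution_part
  have hE0 : ∀ t ∈ Icc 0 T, ∀ p ∈ partGraph ι ((A t).graph : Set (H × H)), ∀ α : ℝ, 0 < α →
      ‖p.1‖ ≤ ‖p.1 - α • p.2‖ := by
    intro t ht p hp α hα
    have h0 : ((0 : E), (0 : E)) ∈ partGraph ι ((A t).graph : Set (H × H)) := by
      show (ι 0, ι 0) ∈ ((A t).graph : Set (H × H))
      rw [map_zero]
      exact (A t).graph.zero_mem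
    simpa using (hS.A_part_mdissipative t ht).1 p hp _ h0 α hα
  have hH0 : ∀ t ∈ Icc 0 T, ∀ p ∈ partGraph ι ((A t).graph : Set (H × H)), ∀ α : ℝ, 0 < α →
      ‖ι p.1‖ ≤ ‖ι p.1 - α • ι p.2‖ := by
    intro t ht p hp α hα
    have := (hS.A_mdissipative t ht).1 (ι p.1, ι p.2) hp 0 (A t).graph.zero_mem α hα
    simpa using this
  have hUn : ∀ n, IsContractionEvolution T (Un (n + 1)) ∧
      ∀ t ∈ Ioc 0 T, ∀ x, Tendsto (fun r => Un (n + 1) t r x) (𝓝[<] t) (𝓝 x) := fun n =>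
    (hev (n + 1) (by omega)).isContractionEvolution (n := ((n + 1 : ℕ) : ℝ))
      (hAc (n + 1) (by omega)) fun t ht x =>
        norm_map_yosida_add_le (ContinuousLinearMap.id ℝ E) (hE0 t ht) (by omega)
          (hyos (n + 1) (by omega) t ht) x
  have hlim' : ∀ s t : ℝ, 0 ≤ s → s ≤ t → t ≤ T → ∀ x,
      Tendsto (fun n => Un (n + 1) t s x) atTop (𝓝 (UE t s x)) := by
    intro s t hs hst ht x
    have h1 := (tendsto_add_atTop_iff_nat 1).2 (hlim s t hs hst ht)
    rw [tendsto_iff_norm_sub_tendsto_zero]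
    have h2 := h1.mul_const ‖x‖
    rw [zero_mul] at h2
    refine squeeze_zero (fun _ => norm_nonneg _) (fun n => ?_) h2
    rw [← sub_apply]
    exact ContinuousLinearMap.le_opNorm _ _
  have hcontrH : ∀ s t : ℝ, 0 ≤ s → s ≤ t → t ≤ T → ∀ x, ‖U t s x‖ ≤ ‖x‖ := by
    intro s t hs hst ht
    refine fun x => hS.embedding_dense.induction_on (p := fun x => ‖U t s x‖ ≤ ‖x‖) x ?_ ?_
    · exact isClosed_le (by fun_prop) (by fun_prop)
    · intro x
      rw [← hcomm s t hs hst ht x]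
      refine le_of_tendsto ((ι.continuous.tendsto _).comp (hlim' s t hs hst ht x)).norm
        (Eventually.of_forall fun n => ?_)
      have h := hev (n + 1) (by omega) s ⟨hs, hst.trans ht⟩ x
      have := norm_map_le_of_hasDerivWithinAt (n := ((n + 1 : ℕ) : ℝ)) ι
        (fun t ht x => norm_map_yosida_add_le ι (hH0 t ⟨hs.trans ht.1, ht.2⟩) (by omega)
          (hyos (n + 1) (by omega) t ⟨hs.trans ht.1, ht.2⟩) x) h.2 ⟨hst, ht⟩
      simpa only [h.1, Function.comp_def] using this
  have hreflH : ∀ t ∈ Icc 0 T, ∀ x, U t t x = x := by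
    intro t ht x
    rw [hS.evolution.refl t ht]; rfl
  refine ⟨UE, fun n => Un (n + 1), ?_⟩
  refine ⟨⟨hcontrH, hreflH, ?_, ?_⟩, ?_, ?_, ⟨?_, ?_, ?_, hcont⟩, fun n => (hUn n).1,
    fun n => (hUn n).2, hlim', hcomm⟩
  · intro s r t hs hsr hrt ht x
    rw [hS.evolution.comp s r t hs hsr hrt ht]; rfl
  · exact fun x => (hS.evolution.cont x).mono fun p hp => ⟨hp.1, hp.2.1.le, hp.2.2⟩
  · exact fun t ht x =>
      tendsto_left_of_continuousOn_closed_triangle hreflH x (hS.evolution.cont x) t ht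
  · intro s hs x
    exact (hS.evolution.cont x).comp (f := fun t : ℝ => ((s, t) : ℝ × ℝ)) (by fun_prop)
      fun t ht => ⟨hs, ht.1, ht.2⟩
  · intro s t hs hst ht x
    exact le_of_tendsto (hlim' s t hs hst ht x).norm
      (Eventually.of_forall fun n => (hUn n).1.contr s t hs hst ht x)
  · intro t ht x
    refine hS.embedding_injective ?_
    rw [hcomm t t ht.1 le_rfl ht.2, hreflH t ht]
  · intro s r t hs hsr hrt ht x
    refine hS.embedding_injective ?_
    rw [hcomm s t hs (hsr.trans hrt) ht, hcomm r t (hs.trans hsr) hrt ht,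
      hcomm s r hs hsr (hrt.trans ht), hS.evolution.comp s r t hs hsr hrt ht]
    rfl

namespace ApproximatedEvolution

variable {E H : Type*} [NormedAddCommGroup E] [NormedSpace ℝ E] [CompleteSpace E]
    [NormedAddCommGroup H] [InnerProductSpace ℝ H] {T : ℝ} {ι : E →L[ℝ] H}
    {U : ℝ → ℝ → H →L[ℝ] H} {UE : ℝ → ℝ → E →L[ℝ] E} {Un : ℕ → ℝ → ℝ → E →L[ℝ] E}

/-- The estimate in `E` for a mild solution `u` of `u' = A u + B(u) + q` with `B` globally Lipschitz
and `ω`-dissipative at `0`. Since `UE` need not be continuous at the diagonal, the differential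
inequality is derived for the approximations `u_n` with `UE` replaced by `Un n`; these do not solve
the equation, but `B(u) - B(u_n)` tends to `0`. -/
theorem norm_le_of_lipschitz (hA : ApproximatedEvolution T ι U UE Un) {s : ℝ} (hs : 0 ≤ s)
    {g : ℝ → E} (hg : IntegrableOn g (Ioc s T)) {x : E} {u : ℝ → E}
    (hu : ∀ t ∈ Icc s T, u t = UE t s x + ∫ r in s..t, UE t r (g r))
    {B : ℝ → E → E} {K ω : ℝ} (hK : 0 ≤ K)
    (hBl : ∀ r ∈ Ioc s T, ∀ a b, ‖B r a - B r b‖ ≤ K * ‖a - b‖)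
    (hBd : ∀ r ∈ Ioc s T, ∀ a, ∀ α > 0, (1 - α * ω) * ‖a‖ ≤ ‖a - α • B r a‖)
    {q : ℝ → E} (hq : IntegrableOn q (Ioc s T)) (hgB : ∀ r ∈ Ioc s T, g r = B r (u r) + q r)
    {t : ℝ} (ht : t ∈ Icc s T) :
    ‖u t‖ ≤ Real.exp (ω * (t - s)) * ‖x‖ + ∫ r in s..t, Real.exp (ω * (t - r)) * ‖q r‖ := by
  set v : ℕ → ℝ → E := fun n t => Un n t s x + ∫ r in s..t, Un n t r (g r) with hv
  have hsT : s ≤ T := ht.1.trans ht.2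
  have hvu : ∀ t ∈ Icc s T, Tendsto (fun n => v n t) atTop (𝓝 (u t)) := by
    intro t ht
    rw [hu t ht]
    refine (hA.lim s t hs ht.1 ht.2 x).add ?_
    simp only [intervalIntegral.integral_of_le ht.1]
    refine tendsto_integral_of_dominated_convergence (fun r => ‖g r‖) (fun n =>
      (hA.evoln n).aestronglyMeasurable hs ht.2
        (hg.mono_set (Ioc_subset_Ioc_right ht.2)).aestronglyMeasurable)
      (hg.mono_set (Ioc_subset_Ioc_right ht.2)).norm (fun n => ?_) ?_
    · filter_upwards [ae_restrict_mem measurableSet_Ioc] with r hr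
      exact (hA.evoln n).contr _ _ (hs.trans hr.1.le) hr.2 ht.2 _
    · filter_upwards [ae_restrict_mem measurableSet_Ioc] with r hr
      exact hA.lim _ _ (hs.trans hr.1.le) hr.2 ht.2 _
  have hmeas_u : AEStronglyMeasurable u (volume.restrict (Ioc s T)) := by
    have h1 : ContinuousOn (fun t => UE t s x + ∫ r in s..t, UE t r (g r)) (Ioc s T) :=
      (hA.evolE.continuousOn_orbit hs x).add
        ((hA.evolE.continuousOn_convolution hs hg).mono Ioc_subset_Icc_self)
    exact (h1.congr fun t ht => hu t (Ioc_subset_Icc_self ht)).aestronglyMeasurable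
      measurableSet_Ioc
  have hmeas_v : ∀ n, AEStronglyMeasurable (v n) (volume.restrict (Ioc s T)) := by
    intro n
    exact (((hA.evoln n).continuousOn_orbit hs x).add
      (((hA.evoln n).continuousOn_convolution hs hg).mono
        Ioc_subset_Icc_self)).aestronglyMeasurable measurableSet_Ioc
  set C := ‖x‖ + ∫ r in s..T, ‖g r‖ with hC
  have hvs : ∀ n, v n s = x := fun n => by simp [hv, (hA.evoln n).refl s ⟨hs, hsT⟩]
  have hvC : ∀ n, ∀ t ∈ Icc s T, ‖v n t‖ ≤ C := by
    intro n t ht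
    have := (hA.evoln n).norm_le_bound hs hg (x := x) (u := v n) (fun t _ => rfl) t ht
    rwa [hvs] at this
  have huC : ∀ t ∈ Icc s T, ‖u t‖ ≤ C := fun t ht =>
    le_of_tendsto (hvu t ht).norm (Eventually.of_forall fun n => hvC n t ht)
  set m : ℕ → ℝ → ℝ := fun n r => ‖q r‖ + K * ‖u r - v n r‖ with hm
  have hmC : ∀ n, ∀ r ∈ Ioc s T, m n r ≤ ‖q r‖ + K * (2 * C) := by
    intro n r hr
    have h1 := (norm_sub_le (u r) (v n r)).trans
      (add_le_add (huC r (Ioc_subset_Icc_self hr)) (hvC n r (Ioc_subset_Icc_self hr)))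
    have := mul_le_mul_of_nonneg_left h1 hK
    simp only [hm]
    linarith
  have hdom : IntegrableOn (fun r => ‖q r‖ + K * (2 * C)) (Ioc s T) :=
    (Integrable.norm hq).add (integrableOn_const (by simp))
  have hm0 : ∀ n r, 0 ≤ m n r := fun n r => by positivity
  have hmi : ∀ n, IntegrableOn (m n) (Ioc s T) := by
    intro n
    refine Integrable.mono' hdom (hq.aestronglyMeasurable.norm.add
      ((hmeas_u.sub (hmeas_v n)).norm.const_mul K)) ?_
    filter_upwards [ae_restrict_mem measurableSet_Ioc] with r hr
    rw [Real.norm_of_nonneg (hm0 n r)]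
    exact hmC n r hr
  have hest : ∀ n, ‖v n t‖ ≤ Real.exp (ω * (t - s)) * ‖x‖ +
      ∫ r in s..t, Real.exp (ω * (t - r)) * m n r := by
    intro n
    have := (hA.evoln n).norm_le_of_dissipative (hA.leftn n) hs hg (x := x) (u := v n)
      (fun t _ => rfl) (ω := ω) (hmi n) (by
        filter_upwards [ae_restrict_mem measurableSet_Ioc] with r hr α hα
        have h1 := hBd r hr (v n r) α hα
        have h2 : v n r - α • B r (v n r) =
            (v n r - α • g r) + (α • q r + α • (B r (u r) - B r (v n r))) := by
          rw [hgB r hr, smul_add, smul_sub]; abel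
        have h3 := hBl r hr (u r) (v n r)
        rw [h2] at h1
        have h4 := norm_add_le (v n r - α • g r) (α • q r + α • (B r (u r) - B r (v n r)))
        have h5 := norm_add_le (α • q r) (α • (B r (u r) - B r (v n r)))
        rw [norm_smul, norm_smul, Real.norm_of_nonneg (le_of_lt hα)] at h5
        have h6 := mul_le_mul_of_nonneg_left h3 (le_of_lt hα)
        simp only [hm]
        linarith) ht
    rwa [hvs] at this
  refine le_of_tendsto_of_tendsto (hvu t ht).norm
    ((tendsto_const_nhds (x := Real.exp (ω * (t - s)) * ‖x‖)).add ?_)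
    (Eventually.of_forall hest)
  simp only [intervalIntegral.integral_of_le ht.1]
  obtain ⟨Ce, hCe⟩ := isCompact_Icc.exists_bound_of_continuousOn
    (f := fun r => Real.exp (ω * (t - r))) (s := Icc s t) (by fun_prop)
  have hCe0 : 0 ≤ Ce := (norm_nonneg _).trans (hCe s ⟨le_rfl, ht.1⟩)
  refine tendsto_integral_of_dominated_convergence (fun r => Ce * (‖q r‖ + K * (2 * C)))
    (fun n => ?_) ((hdom.mono_set (Ioc_subset_Ioc_right ht.2)).const_mul Ce) (fun n => ?_) ?_
  · exact (by fun_prop : Continuous fun r => Real.exp (ω * (t - r))).aestronglyMeasurable.mul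
      ((hmi n).mono_set (Ioc_subset_Ioc_right ht.2)).aestronglyMeasurable
  · filter_upwards [ae_restrict_mem measurableSet_Ioc] with r hr
    rw [norm_mul, Real.norm_of_nonneg (hm0 n r)]
    exact mul_le_mul (hCe r (Ioc_subset_Icc_self hr)) (hmC n r ⟨hr.1, hr.2.trans ht.2⟩) (hm0 n r)
      hCe0
  · filter_upwards [ae_restrict_mem measurableSet_Ioc] with r hr
    have h1 : Tendsto (fun n => ‖u r - v n r‖) atTop (𝓝 0) := by
      have := (tendsto_const_nhds (x := u r)).sub (hvu r ⟨hr.1.le, hr.2.trans ht.2⟩)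
      rw [sub_self] at this
      simpa using this.norm
    have h2 := ((h1.const_mul K).const_add ‖q r‖).const_mul (Real.exp (ω * (t - r)))
    rwa [mul_zero, add_zero] at h2

end ApproximatedEvolution

/-! ### Mild solutions for Lipschitz nonlinearities -/

theorem integrableOn_of_lipschitz {V : Type*} [NormedAddCommGroup V]
    {s T K C : ℝ} {Ψ : ℝ → V → V} (hK : 0 ≤ K)
    (hlip : ∀ r ∈ Ioc s T, ∀ a b, ‖Ψ r a - Ψ r b‖ ≤ K * ‖a - b‖)
    (h0 : IntegrableOn (fun r => Ψ r 0) (Ioc s T)) {u : ℝ → V}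
    (hu : AEStronglyMeasurable (fun r => Ψ r (u r)) (volume.restrict (Ioc s T)))
    (hC : ∀ t ∈ Ioc s T, ‖u t‖ ≤ C) : IntegrableOn (fun r => Ψ r (u r)) (Ioc s T) := by
  refine Integrable.mono' (g := fun r => ‖Ψ r 0‖ + K * C)
    ((Integrable.norm h0).add (integrableOn_const (by simp))) hu ?_
  filter_upwards [ae_restrict_mem measurableSet_Ioc] with r hr
  have h1 := hlip r hr (u r) 0
  rw [sub_zero] at h1
  have h2 := mul_le_mul_of_nonneg_left (hC r hr) hK
  have h3 := norm_le_norm_add_norm_sub' (Ψ r (u r)) (Ψ r 0)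
  linarith

/-- Picard iteration. The solution is continuous only on `(s, T]`, as `W` may fail to be strongly
continuous at the diagonal, and the nonlinearity only needs to be measurable in time along such
functions. -/
theorem IsContractionEvolution.exists_mild_of_lipschitz {V : Type*} [NormedAddCommGroup V]
    [NormedSpace ℝ V] [CompleteSpace V] {T : ℝ} {W : ℝ → ℝ → V →L[ℝ] V}
    (hW : IsContractionEvolution T W) {s : ℝ} (hs : 0 ≤ s) (hsT : s ≤ T) {Ψ : ℝ → V → V} {K : ℝ}
    (hK : 0 ≤ K) (hlip : ∀ r ∈ Ioc s T, ∀ a b, ‖Ψ r a - Ψ r b‖ ≤ K * ‖a - b‖)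
    (hmeas : ∀ u : ℝ → V, ContinuousOn u (Ioc s T) →
      AEStronglyMeasurable (fun r => Ψ r (u r)) (volume.restrict (Ioc s T)))
    (h0 : IntegrableOn (fun r => Ψ r 0) (Ioc s T)) (x : V) :
    ∃ u : ℝ → V, ContinuousOn u (Ioc s T) ∧ (∃ C, ∀ t ∈ Icc s T, ‖u t‖ ≤ C) ∧
      IntegrableOn (fun r => Ψ r (u r)) (Ioc s T) ∧
      ∀ t ∈ Icc s T, u t = W t s x + ∫ r in s..t, W t r (Ψ r (u r)) := by
  classical
  set l : ℝ := 2 * K + 1 with hl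
  have hl0 : 0 < l := by linarith
  set X := BoundedContinuousFunction (Ioc s T) V
  set ext : X → ℝ → V := fun w r => if h : r ∈ Ioc s T then w ⟨r, h⟩ else 0 with hext
  have hext_mem : ∀ (w : X) r (h : r ∈ Ioc s T), ext w r = w ⟨r, h⟩ := fun w r h => by
    simp only [hext, dif_pos h]
  have hext_notMem : ∀ (w : X) r, r ∉ Ioc s T → ext w r = 0 := fun w r h => dif_neg h
  have hext_cont : ∀ w : X, ContinuousOn (ext w) (Ioc s T) := by
    intro w
    rw [continuousOn_iff_continuous_domRestrict]
    convert! w.continuous using 1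
    ext ⟨r, hr⟩
    exact hext_mem w r hr
  have hext_sub : ∀ (w w' : X) r, ‖ext w r - ext w' r‖ ≤ dist w w' := by
    intro w w' r
    by_cases h : r ∈ Ioc s T
    · rw [hext_mem w r h, hext_mem w' r h, ← dist_eq_norm]
      exact BoundedContinuousFunction.dist_coe_le_dist _
    · rw [hext_notMem _ r h, hext_notMem _ r h, sub_zero, norm_zero]
      exact dist_nonneg
  have hext_bd : ∀ (w : X) r, ‖ext w r‖ ≤ ‖w‖ := by
    intro w r
    by_cases h : r ∈ Ioc s T
    · rw [hext_mem w r h]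
      exact w.norm_coe_le_norm _
    · rw [hext_notMem _ r h, norm_zero]
      exact norm_nonneg _
  -- the substitution `u = e^{l (t - s)} w` makes the Picard map a contraction on all of `[s, T]`
  set lift : X → ℝ → V := fun w r => Real.exp (l * (r - s)) • ext w r with hlift
  have hlift_cont : ∀ w, ContinuousOn (lift w) (Ioc s T) := fun w =>
    (by fun_prop : Continuous fun r => Real.exp (l * (r - s))).continuousOn.smul (hext_cont w)
  have hlift_bd : ∀ w, ∀ r ∈ Ioc s T, ‖lift w r‖ ≤ Real.exp (l * (T - s)) * ‖w‖ := by
    intro w r hr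
    rw [hlift, norm_smul, Real.norm_of_nonneg (Real.exp_pos _).le]
    refine mul_le_mul (Real.exp_le_exp.2 ?_) (hext_bd w r) (norm_nonneg _) (Real.exp_pos _).le
    exact mul_le_mul_of_nonneg_left (by linarith [hr.2]) hl0.le
  have hint : ∀ w, IntegrableOn (fun r => Ψ r (lift w r)) (Ioc s T) := fun w =>
    integrableOn_of_lipschitz hK hlip h0 (hmeas _ (hlift_cont w)) (hlift_bd w)
  set P : X → ℝ → V := fun w t => W t s x + ∫ r in s..t, W t r (Ψ r (lift w r)) with hP
  have hP_cont : ∀ w, ContinuousOn (P w) (Ioc s T) := fun w =>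
    (hW.continuousOn_orbit hs x).add
      ((hW.continuousOn_convolution hs (hint w)).mono Ioc_subset_Icc_self)
  have hP_bd : ∀ w, ∀ t ∈ Icc s T, ‖P w t‖ ≤ ‖x‖ + ∫ r in s..T, ‖Ψ r (lift w r)‖ := by
    intro w t ht
    have := hW.norm_le_bound hs (hint w) (x := x) (u := P w) (fun t _ => rfl) t ht
    have hPs : P w s = x := by simp [hP, hW.refl s ⟨hs, hsT⟩]
    rwa [hPs] at this
  set Θ : X → X := fun w => BoundedContinuousFunction.ofNormedAddCommGroup
    (fun t : Ioc s T => Real.exp (-(l * (t - s))) • P w t)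
    (((by fun_prop : Continuous fun r : ℝ => Real.exp (-(l * (r - s)))).comp
      continuous_subtype_val).smul (continuousOn_iff_continuous_domRestrict.1 (hP_cont w)))
    (‖x‖ + ∫ r in s..T, ‖Ψ r (lift w r)‖) (by
      rintro ⟨t, ht⟩
      rw [norm_smul, Real.norm_of_nonneg (Real.exp_pos _).le]
      have h1 : Real.exp (-(l * (t - s))) ≤ 1 := by
        rw [Real.exp_le_one_iff, neg_nonpos]
        exact mul_nonneg hl0.le (by linarith [ht.1])
      exact (mul_le_of_le_one_left (norm_nonneg _) h1).trans
        (hP_bd w t (Ioc_subset_Icc_self ht))) with hΘ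
  have hΘ_apply : ∀ w (t : Ioc s T), Θ w t = Real.exp (-(l * (t - s))) • P w t := fun w t => rfl
  have hcontr : ContractingWith (1 / 2) Θ := by
    refine ⟨by rw [← NNReal.coe_lt_coe]; norm_num, LipschitzWith.of_dist_le_mul fun w w' => ?_⟩
    rw [BoundedContinuousFunction.dist_le (by positivity)]
    rintro ⟨t, ht⟩
    have htI : t ∈ Icc s T := Ioc_subset_Icc_self ht
    rw [hΘ_apply, hΘ_apply, dist_eq_norm, ← smul_sub, norm_smul,
      Real.norm_of_nonneg (Real.exp_pos _).le]
    simp only [hP, add_sub_add_left_eq_sub]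
    rw [← intervalIntegral.integral_sub
      (hW.intervalIntegrable hs ht.2 le_rfl ht.1.le le_rfl (hint w))
      (hW.intervalIntegrable hs ht.2 le_rfl ht.1.le le_rfl (hint w'))]
    have hexpint : (∫ r in s..t, K * (Real.exp (l * (r - s)) * dist w w')) =
        K / l * (Real.exp (l * (t - s)) - 1) * dist w w' := by
      have : ∀ r ∈ uIcc s t, HasDerivAt (fun r => K / l * Real.exp (l * (r - s)) * dist w w')
          (K * (Real.exp (l * (r - s)) * dist w w')) r := by
        intro r _
        have h1 : HasDerivAt (fun r : ℝ => l * (r - s)) l r := by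
          simpa using ((hasDerivAt_id r).sub_const s).const_mul l
        have h2 := (h1.exp.const_mul (K / l)).mul_const (dist w w')
        convert! h2 using 1
        field_simp
      rw [intervalIntegral.integral_eq_sub_of_hasDerivAt this
        (by apply Continuous.intervalIntegrable; fun_prop)]
      simp
      ring
    have h1 : ‖∫ r in s..t, (W t r (Ψ r (lift w r)) - W t r (Ψ r (lift w' r)))‖ ≤
        K / l * (Real.exp (l * (t - s)) - 1) * dist w w' := by
      rw [← hexpint]
      refine intervalIntegral.norm_integral_le_of_norm_le ht.1.le ?_
        (by apply Continuous.intervalIntegrable; fun_prop)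
      filter_upwards with r hr
      rw [← map_sub]
      refine (hW.contr _ _ (hs.trans hr.1.le) hr.2 ht.2 _).trans
        ((hlip r ⟨hr.1, hr.2.trans ht.2⟩ _ _).trans (mul_le_mul_of_nonneg_left ?_ hK))
      rw [hlift, ← smul_sub, norm_smul, Real.norm_of_nonneg (Real.exp_pos _).le]
      exact mul_le_mul_of_nonneg_left (hext_sub w w' r) (Real.exp_pos _).le
    refine (mul_le_mul_of_nonneg_left h1 (Real.exp_pos _).le).trans ?_
    have h2 : Real.exp (-(l * (t - s))) * (Real.exp (l * (t - s)) - 1) ≤ 1 := by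
      rw [mul_sub, ← Real.exp_add, neg_add_cancel, Real.exp_zero, mul_one]
      linarith [Real.exp_pos (-(l * (t - s)))]
    have h3 : K / l ≤ 1 / 2 := by rw [div_le_div_iff₀ hl0 two_pos]; linarith
    have h4 : 0 ≤ K / l := by positivity
    calc Real.exp (-(l * (t - s))) * (K / l * (Real.exp (l * (t - s)) - 1) * dist w w')
        = (K / l) * (Real.exp (-(l * (t - s))) * (Real.exp (l * (t - s)) - 1)) * dist w w' := by
          ring
      _ ≤ (1 / 2) * 1 * dist w w' := by
          refine mul_le_mul_of_nonneg_right ?_ dist_nonneg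
          nlinarith
      _ = _ := by simp
  set w := hcontr.fixedPoint Θ with hw
  have hfix : Θ w = w := hcontr.fixedPoint_isFixedPt
  have hPl : ∀ t ∈ Ioc s T, P w t = lift w t := by
    intro t ht
    simp only [hlift]
    rw [hext_mem w t ht]
    conv_rhs => rw [← hfix]
    rw [hΘ_apply, smul_smul, ← Real.exp_add]
    simp
  refine ⟨P w, hP_cont w, ⟨_, hP_bd w⟩, ?_, ?_⟩
  · exact (hint w).congr_fun (fun r hr => by simp only [hPl r hr]) measurableSet_Ioc
  · intro t ht
    simp only [hP]
    congr 1
    rw [intervalIntegral.integral_of_le ht.1, intervalIntegral.integral_of_le ht.1]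
    refine setIntegral_congr_fun measurableSet_Ioc fun r hr => ?_
    have := hPl r ⟨hr.1, hr.2.trans ht.2⟩
    simp only [hP] at this
    simp only [this]

/-! ### Dissipative maps and their Yosida approximations -/

section Dissipative

variable {E V H : Type*} [NormedAddCommGroup E] [NormedSpace ℝ E]
  [NormedAddCommGroup V] [NormedSpace ℝ V] [NormedAddCommGroup H] [InnerProductSpace ℝ H]

/-- `g : E → E` is dissipative for the seminorm `x ↦ ‖L x‖`. With `L = id` this is dissipativity
in `E`, with `L = ι` dissipativity for the norm of `H` along points of `E`. -/
def DissipativeAlong (L : E →L[ℝ] V) (g : E → E) : Prop :=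
  ∀ a b : E, ∀ α : ℝ, 0 < α → ‖L (a - b)‖ ≤ ‖L (a - b - α • (g a - g b))‖

/-- An everywhere defined map of `E` that is m-dissipative in `E` and dissipative for the norm
of `H`. -/
structure IsMDissipativeMap (ι : E →L[ℝ] H) (g : E → E) : Prop where
  dissE : DissipativeAlong (ContinuousLinearMap.id ℝ E) g
  dissH : DissipativeAlong ι g
  surj : ∀ l : ℝ, 0 < l → ∀ v, ∃ z, l • z - g z = v

/-- The nonlinear resolvent `J_k = (1 - g / k)⁻¹`. -/
def resolventMap (g : E → E) (k : ℝ) (v : E) : E :=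
  Function.invFun (fun z => z - (1 / k) • g z) v

/-- The Yosida approximation `k (J_k - 1) = g ∘ J_k`. -/
def yosidaApprox (g : E → E) (k : ℝ) (v : E) : E := k • (resolventMap g k v - v)

/-- If `l - g` is onto for one `l > 0`, then it is onto for all `l > 0`. -/
theorem DissipativeAlong.surjective_of_exists [CompleteSpace E] {g : E → E}
    (hg : DissipativeAlong (ContinuousLinearMap.id ℝ E) g)
    (h : ∃ l : ℝ, 0 < l ∧ ∀ v, ∃ z, l • z - g z = v) :
    ∀ l : ℝ, 0 < l → ∀ v, ∃ z, l • z - g z = v := by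
  have step : ∀ l : ℝ, 0 < l → (∀ v, ∃ z, l • z - g z = v) → ∀ m : ℝ, 0 < m → m < 2 * l →
      ∀ v, ∃ z, m • z - g z = v := by
    intro l hl hsurj m hm hml v
    choose R hR using hsurj
    have hRlip : ∀ a b, ‖R a - R b‖ ≤ l⁻¹ * ‖a - b‖ := by
      intro a b
      have h1 := hg (R a) (R b) l⁻¹ (inv_pos.2 hl)
      have h2 : R a - R b - l⁻¹ • (g (R a) - g (R b)) = l⁻¹ • (a - b) := by
        have e : l⁻¹ • (a - b) = l⁻¹ • ((l • R a - g (R a)) - (l • R b - g (R b))) := by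
          rw [hR, hR]
        rw [e]
        simp only [smul_sub, inv_smul_smul₀ hl.ne']
        abel
      rw [h2] at h1
      simpa [norm_smul, abs_of_pos hl] using h1
    have hlm : |l - m| < l := by rw [abs_lt]; constructor <;> linarith
    have hc : ContractingWith (Real.toNNReal (|l - m| / l)) (fun z => R (v + (l - m) • z)) := by
      refine ⟨?_, LipschitzWith.of_dist_le_mul fun a b => ?_⟩
      · rw [Real.toNNReal_lt_one, div_lt_one hl]; exact hlm
      · rw [Real.coe_toNNReal _ (by positivity), dist_eq_norm, dist_eq_norm]
        refine (hRlip _ _).trans (le_of_eq ?_)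
        rw [add_sub_add_left_eq_sub, ← smul_sub, norm_smul, Real.norm_eq_abs]
        ring
    have hfix : R (v + (l - m) • hc.fixedPoint) = hc.fixedPoint := hc.fixedPoint_isFixedPt
    refine ⟨hc.fixedPoint, ?_⟩
    have h3 := hR (v + (l - m) • hc.fixedPoint)
    rw [hfix, sub_smul] at h3
    rw [sub_eq_iff_eq_add] at h3 ⊢
    rw [eq_comm, ← sub_eq_zero] at h3 ⊢
    rw [← h3]; abel
  obtain ⟨l₀, hl₀, hs₀⟩ := h
  have hpow : ∀ n : ℕ, ∀ v, ∃ z, ((3 / 2 : ℝ) ^ n * l₀) • z - g z = v := by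
    intro n
    induction n with
    | zero => simpa using hs₀
    | succ n ih =>
      have hp : 0 < (3 / 2 : ℝ) ^ n * l₀ := by positivity
      refine step _ hp ih _ (by positivity) ?_
      rw [pow_succ]; nlinarith
  intro l hl
  obtain ⟨n, hn⟩ := pow_unbounded_of_one_lt (l / l₀) (by norm_num : (1 : ℝ) < 3 / 2)
  rw [div_lt_iff₀ hl₀] at hn
  have hp : 0 < (3 / 2 : ℝ) ^ n * l₀ := by positivity
  exact step _ hp (hpow n) l hl (by linarith)

/-- Dissipativity of `g` for the seminorm `‖L ·‖` gives `ω`-dissipativity of `ω + g`. -/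
theorem DissipativeAlong.shift_le {L : E →L[ℝ] V} {g : E → E} (hg : DissipativeAlong L g)
    (ω : ℝ) (a b : E) {α : ℝ} (hα : 0 < α) :
    (1 - α * ω) * ‖L (a - b)‖ ≤ ‖L (a - b - α • ((ω • a + g a) - (ω • b + g b)))‖ := by
  rcases le_or_gt (1 - α * ω) 0 with h | h
  · exact (mul_nonpos_of_nonpos_of_nonneg h (norm_nonneg _)).trans (norm_nonneg _)
  · have h1 := hg a b (α / (1 - α * ω)) (div_pos hα h)
    have h2 : a - b - α • ((ω • a + g a) - (ω • b + g b)) =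
        (1 - α * ω) • (a - b - (α / (1 - α * ω)) • (g a - g b)) := by
      rw [smul_sub (1 - α * ω), smul_smul, mul_div_cancel₀ _ h.ne']
      module
    rw [h2, map_smul, norm_smul, Real.norm_of_nonneg h.le]
    exact mul_le_mul_of_nonneg_left h1 h.le

theorem DissipativeAlong.inner_nonpos {ι : E →L[ℝ] H} {g : E → E} (hg : DissipativeAlong ι g)
    (a b : E) : inner ℝ (ι (g a - g b)) (ι (a - b)) ≤ 0 := by
  set p := ι (a - b)
  set q := ι (g a - g b)
  have h1 : ∀ α : ℝ, 0 < α → 2 * inner ℝ q p ≤ α * ‖q‖ ^ 2 := by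
    intro α hα
    have h2 := hg a b α hα
    rw [map_sub ι (a - b), map_smul] at h2
    have h3 := pow_le_pow_left₀ (norm_nonneg _) h2 2
    rw [norm_sub_sq_real, inner_smul_right, real_inner_comm, norm_smul,
      Real.norm_of_nonneg hα.le] at h3
    have h4 : α * (2 * inner ℝ q p) ≤ α * (α * ‖q‖ ^ 2) := by
      simp only [p, q] at *
      nlinarith
    exact le_of_mul_le_mul_left h4 hα
  have h5 : 2 * inner ℝ q p ≤ 0 := by
    refine le_of_forall_pos_le_add fun ε hε => ?_
    have h6 := h1 (ε / (‖q‖ ^ 2 + 1)) (by positivity)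
    have h7 : ε / (‖q‖ ^ 2 + 1) * ‖q‖ ^ 2 ≤ ε := by
      rw [div_mul_eq_mul_div, div_le_iff₀ (by positivity)]
      nlinarith
    linarith
  linarith

namespace IsMDissipativeMap

variable {ι : E →L[ℝ] H} {g : E → E} {k : ℝ}

theorem injective_resolvent (hg : IsMDissipativeMap ι g) (hk : 0 < k) :
    Function.Injective (fun z => z - (1 / k) • g z) := by
  intro a b hab
  have h1 := hg.dissE a b (1 / k) (by positivity)
  have h2 : a - b - (1 / k) • (g a - g b) = 0 := by
    have h3 : a - (1 / k) • g a = b - (1 / k) • g b := hab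
    rw [smul_sub, sub_sub_sub_comm, h3, sub_self]
  rw [h2] at h1
  simpa [sub_eq_zero] using h1

theorem resolvent_spec (hg : IsMDissipativeMap ι g) (hk : 0 < k) (v : E) :
    resolventMap g k v - (1 / k) • g (resolventMap g k v) = v := by
  refine Function.invFun_eq (f := fun z => z - (1 / k) • g z) ?_
  obtain ⟨z, hz⟩ := hg.surj k hk (k • v)
  refine ⟨z, ?_⟩
  rw [one_div, ← inv_smul_smul₀ hk.ne' v, ← hz, smul_sub, inv_smul_smul₀ hk.ne']

theorem resolvent_unique (hg : IsMDissipativeMap ι g) (hk : 0 < k) {z v : E}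
    (hz : z - (1 / k) • g z = v) : resolventMap g k v = z :=
  hg.injective_resolvent hk ((hg.resolvent_spec hk v).trans hz.symm)

theorem yosida_eq (hg : IsMDissipativeMap ι g) (hk : 0 < k) (v : E) :
    yosidaApprox g k v = g (resolventMap g k v) := by
  have h := hg.resolvent_spec hk v
  rw [yosidaApprox]
  nth_rewrite 2 [← h]
  rw [sub_sub_cancel, smul_smul, mul_one_div_cancel hk.ne', one_smul]

theorem norm_resolvent_sub_le (hg : IsMDissipativeMap ι g) {L : E →L[ℝ] V}
    (hL : DissipativeAlong L g) (hk : 0 < k) (a b : E) :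
    ‖L (resolventMap g k a - resolventMap g k b)‖ ≤ ‖L (a - b)‖ := by
  have h := hL (resolventMap g k a) (resolventMap g k b) (1 / k) (by positivity)
  rwa [smul_sub, sub_sub_sub_comm, hg.resolvent_spec hk, hg.resolvent_spec hk] at h

theorem norm_yosida_sub_le (hg : IsMDissipativeMap ι g) {L : E →L[ℝ] V}
    (hL : DissipativeAlong L g) (hk : 0 < k) (a b : E) :
    ‖L (yosidaApprox g k a - yosidaApprox g k b)‖ ≤ 2 * k * ‖L (a - b)‖ := by
  have h1 : yosidaApprox g k a - yosidaApprox g k b =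
      k • ((resolventMap g k a - resolventMap g k b) - (a - b)) := by
    rw [yosidaApprox, yosidaApprox, ← smul_sub, sub_sub_sub_comm]
  rw [h1, map_smul, norm_smul, Real.norm_of_nonneg hk.le, map_sub L (_ - _)]
  have h2 := norm_sub_le (L (resolventMap g k a - resolventMap g k b)) (L (a - b))
  have h3 := hg.norm_resolvent_sub_le hL hk a b
  nlinarith

theorem norm_resolvent_sub_self_le (hg : IsMDissipativeMap ι g) {L : E →L[ℝ] V}
    (hL : DissipativeAlong L g) (hk : 0 < k) (v : E) :
    ‖L (resolventMap g k v - v)‖ ≤ 1 / k * ‖L (g v)‖ := by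
  have h := hL (resolventMap g k v) v (1 / k) (by positivity)
  have h1 : resolventMap g k v - v - (1 / k) • (g (resolventMap g k v) - g v) =
      (1 / k) • g v := by
    have h2 := hg.resolvent_spec hk v
    nth_rewrite 2 [← h2]
    rw [smul_sub]; abel
  rwa [h1, map_smul, norm_smul, Real.norm_of_nonneg (by positivity)] at h

theorem norm_yosida_le (hg : IsMDissipativeMap ι g) {L : E →L[ℝ] V}
    (hL : DissipativeAlong L g) (hk : 0 < k) (v : E) :
    ‖L (yosidaApprox g k v)‖ ≤ ‖L (g v)‖ := by
  rw [yosidaApprox, map_smul, norm_smul, Real.norm_of_nonneg hk.le]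
  have h := mul_le_mul_of_nonneg_left (hg.norm_resolvent_sub_self_le hL hk v) hk.le
  rwa [← mul_assoc, mul_one_div_cancel hk.ne', one_mul] at h

/-- `ζ J_k + g ∘ J_k` is `ζ`-dissipative as soon as `k + ζ ≥ 0`. -/
theorem resolvent_shift_le (hg : IsMDissipativeMap ι g) {L : E →L[ℝ] V}
    (hL : DissipativeAlong L g) (hk : 0 < k) {ζ : ℝ} (hζ : 0 ≤ k + ζ) (a b : E) {α : ℝ}
    (hα : 0 < α) :
    (1 - α * ζ) * ‖L (a - b)‖ ≤ ‖L (a - b - α • ((ζ • resolventMap g k a + yosidaApprox g k a) -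
      (ζ • resolventMap g k b + yosidaApprox g k b)))‖ := by
  have h1 : a - b - α • ((ζ • resolventMap g k a + yosidaApprox g k a) -
      (ζ • resolventMap g k b + yosidaApprox g k b)) =
      (1 + α * k) • (a - b) - (α * (k + ζ)) • (resolventMap g k a - resolventMap g k b) := by
    simp only [yosidaApprox]; module
  rw [h1, map_sub L (_ • _), map_smul, map_smul]
  have h2 := norm_sub_norm_le ((1 + α * k) • L (a - b))
    ((α * (k + ζ)) • L (resolventMap g k a - resolventMap g k b))
  rw [norm_smul, norm_smul, Real.norm_of_nonneg (by positivity),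
    Real.norm_of_nonneg (by positivity)] at h2
  have h3 := mul_le_mul_of_nonneg_left (hg.norm_resolvent_sub_le hL hk a b)
    (show 0 ≤ α * (k + ζ) by positivity)
  linarith

theorem dissipative_yosida (hg : IsMDissipativeMap ι g) {L : E →L[ℝ] V}
    (hL : DissipativeAlong L g) (hk : 0 < k) : DissipativeAlong L (yosidaApprox g k) := by
  intro a b α hα
  simpa using hg.resolvent_shift_le hL hk (ζ := 0) (by simpa using hk.le) a b hα

/-- Recentring a dissipative map at `c`. -/
theorem recentre (hg : IsMDissipativeMap ι g) (c : E) :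
    IsMDissipativeMap ι (fun v => g (c + v) - g c) := by
  have key : ∀ a b : E, g (c + a) - g c - (g (c + b) - g c) = g (c + a) - g (c + b) := by
    intro a b; abel
  refine ⟨fun a b α hα => ?_, fun a b α hα => ?_, fun l hl v => ?_⟩
  · have := hg.dissE (c + a) (c + b) α hα
    rwa [add_sub_add_left_eq_sub, ← key] at this
  · have := hg.dissH (c + a) (c + b) α hα
    rwa [add_sub_add_left_eq_sub, ← key] at this
  · obtain ⟨z, hz⟩ := hg.surj l hl (v + l • c - g c)
    refine ⟨z - c, ?_⟩
    simp only [add_sub_cancel]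
    rw [smul_sub]
    rw [← sub_eq_zero] at hz ⊢
    rw [← hz]; abel

theorem resolvent_recentre (hg : IsMDissipativeMap ι g) (hk : 0 < k) (c v : E) :
    resolventMap (fun v => g (c + v) - g c) k v =
      resolventMap g k (v + c - (1 / k) • g c) - c := by
  refine (hg.recentre c).resolvent_unique hk ?_
  simp only [add_sub_cancel]
  have h := hg.resolvent_spec hk (v + c - (1 / k) • g c)
  rw [smul_sub]
  rw [← sub_eq_zero] at h ⊢
  rw [← h]; abel

end IsMDissipativeMap

/-- If `t ↦ G t x` is continuous for every `x`, the resolvents are jointly continuous. -/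
theorem continuousOn_resolventMap {T : ℝ} {ι : E →L[ℝ] H} {G : ℝ → E → E}
    (hG : ∀ t ∈ Icc 0 T, IsMDissipativeMap ι (G t))
    (hc : ∀ x, ContinuousOn (fun t => G t x) (Icc 0 T)) {k : ℝ} (hk : 0 < k) (v : E) :
    ContinuousOn (fun t => resolventMap (G t) k v) (Icc 0 T) := by
  intro t₀ ht₀
  rw [ContinuousWithinAt, tendsto_iff_norm_sub_tendsto_zero]
  set z := resolventMap (G t₀) k v
  have h1 : Tendsto (fun t => 1 / k * ‖G t₀ z - G t z‖) (𝓝[Icc 0 T] t₀) (𝓝 0) := by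
    have h2 := ((tendsto_const_nhds (x := G t₀ z)).sub (hc z t₀ ht₀).tendsto).norm.const_mul (1 / k)
    simpa using h2
  refine squeeze_zero' (Eventually.of_forall fun _ => norm_nonneg _) ?_ h1
  filter_upwards [self_mem_nhdsWithin] with t ht
  have hz : resolventMap (G t) k (z - (1 / k) • G t z) = z :=
    (hG t ht).resolvent_unique hk rfl
  have h3 := (hG t ht).norm_resolvent_sub_le (hG t ht).dissE hk v (z - (1 / k) • G t z)
  rw [hz] at h3
  have h4 : v - (z - (1 / k) • G t z) = -((1 / k) • (G t₀ z - G t z)) := by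
    have h5 := (hG t₀ ht₀).resolvent_spec hk v
    nth_rewrite 1 [← h5]
    rw [smul_sub]
    show z - (1 / k) • G t₀ z - _ = _
    abel
  rw [h4] at h3
  simpa [norm_smul, abs_of_pos hk] using h3

theorem aestronglyMeasurable_resolventMap {T : ℝ} (hT : 0 ≤ T) {ι : E →L[ℝ] H} {G : ℝ → E → E}
    (hG : ∀ t ∈ Icc 0 T, IsMDissipativeMap ι (G t))
    (hc : ∀ x, ContinuousOn (fun t => G t x) (Icc 0 T)) {k : ℝ} (hk : 0 < k) {S : Set ℝ}
    (hS : MeasurableSet S) (hST : S ⊆ Icc 0 T) {u : ℝ → E}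
    (hu : AEStronglyMeasurable u (volume.restrict S)) :
    AEStronglyMeasurable (fun t => resolventMap (G t) k (u t)) (volume.restrict S) := by
  have hcont : Continuous (fun p : ℝ × E => resolventMap (G (projIcc 0 T hT p.1)) k p.2) := by
    refine continuous_prod_of_continuous_lipschitzWith' _ 1 (fun r => ?_) (fun v => ?_)
    · refine LipschitzWith.of_dist_le_mul fun v w => ?_
      rw [dist_eq_norm, dist_eq_norm, NNReal.coe_one, one_mul]
      exact (hG _ (projIcc 0 T hT r).2).norm_resolvent_sub_le
        (hG _ (projIcc 0 T hT r).2).dissE hk v w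
    · exact (continuousOn_resolventMap hG hc hk v).comp_continuous
        (continuous_subtype_val.comp continuous_projIcc) fun r => (projIcc 0 T hT r).2
  refine (hcont.comp_aestronglyMeasurable
    ((continuous_id.aestronglyMeasurable (μ := volume.restrict S)).prodMk hu)).congr ?_
  filter_upwards [ae_restrict_mem hS] with t ht
  simp [projIcc_of_mem hT (hST ht)]

end Dissipative

/-! ### Reflexive spaces -/

section Reflexive

variable {E : Type*} [NormedAddCommGroup E] [NormedSpace ℝ E]

/-- In a reflexive space, bounded sequences have weak limits along ultrafilters. -/
theorem exists_ultrafilter_weak_limit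
    (hrefl : Function.Surjective (NormedSpace.inclusionInDoubleDual ℝ E)) {x : ℕ → E} {C : ℝ}
    (hC : ∀ n, ‖x n‖ ≤ C) :
    ∃ (𝒰 : Ultrafilter ℕ) (y : E), (𝒰 : Filter ℕ) ≤ atTop ∧ ‖y‖ ≤ C ∧
      ∀ ξ : StrongDual ℝ E, Tendsto (fun n => ξ (x n)) 𝒰 (𝓝 (ξ y)) := by
  set 𝒰 : Ultrafilter ℕ := Ultrafilter.of atTop
  have hC0 : 0 ≤ C := (norm_nonneg _).trans (hC 0)
  have hex : ∀ ξ : StrongDual ℝ E, ∃ l : ℝ, |l| ≤ C * ‖ξ‖ ∧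
      Tendsto (fun n => ξ (x n)) 𝒰 (𝓝 l) := by
    intro ξ
    have hmem : ∀ n, ξ (x n) ∈ Icc (-(C * ‖ξ‖)) (C * ‖ξ‖) := by
      intro n
      rw [mem_Icc, ← abs_le, mul_comm]
      exact ξ.le_of_opNorm_le_of_le le_rfl (hC n)
    obtain ⟨l, hl, hlim⟩ := isCompact_Icc.ultrafilter_le_nhds (𝒰.map fun n => ξ (x n)) (by
      rw [Ultrafilter.coe_map, le_principal_iff, mem_map]
      exact Filter.Eventually.of_forall hmem)
    exact ⟨l, abs_le.2 hl, hlim⟩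
  choose φ hφ1 hφ2 using hex
  set Φ : StrongDual ℝ (StrongDual ℝ E) := LinearMap.mkContinuous
    { toFun := φ
      map_add' := fun ξ η => tendsto_nhds_unique (hφ2 (ξ + η)) ((hφ2 ξ).add (hφ2 η))
      map_smul' := fun c ξ => tendsto_nhds_unique (hφ2 (c • ξ)) ((hφ2 ξ).const_mul c) } C hφ1
  obtain ⟨y, hy⟩ := hrefl Φ
  have hyφ : ∀ ξ, ξ y = φ ξ := fun ξ => by
    rw [← NormedSpace.dual_def, hy]; rfl
  refine ⟨𝒰, y, Ultrafilter.of_le _, ?_, fun ξ => by rw [hyφ]; exact hφ2 ξ⟩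
  obtain ⟨ξ, h1, h2⟩ := exists_dual_vector'' ℝ y
  have h3 := hφ1 ξ
  rw [← hyφ, h2] at h3
  calc ‖y‖ ≤ |(‖y‖ : ℝ)| := le_abs_self _
    _ ≤ C * ‖ξ‖ := h3
    _ ≤ C := mul_le_of_le_one_right hC0 h1

variable {H : Type*} [NormedAddCommGroup H] [InnerProductSpace ℝ H] {ι : E →L[ℝ] H}

/-- If a bounded sequence of the reflexive space `E` converges weakly in `H`, tested with a dense
set of vectors, then its limit belongs to `E`, with the same bound. -/
theorem exists_of_tendsto_inner
    (hrefl : Function.Surjective (NormedSpace.inclusionInDoubleDual ℝ E)) (hd : DenseRange ι)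
    {x : ℕ → E} {C : ℝ} (hC : ∀ n, ‖x n‖ ≤ C) {h : H}
    (hlim : ∀ z : E, Tendsto (fun n => inner ℝ (ι (x n)) (ι z)) atTop (𝓝 (inner ℝ h (ι z)))) :
    ∃ y, ι y = h ∧ ‖y‖ ≤ C := by
  obtain ⟨𝒰, y, h𝒰, hy, hξ⟩ := exists_ultrafilter_weak_limit hrefl hC
  refine ⟨y, ?_, hy⟩
  refine hd.eq_of_inner_left ℝ fun z => ?_
  have h1 := hξ ((innerSL ℝ (ι z)).comp ι)
  have h2 := (hlim z).mono_left h𝒰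
  simp only [ContinuousLinearMap.comp_apply, innerSL_apply_apply] at h1
  rw [real_inner_comm]
  refine tendsto_nhds_unique h1 (h2.congr fun n => ?_)
  rw [real_inner_comm]

theorem exists_of_tendsto
    (hrefl : Function.Surjective (NormedSpace.inclusionInDoubleDual ℝ E)) (hd : DenseRange ι)
    {x : ℕ → E} {C : ℝ} (hC : ∀ n, ‖x n‖ ≤ C) {h : H}
    (hlim : Tendsto (fun n => ι (x n)) atTop (𝓝 h)) : ∃ y, ι y = h ∧ ‖y‖ ≤ C :=
  exists_of_tendsto_inner hrefl hd hC fun _ => hlim.inner tendsto_const_nhds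

/-- Balls of a reflexive space are closed for the norm of `H`. -/
theorem isClosed_image_closedBall
    (hrefl : Function.Surjective (NormedSpace.inclusionInDoubleDual ℝ E)) (hd : DenseRange ι)
    (d : E) (r : ℝ) : IsClosed (ι '' Metric.closedBall d r) := by
  refine IsSeqClosed.isClosed fun u h hu hlim => ?_
  choose x hx hxu using hu
  obtain ⟨y, hy, hyC⟩ := exists_of_tendsto hrefl hd (x := fun n => x n - d) (C := r) (h := h - ι d)
    (fun n => by simpa [dist_eq_norm] using hx n) (by
      simp only [map_sub, hxu]
      exact hlim.sub_const _)
  refine ⟨y + d, by simpa [dist_eq_norm] using hyC, by rw [map_add, hy, sub_add_cancel]⟩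

/-- On balls of a separable reflexive space `E`, the points at which convergence in `H` implies
convergence in `E` are dense for the norm of `H`, by Baire's theorem: `E`-balls are closed in `H`,
and countably many small ones cover. -/
theorem exists_near_continuity_point [CompleteSpace H] [TopologicalSpace.SeparableSpace E]
    (hrefl : Function.Surjective (NormedSpace.inclusionInDoubleDual ℝ E)) (hd : DenseRange ι)
    (hι : Function.Injective ι) {x : E} {C : ℝ} (hx : ‖x‖ ≤ C) {δ : ℝ} (hδ : 0 < δ) :
    ∃ y, ‖y‖ ≤ C ∧ ‖ι y - ι x‖ < δ ∧
      ∀ ε > 0, ∃ η > 0, ∀ z, ‖z‖ ≤ C → ‖ι z - ι y‖ < η → ‖z - y‖ < ε := by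
  set X : Set H := ι '' Metric.closedBall 0 C with hX
  have hXc : IsClosed X := isClosed_image_closedBall hrefl hd 0 C
  have : CompleteSpace X := hXc.completeSpace_coe
  obtain ⟨d, hdd⟩ := TopologicalSpace.exists_dense_seq E
  let K : ℕ → ℕ → Set X := fun n j =>
    {h | (h : H) ∈ ι '' Metric.closedBall (d j) (1 / ((n : ℝ) + 1))}
  have hKc : ∀ n j, IsClosed (K n j) := fun n j =>
    (isClosed_image_closedBall hrefl hd _ _).preimage continuous_subtype_val
  have hKU : ∀ n, ⋃ j, K n j = univ := by
    intro n
    rw [eq_univ_iff_forall]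
    rintro ⟨_, y, hy, rfl⟩
    obtain ⟨j, hj⟩ := hdd.exists_dist_lt y (show (0 : ℝ) < 1 / ((n : ℝ) + 1) by positivity)
    exact mem_iUnion.2 ⟨j, y, hj.le, rfl⟩
  have hO : Dense (⋂ n, ⋃ j, interior (K n j)) :=
    dense_iInter_of_isOpen (fun n => isOpen_iUnion fun j => isOpen_interior) fun n =>
      dense_iUnion_interior_of_closed (hKc n) (hKU n)
  have hxX : ι x ∈ X := ⟨x, by simpa using hx, rfl⟩
  obtain ⟨⟨_, y, hy, rfl⟩, hyO, hyd⟩ := hO.exists_dist_lt ⟨ι x, hxX⟩ hδ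
  refine ⟨y, by simpa using hy, ?_, fun ε hε => ?_⟩
  · rw [Subtype.dist_eq, dist_comm] at hyd
    rwa [dist_eq_norm] at hyd
  · obtain ⟨n, hn⟩ := exists_nat_one_div_lt (half_pos hε)
    obtain ⟨j, hj⟩ := mem_iUnion.1 (mem_iInter.1 hyO n)
    obtain ⟨η, hη, hball⟩ := Metric.mem_nhds_iff.1 (mem_interior_iff_mem_nhds.1 hj)
    refine ⟨η, hη, fun z hz hzy => ?_⟩
    have hzX : ι z ∈ X := ⟨z, by simpa using hz, rfl⟩
    obtain ⟨z', hz', hzz'⟩ := hball (show (⟨ι z, hzX⟩ : X) ∈ _ by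
      rw [Metric.mem_ball, Subtype.dist_eq, dist_eq_norm]; exact hzy)
    obtain ⟨y', hy', hyy'⟩ := mem_interior_iff_mem_nhds.1 hj |> mem_of_mem_nhds
    have e1 : z' = z := hι hzz'
    have e2 : y' = y := hι hyy'
    subst e1; subst e2
    rw [← dist_eq_norm]
    have := dist_triangle_right z' y' (d j)
    rw [Metric.mem_closedBall] at hz' hy'
    linarith

/-- Contractions of a separable reflexive space that converge strongly to the identity in the weaker
norm of `H` converge strongly in `E`: this holds at the vectors of `exists_near_continuity_point`,
and the vectors where it holds form a closed, hence weakly closed, subspace. -/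
theorem tendsto_of_tendsto_map_of_contraction [CompleteSpace H]
    [TopologicalSpace.SeparableSpace E]
    (hrefl : Function.Surjective (NormedSpace.inclusionInDoubleDual ℝ E)) (hd : DenseRange ι)
    (hι : Function.Injective ι) {α : Type*} {l : Filter α} {S : α → E →L[ℝ] E}
    (hS : ∀ᶠ a in l, ∀ x, ‖S a x‖ ≤ ‖x‖)
    (hlim : ∀ x, Tendsto (fun a => ι (S a x)) l (𝓝 (ι x))) (x : E) :
    Tendsto (fun a => S a x) l (𝓝 x) := by
  set Y : Set E := {y | Tendsto (fun a => S a y) l (𝓝 y)} with hY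
  have hYconv : Convex ℝ Y := by
    intro a ha b hb p q _ _ _
    have := (Tendsto.const_smul ha p).add (Tendsto.const_smul hb q)
    simpa only [hY, mem_ofPred_eq, map_add, map_smul] using this
  have hYclosed : IsClosed Y := by
    refine isClosed_of_closure_subset fun z hz => ?_
    rw [hY, mem_ofPred_eq, Metric.tendsto_nhds]
    intro ε hε
    obtain ⟨y, hy, hyz⟩ := Metric.mem_closure_iff.1 hz (ε / 3) (by positivity)
    filter_upwards [hS, (Metric.tendsto_nhds.1 hy) (ε / 3) (by positivity)] with a ha1 ha2
    have h1 : dist (S a z) (S a y) ≤ dist z y := by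
      rw [dist_eq_norm, dist_eq_norm, ← map_sub]; exact ha1 _
    have h2 := dist_triangle4_right (S a z) z (S a y) y
    have h3 := dist_triangle (S a z) (S a y) z
    have h4 := dist_triangle (S a y) y z
    rw [dist_comm y z] at h4
    linarith
  by_contra hx
  obtain ⟨ξ, u, h1, h2⟩ := geometric_hahn_banach_closed_point hYconv hYclosed (x := x) hx
  have hpts : ∀ n : ℕ, ∃ y ∈ Y, ‖y‖ ≤ ‖x‖ ∧ ‖ι y - ι x‖ < 1 / ((n : ℝ) + 1) := by
    intro n
    obtain ⟨y, hy1, hy2, hy3⟩ := exists_near_continuity_point hrefl hd hι (x := x) le_rfl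
      (show (0 : ℝ) < 1 / ((n : ℝ) + 1) by positivity)
    refine ⟨y, ?_, hy1, hy2⟩
    rw [hY, mem_ofPred_eq, Metric.tendsto_nhds]
    intro ε hε
    obtain ⟨η, hη, hη2⟩ := hy3 ε hε
    filter_upwards [hS, Metric.tendsto_nhds.1 (hlim y) η hη] with a ha1 ha2
    rw [dist_eq_norm] at ha2 ⊢
    exact hη2 _ ((ha1 y).trans hy1) ha2
  choose y hyY hyb hyx using hpts
  obtain ⟨𝒰, x', h𝒰, -, hξ⟩ := exists_ultrafilter_weak_limit hrefl hyb
  have hx' : x' = x := by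
    refine hι (hd.eq_of_inner_left ℝ fun w => ?_)
    have h3 := hξ ((innerSL ℝ (ι w)).comp ι)
    have h4 : Tendsto (fun n => ι (y n)) atTop (𝓝 (ι x)) := by
      rw [tendsto_iff_norm_sub_tendsto_zero]
      exact squeeze_zero (fun _ => norm_nonneg _) (fun n => (hyx n).le)
        tendsto_one_div_add_atTop_nhds_zero_nat
    have h5 := (((innerSL ℝ (ι w)).continuous.tendsto (ι x)).comp h4).mono_left h𝒰
    simp only [ContinuousLinearMap.comp_apply, innerSL_apply_apply] at h3
    simp only [Function.comp_def, innerSL_apply_apply] at h5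
    rw [real_inner_comm, real_inner_comm (ι w) (ι x)]
    exact tendsto_nhds_unique h3 h5
  have h6 := hξ ξ
  rw [hx'] at h6
  exact absurd (le_of_tendsto h6 (Eventually.of_forall fun n => (h1 _ (hyY n)).le)) (not_le.2 h2)

end Reflexive

/-- In the reflexive case `UE` is strongly continuous up to the diagonal. -/
theorem ApproximatedEvolution.continuousOn_orbit_of_reflexive {E H : Type*} [NormedAddCommGroup E]
    [NormedSpace ℝ E] [TopologicalSpace.SeparableSpace E]
    [NormedAddCommGroup H] [InnerProductSpace ℝ H] [CompleteSpace H] {T : ℝ} {ι : E →L[ℝ] H}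
    {U : ℝ → ℝ → H →L[ℝ] H} {UE : ℝ → ℝ → E →L[ℝ] E} {Un : ℕ → ℝ → ℝ → E →L[ℝ] E}
    (hA : ApproximatedEvolution T ι U UE Un)
    (hrefl : Function.Surjective (NormedSpace.inclusionInDoubleDual ℝ E)) (hd : DenseRange ι)
    (hι : Function.Injective ι) {s : ℝ} (hs : 0 ≤ s) (x : E) :
    ContinuousOn (fun t => UE t s x) (Icc s T) := by
  intro t ht
  rcases eq_or_lt_of_le ht.1 with rfl | hst
  · rw [ContinuousWithinAt, hA.evolE.refl s ⟨hs, ht.2⟩]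
    refine tendsto_of_tendsto_map_of_contraction hrefl hd hι ?_ (fun y => ?_) x
    · filter_upwards [self_mem_nhdsWithin] with r hr y
      exact hA.evolE.contr _ _ hs hr.1 hr.2 y
    · have h := hA.orbitH s hs (ι y) s ht
      rw [ContinuousWithinAt, hA.evolH.refl s ⟨hs, ht.2⟩] at h
      refine h.congr' ?_
      filter_upwards [self_mem_nhdsWithin] with r hr
      exact (hA.comm _ _ hs hr.1 hr.2 y).symm
  · have h := hA.evolE.continuousOn_orbit hs x t ⟨hst, ht.2⟩
    refine h.mono_of_mem_nhdsWithin ?_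
    filter_upwards [self_mem_nhdsWithin, mem_nhdsWithin_of_mem_nhds (Ioi_mem_nhds hst)] with r h1 h2
    exact ⟨h2, h1.2⟩

/-! ### Local bounds for superposition operators -/

section Radial

variable {E : Type*} [NormedAddCommGroup E] [NormedSpace ℝ E]

/-- The radial retraction onto the ball of radius `M`. -/
def radialRetraction (M : ℝ) (a : E) : E := (M / max M ‖a‖) • a

theorem norm_radialRetraction_le {M : ℝ} (hM : 0 < M) (a : E) : ‖radialRetraction M a‖ ≤ M := by
  have h : 0 < max M ‖a‖ := lt_max_of_lt_left hM
  rw [radialRetraction, norm_smul, Real.norm_of_nonneg (by positivity), div_mul_eq_mul_div,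
    div_le_iff₀ h]
  exact mul_le_mul_of_nonneg_left (le_max_right _ _) hM.le

theorem radialRetraction_of_norm_le {M : ℝ} (hM : 0 < M) {a : E} (ha : ‖a‖ ≤ M) :
    radialRetraction M a = a := by
  rw [radialRetraction, max_eq_left ha, div_self hM.ne', one_smul]

theorem norm_radialRetraction_sub_le {M : ℝ} (hM : 0 < M) (a b : E) :
    ‖radialRetraction M a - radialRetraction M b‖ ≤ 2 * ‖a - b‖ := by
  set p := max M ‖a‖ with hp
  set q := max M ‖b‖ with hq
  have hp0 : 0 < p := lt_max_of_lt_left hM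
  have hq0 : 0 < q := lt_max_of_lt_left hM
  have h1 : radialRetraction M a - radialRetraction M b =
      (M / p) • (a - b) + (M / p * ((q - p) / q)) • b := by
    have : M / q = M / p - M / p * ((q - p) / q) := by field_simp; ring
    rw [radialRetraction, radialRetraction, ← hp, ← hq, this]
    module
  have h2 : M / p ≤ 1 := (div_le_one hp0).2 (le_max_left _ _)
  have h3 : |q - p| ≤ ‖a - b‖ := by
    rw [hp, hq, abs_sub_comm]
    exact (abs_max_sub_max_le_max M ‖a‖ M ‖b‖).trans
      (max_le (by simp) (abs_norm_sub_norm_le a b))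
  have h4 : ‖b‖ ≤ q := le_max_right _ _
  have h5 : 0 ≤ M / p := by positivity
  rw [h1, two_mul]
  refine (norm_add_le _ _).trans (add_le_add ?_ ?_)
  · rw [norm_smul, Real.norm_of_nonneg h5]
    exact mul_le_of_le_one_left (norm_nonneg _) h2
  · rw [norm_smul, norm_mul, Real.norm_of_nonneg h5, norm_div, Real.norm_of_nonneg hq0.le,
      Real.norm_eq_abs]
    have h6 : |q - p| / q * ‖b‖ ≤ |q - p| := by
      rw [div_mul_eq_mul_div, div_le_iff₀ hq0]
      exact mul_le_mul_of_nonneg_left h4 (abs_nonneg _)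
    rw [mul_assoc]
    exact (mul_le_of_le_one_left (by positivity) h2).trans (h6.trans h3)

theorem continuous_radialRetraction {M : ℝ} (hM : 0 < M) :
    Continuous (radialRetraction M : E → E) := by
  refine (LipschitzWith.of_dist_le_mul (K := 2) fun a b => ?_).continuous
  rw [dist_eq_norm, dist_eq_norm]
  exact norm_radialRetraction_sub_le hM a b

end Radial

section LocalBound

open scoped ENNReal

variable {E : Type*} [NormedAddCommGroup E] [NormedSpace ℝ E] [CompleteSpace E]
  {Φ : ℝ → E → E} {a b : ℝ}

/-- A superposition operator that has integrable values along all continuous paths is bounded in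
`L¹` on a small ball of continuous paths, locally in time. Otherwise paths with large values on
disjoint annuli around `t₀` could be glued to a single continuous path. -/
theorem exists_lintegral_bound_near
    (hΦ : ∀ g : ℝ → E, Continuous g → IntegrableOn (fun t => Φ t (g t)) (Icc a b)) (t₀ : ℝ) :
    ∃ δ > 0, ∃ ρ > 0, ∃ M : ℝ≥0∞, M ≠ ∞ ∧ ∀ g : ℝ → E, Continuous g → (∀ t, ‖g t‖ ≤ ρ) →
      ∫⁻ t in Icc a b ∩ Metric.ball t₀ δ, ‖Φ t (g t)‖ₑ ≤ M := by
  by_contra! hcon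
  let A : ℝ → ℝ → Set ℝ := fun δ' δ => {t | δ' < |t - t₀| ∧ |t - t₀| < δ}
  -- a small path supported in an annulus inside any given interval around `t₀`, with large values
  have hstep : ∀ (n : ℕ) (δ : ℝ), 0 < δ → ∃ δ' : ℝ, ∃ h : ℝ → E, 0 < δ' ∧ δ' < δ ∧
      Continuous h ∧ (∀ t, ‖h t‖ ≤ (1 / 2 : ℝ) ^ n) ∧ (∀ t, t ∉ A δ' δ → h t = 0) ∧
      1 < ∫⁻ t in Icc a b ∩ A δ' δ, ‖Φ t (h t)‖ₑ := by
    intro n δ hδ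
    obtain ⟨g, hg, hgn, hlt⟩ := hcon δ hδ ((1 / 2 : ℝ) ^ n) (by positivity) 1 (by simp)
    -- closed annuli that exhaust the punctured interval around `t₀`
    let C : ℕ → Set ℝ := fun j =>
      {t | δ / (j + 2) ≤ |t - t₀| ∧ |t - t₀| ≤ δ - δ / (j + 2)}
    have hCmono : Monotone C := by
      intro i j hij t ht
      have : δ / ((j : ℝ) + 2) ≤ δ / (i + 2) := by gcongr
      exact ⟨this.trans ht.1, ht.2.trans (by linarith)⟩
    have hCU : Icc a b ∩ Metric.ball t₀ δ ⊆ (⋃ j, Icc a b ∩ C j) ∪ {t₀} := by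
      rintro t ⟨ht, htb⟩
      rw [Metric.mem_ball, Real.dist_eq] at htb
      by_cases h0 : t = t₀
      · exact Or.inr h0
      · left
        have hpos : 0 < |t - t₀| := abs_pos.2 (sub_ne_zero.2 h0)
        obtain ⟨j, hj⟩ := exists_nat_gt (δ / min |t - t₀| (δ - |t - t₀|))
        have hmin : 0 < min |t - t₀| (δ - |t - t₀|) := lt_min hpos (by linarith)
        rw [div_lt_iff₀ hmin] at hj
        have h1 : δ / ((j : ℝ) + 2) ≤ min |t - t₀| (δ - |t - t₀|) := by
          rw [div_le_iff₀ (by positivity)]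
          nlinarith
        refine mem_iUnion.2 ⟨j, ht, h1.trans (min_le_left _ _), ?_⟩
        have := h1.trans (min_le_right _ _)
        linarith
    have hlt2 : 1 < ⨆ j, ∫⁻ t in Icc a b ∩ C j, ‖Φ t (g t)‖ₑ := by
      rw [← setLIntegral_iUnion_of_directed]
      · refine hlt.trans_le ((lintegral_mono_set hCU).trans ?_)
        refine (lintegral_union_le _ _ _).trans ?_
        simp
      · exact (directed_of_isDirected_le fun i j hij => inter_subset_inter_right _ (hCmono hij))
    obtain ⟨j, hj⟩ := lt_iSup_iff.1 hlt2
    have hdj : 0 < δ / ((j : ℝ) + 2) := by positivity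
    have hcont : Continuous fun t : ℝ => |t - t₀| := by fun_prop
    have hAopen : IsOpen (A (δ / (j + 3)) δ) :=
      (isOpen_lt continuous_const hcont).inter (isOpen_lt hcont continuous_const)
    have hCclosed : IsClosed (C j) :=
      (isClosed_le continuous_const hcont).inter (isClosed_le hcont continuous_const)
    have hCA : C j ⊆ A (δ / (j + 3)) δ := by
      intro t ht
      have : δ / ((j : ℝ) + 3) < δ / (j + 2) := by gcongr; norm_num
      exact ⟨this.trans_le ht.1, ht.2.trans_lt (by linarith)⟩
    obtain ⟨θ, hθ0, hθ1, hθ⟩ := exists_continuous_zero_one_of_isClosed hAopen.isClosed_compl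
      hCclosed (disjoint_compl_left_iff_subset.2 hCA)
    refine ⟨δ / (j + 3), fun t => θ t • g t, by positivity, ?_, by fun_prop, fun t => ?_,
      fun t ht => ?_, ?_⟩
    · exact div_lt_self hδ (by linarith [(Nat.cast_nonneg j : (0 : ℝ) ≤ j)])
    · rw [norm_smul, Real.norm_of_nonneg (hθ t).1]
      exact (mul_le_of_le_one_left (norm_nonneg _) (hθ t).2).trans (hgn t)
    · simp only
      rw [hθ0 ht]; simp
    · refine hj.trans_le (le_trans (le_of_eq ?_)
        (lintegral_mono_set (inter_subset_inter_right _ hCA)))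
      refine setLIntegral_congr_fun (measurableSet_Icc.inter hCclosed.measurableSet) fun t ht => ?_
      simp only
      rw [hθ1 ht.2]; simp
  choose! δ' h h1 h2 h3 h4 h5 h6 using hstep
  let d : ℕ → ℝ := fun n => Nat.rec 1 (fun n r => δ' n r) n
  have hd0 : ∀ n, 0 < d n := by
    intro n
    induction n with
    | zero => exact one_pos
    | succ n ih => exact h1 n _ ih
  have hdanti : Antitone d := antitone_nat_of_succ_le fun n => (h2 n _ (hd0 n)).le
  let B : ℕ → Set ℝ := fun n => A (d (n + 1)) (d n)
  have hBdisj : Pairwise (Function.onFun Disjoint B) := by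
    have hlt : ∀ m n, m < n → Disjoint (B m) (B n) := by
      intro m n hmn
      rw [Set.disjoint_left]
      intro t htm htn
      have h7 : d n ≤ d (m + 1) := hdanti hmn
      have h8 : d (m + 1) < |t - t₀| := htm.1
      have h9 : |t - t₀| < d n := htn.2
      linarith
    intro m n hmn
    rcases lt_or_gt_of_ne hmn with h7 | h7
    · exact hlt m n h7
    · exact (hlt n m h7).symm
  let g : ℝ → E := fun t => ∑' n, h n (d n) t
  have hgcont : Continuous g := continuous_tsum (fun n => h3 n _ (hd0 n))
    (summable_geometric_of_lt_one (by norm_num) (by norm_num : (1 / 2 : ℝ) < 1))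
    (fun n t => h4 n _ (hd0 n) t)
  have hg : ∀ n, ∀ t ∈ B n, g t = h n (d n) t := by
    intro n t ht
    refine tsum_eq_single n fun m hm => ?_
    refine h5 m _ (hd0 m) t fun htm => ?_
    exact Set.disjoint_left.1 (hBdisj hm) htm ht
  have hBmeas : ∀ n, MeasurableSet (B n) := fun n => by
    have hcont : Continuous fun t : ℝ => |t - t₀| := by fun_prop
    exact ((isOpen_lt continuous_const hcont).inter
      (isOpen_lt hcont continuous_const)).measurableSet
  have hfin : ∫⁻ t in Icc a b, ‖Φ t (g t)‖ₑ < ∞ := (hΦ g hgcont).hasFiniteIntegral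
  have hinf : ∞ ≤ ∫⁻ t in Icc a b, ‖Φ t (g t)‖ₑ := by
    calc (∞ : ℝ≥0∞) = ∑' _ : ℕ, (1 : ℝ≥0∞) := by
          rw [ENNReal.tsum_const_eq_top_of_ne_zero one_ne_zero]
      _ ≤ ∑' n, ∫⁻ t in Icc a b ∩ B n, ‖Φ t (g t)‖ₑ := by
          refine ENNReal.tsum_le_tsum fun n => ?_
          refine (h6 n _ (hd0 n)).le.trans (le_of_eq ?_)
          refine setLIntegral_congr_fun (measurableSet_Icc.inter (hBmeas n)) fun t ht => ?_
          rw [hg n t ht.2]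
      _ = ∫⁻ t in ⋃ n, Icc a b ∩ B n, ‖Φ t (g t)‖ₑ :=
          (lintegral_iUnion (fun n => measurableSet_Icc.inter (hBmeas n))
            (fun m n hmn => (hBdisj hmn).mono inter_subset_right inter_subset_right) _).symm
      _ ≤ _ := lintegral_mono_set (iUnion_subset fun n => inter_subset_left)
  exact absurd hfin (not_lt.2 hinf)

/-- The bound on a small ball of continuous paths, over all of `[a, b]`, by compactness. -/
theorem exists_lintegral_bound
    (hΦ : ∀ g : ℝ → E, Continuous g → IntegrableOn (fun t => Φ t (g t)) (Icc a b)) :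
    ∃ ρ > 0, ∃ M : ℝ≥0∞, M ≠ ∞ ∧ ∀ g : ℝ → E, Continuous g → (∀ t, ‖g t‖ ≤ ρ) →
      ∫⁻ t in Icc a b, ‖Φ t (g t)‖ₑ ≤ M := by
  have key := isCompact_Icc.induction_on (s := Icc a b)
    (p := fun S => ∃ ρ > 0, ∃ M : ℝ≥0∞, M ≠ ∞ ∧ ∀ g : ℝ → E, Continuous g → (∀ t, ‖g t‖ ≤ ρ) →
      ∫⁻ t in Icc a b ∩ S, ‖Φ t (g t)‖ₑ ≤ M) ?_ ?_ ?_ ?_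
  · simpa using key
  · exact ⟨1, one_pos, 0, by simp, fun g _ _ => by simp⟩
  · rintro s t hst ⟨ρ, hρ, M, hM, h⟩
    exact ⟨ρ, hρ, M, hM, fun g hg hgn =>
      (lintegral_mono_set (inter_subset_inter_right _ hst)).trans (h g hg hgn)⟩
  · rintro s t ⟨ρ, hρ, M, hM, h⟩ ⟨ρ', hρ', M', hM', h'⟩
    refine ⟨min ρ ρ', lt_min hρ hρ', M + M', ENNReal.add_ne_top.2 ⟨hM, hM'⟩, fun g hg hgn => ?_⟩
    rw [inter_union_distrib_left]
    exact (lintegral_union_le _ _ _).trans (add_le_add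
      (h g hg fun t => (hgn t).trans (min_le_left _ _))
      (h' g hg fun t => (hgn t).trans (min_le_right _ _)))
  · intro t₀ _
    obtain ⟨δ, hδ, h⟩ := exists_lintegral_bound_near hΦ t₀
    exact ⟨_, mem_nhdsWithin_of_mem_nhds (Metric.ball_mem_nhds t₀ hδ), h⟩

/-- The bound of `exists_lintegral_bound` passes from continuous paths to measurable ones by
approximation, and hence to suprema over countably many paths: the index that nearly realizes the
supremum can be chosen measurably. -/
theorem exists_lintegral_iSup_bound (hab : a ≤ b)
    (hΦ : ∀ g : ℝ → E, Continuous g → IntegrableOn (fun t => Φ t (g t)) (Icc a b))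
    (hlsc : ∀ t ∈ Icc a b, ∀ (v : ℕ → E) (y : E), Tendsto v atTop (𝓝 y) →
      ‖Φ t y‖ₑ ≤ liminf (fun n => ‖Φ t (v n)‖ₑ) atTop) :
    ∃ ρ > 0, ∃ M : ℝ≥0∞, M ≠ ∞ ∧ ∀ u : ℕ → ℝ → E, (∀ k, ContinuousOn (u k) (Icc a b)) →
      (∀ k, ∀ t ∈ Icc a b, ‖u k t‖ ≤ ρ) →
      ∫⁻ t in Icc a b, ⨆ k, ‖Φ t (u k t)‖ₑ ≤ M := by
  obtain ⟨ρ, hρ, M, hM, hbd⟩ := exists_lintegral_bound hΦ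
  have hmeas : ∀ g : ℝ → E, Continuous g →
      AEMeasurable (fun t => ‖Φ t (g t)‖ₑ) (volume.restrict (Icc a b)) := fun g hg =>
    (hΦ g hg).aestronglyMeasurable.enorm
  -- measurable paths are a.e. limits of continuous ones, so that Fatou's lemma applies
  have hσ : ∀ σ : ℝ → E, AEStronglyMeasurable σ (volume.restrict (Icc a b)) →
      (∀ t, ‖σ t‖ ≤ ρ) → ∫⁻ t in Icc a b, ‖Φ t (σ t)‖ₑ ≤ M := by
    intro σ hσm hσρ
    have hmem : MemLp σ 1 (volume.restrict (Icc a b)) :=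
      MemLp.of_bound hσm ρ (Eventually.of_forall hσρ)
    have happ : ∀ n : ℕ, ∃ g : ℝ → E, Continuous g ∧
        AEStronglyMeasurable g (volume.restrict (Icc a b)) ∧
        eLpNorm (σ - g) 1 (volume.restrict (Icc a b)) ≤ ((n : ℝ≥0∞) + 1)⁻¹ := by
      intro n
      obtain ⟨g, hg1, hg2⟩ := hmem.exists_boundedContinuous_eLpNorm_sub_le (by simp)
        (ε := ((n : ℝ≥0∞) + 1)⁻¹) (by simp)
      exact ⟨g, g.continuous, hg2.1, hg1⟩
    choose g hgc hgm hgl using happ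
    have hlim0 : Tendsto (fun n : ℕ => ((n : ℝ≥0∞) + 1)⁻¹) atTop (𝓝 0) := by
      have := (tendsto_add_atTop_iff_nat 1).2 ENNReal.tendsto_inv_nat_nhds_zero
      simpa using this
    have hlim : Tendsto (fun n => eLpNorm (g n - σ) 1 (volume.restrict (Icc a b))) atTop (𝓝 0) := by
      refine tendsto_of_tendsto_of_tendsto_of_le_of_le tendsto_const_nhds hlim0
        (fun _ => zero_le) fun n => ?_
      simp only
      rw [← eLpNorm_neg, neg_sub]
      exact hgl n
    obtain ⟨ns, -, hns⟩ := (tendstoInMeasure_of_tendsto_eLpNorm one_ne_zero hgm hσm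
      hlim).exists_seq_tendsto_ae
    set w : ℕ → ℝ → E := fun n t => radialRetraction ρ (g (ns n) t) with hw
    have hwc : ∀ n, Continuous (w n) := fun n => (continuous_radialRetraction hρ).comp (hgc _)
    calc ∫⁻ t in Icc a b, ‖Φ t (σ t)‖ₑ
        ≤ ∫⁻ t in Icc a b, liminf (fun n => ‖Φ t (w n t)‖ₑ) atTop := by
          refine lintegral_mono_ae ?_
          filter_upwards [hns, ae_restrict_mem measurableSet_Icc] with t ht htI
          refine hlsc t htI _ _ ?_
          have := ((continuous_radialRetraction hρ).tendsto (σ t)).comp ht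
          rwa [radialRetraction_of_norm_le hρ (hσρ t)] at this
      _ ≤ liminf (fun n => ∫⁻ t in Icc a b, ‖Φ t (w n t)‖ₑ) atTop :=
          lintegral_liminf_le' fun n => hmeas _ (hwc n)
      _ ≤ M := by
          refine liminf_le_of_frequently_le' (Frequently.of_forall fun n => ?_)
          exact hbd _ (hwc n) fun t => norm_radialRetraction_le hρ _
  refine ⟨ρ, hρ, M, hM, fun u₀ hu₀ hu₀ρ => ?_⟩
  -- replace the paths by globally continuous ones
  set u : ℕ → ℝ → E := fun k t => u₀ k (projIcc a b hab t) with hu_def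
  have huc : ∀ k, Continuous (u k) := fun k =>
    (hu₀ k).comp_continuous (continuous_subtype_val.comp continuous_projIcc)
      fun t => (projIcc a b hab t).2
  have huρ : ∀ k t, ‖u k t‖ ≤ ρ := fun k t => hu₀ρ k _ (projIcc a b hab t).2
  -- a measurable path `σ` that realizes the maximum over the first `n` paths
  have hfin : ∀ n : ℕ, ∃ σ : ℝ → E, AEStronglyMeasurable σ (volume.restrict (Icc a b)) ∧
      (∀ t, ‖σ t‖ ≤ ρ) ∧
      AEMeasurable (fun t => ‖Φ t (σ t)‖ₑ) (volume.restrict (Icc a b)) ∧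
      ∀ᵐ t ∂volume.restrict (Icc a b), ∀ k ≤ n, ‖Φ t (u k t)‖ₑ ≤ ‖Φ t (σ t)‖ₑ := by
    intro n
    induction n with
    | zero =>
      refine ⟨u 0, (huc 0).aestronglyMeasurable, huρ 0, hmeas _ (huc 0), ?_⟩
      filter_upwards with t k hk
      rw [Nat.le_zero.1 hk]
    | succ n ih =>
      classical
      obtain ⟨σ, hσm, hσρ, hσΦ, hσle⟩ := ih
      set S : Set ℝ := {t | ‖Φ t (σ t)‖ₑ < ‖Φ t (u (n + 1) t)‖ₑ} with hS
      have hSn : NullMeasurableSet S (volume.restrict (Icc a b)) :=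
        nullMeasurableSet_lt hσΦ (hmeas _ (huc _))
      set S' := toMeasurable (volume.restrict (Icc a b)) S with hS'
      have hSS' : ∀ᵐ t ∂volume.restrict (Icc a b), t ∈ S' ↔ t ∈ S := by
        filter_upwards [hSn.toMeasurable_ae_eq] with t ht
        exact iff_of_eq ht
      have hmax : ∀ᵐ t ∂volume.restrict (Icc a b),
          ‖Φ t (S'.piecewise (u (n + 1)) σ t)‖ₑ =
            max ‖Φ t (σ t)‖ₑ ‖Φ t (u (n + 1) t)‖ₑ := by
        filter_upwards [hSS'] with t ht
        by_cases h : t ∈ S'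
        · rw [piecewise_eq_of_mem _ _ _ h, max_eq_right (le_of_lt (ht.1 h))]
        · rw [piecewise_eq_of_notMem _ _ _ h, max_eq_left (not_lt.1 fun h' => h (ht.2 h'))]
      refine ⟨S'.piecewise (u (n + 1)) σ, ?_, fun t => ?_, ?_, ?_⟩
      · exact AEStronglyMeasurable.piecewise (measurableSet_toMeasurable _ _)
          (huc _).aestronglyMeasurable hσm.restrict
      · by_cases h : t ∈ S'
        · rw [piecewise_eq_of_mem _ _ _ h]; exact huρ _ _
        · rw [piecewise_eq_of_notMem _ _ _ h]; exact hσρ _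
      · exact (hσΦ.max (hmeas _ (huc (n + 1)))).congr (hmax.mono fun t ht => ht.symm)
      · filter_upwards [hmax, hσle] with t ht1 ht2 k hk
        rw [ht1]
        rcases Nat.lt_or_ge n k with h | h
        · have : k = n + 1 := le_antisymm hk h
          rw [this]; exact le_max_right _ _
        · exact (ht2 k h).trans (le_max_left _ _)
  have hcongr : ∫⁻ t in Icc a b, ⨆ k, ‖Φ t (u₀ k t)‖ₑ = ∫⁻ t in Icc a b, ⨆ k, ‖Φ t (u k t)‖ₑ := by
    refine setLIntegral_congr_fun measurableSet_Icc fun t ht => ?_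
    simp only [hu_def, projIcc_of_mem hab ht]
  have hsup : ∀ t, ⨆ k, ‖Φ t (u k t)‖ₑ = ⨆ n : ℕ, ⨆ k ∈ Iic n, ‖Φ t (u k t)‖ₑ := fun t =>
    le_antisymm (iSup_le fun k => le_iSup_of_le k (le_iSup₂_of_le k self_mem_Iic le_rfl))
      (iSup_le fun n => iSup₂_le fun k _ => le_iSup (fun k => ‖Φ t (u k t)‖ₑ) k)
  rw [hcongr]
  simp only [hsup]
  rw [lintegral_iSup']
  · refine iSup_le fun n => ?_
    obtain ⟨σ, hσm, hσρ, -, hσle⟩ := hfin n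
    refine (lintegral_mono_ae ?_).trans (hσ σ hσm hσρ)
    filter_upwards [hσle] with t ht
    exact iSup₂_le fun k hk => ht k hk
  · exact fun n => AEMeasurable.biSup _ (to_countable _) fun k _ => hmeas _ (huc k)
  · filter_upwards with t m n hmn
    exact biSup_mono fun k hk => le_trans hk hmn

end LocalBound

/-! ### Mild solutions for a given forcing term -/

section MildEquation

variable {V : Type*} [NormedAddCommGroup V] [NormedSpace ℝ V]

/-- `u` is the mild solution on `[s, T]` of `u' = A(t) u + g(t)`, `u(s) = x`, where `W` is the
evolution family of `A`. -/
structure IsMildFor (W : ℝ → ℝ → V →L[ℝ] V) (s T : ℝ) (g : ℝ → V) (x : V) (u : ℝ → V) : Prop where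
  integrable : IntegrableOn g (Ioc s T)
  eq : ∀ t ∈ Icc s T, u t = W t s x + ∫ r in s..t, W t r (g r)

namespace IsMildFor

variable {W : ℝ → ℝ → V →L[ℝ] V} {s T : ℝ} {g g₁ g₂ : ℝ → V} {x x₁ x₂ : V} {u u₁ u₂ : ℝ → V}

theorem apply_left (hu : IsMildFor W s T g x u) (hW : IsContractionEvolution T W) (hs : 0 ≤ s)
    (hsT : s ≤ T) : u s = x := by
  rw [hu.eq s ⟨le_rfl, hsT⟩, intervalIntegral.integral_same, add_zero, hW.refl s ⟨hs, hsT⟩]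

theorem congr (hu : IsMildFor W s T g₁ x u) (h : ∀ r ∈ Ioc s T, g₁ r = g₂ r) :
    IsMildFor W s T g₂ x u := by
  refine ⟨hu.integrable.congr_fun h measurableSet_Ioc, fun t ht => ?_⟩
  rw [hu.eq t ht]
  congr 1
  refine intervalIntegral.integral_congr_ae (Eventually.of_forall fun r hr => ?_)
  rw [uIoc_of_le ht.1] at hr
  rw [h r ⟨hr.1, hr.2.trans ht.2⟩]

theorem sub (h₁ : IsMildFor W s T g₁ x₁ u₁) (h₂ : IsMildFor W s T g₂ x₂ u₂)
    (hW : IsContractionEvolution T W) (hs : 0 ≤ s) :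
    IsMildFor W s T (fun r => g₁ r - g₂ r) (x₁ - x₂) (fun r => u₁ r - u₂ r) := by
  refine ⟨h₁.integrable.sub h₂.integrable, fun t ht => ?_⟩
  simp only [h₁.eq t ht, h₂.eq t ht, map_sub]
  rw [intervalIntegral.integral_sub
    (hW.intervalIntegrable hs ht.2 le_rfl ht.1 le_rfl h₁.integrable)
    (hW.intervalIntegrable hs ht.2 le_rfl ht.1 le_rfl h₂.integrable)]
  abel

theorem add (h₁ : IsMildFor W s T g₁ x₁ u₁) (h₂ : IsMildFor W s T g₂ x₂ u₂)
    (hW : IsContractionEvolution T W) (hs : 0 ≤ s) :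
    IsMildFor W s T (fun r => g₁ r + g₂ r) (x₁ + x₂) (fun r => u₁ r + u₂ r) := by
  refine ⟨h₁.integrable.add h₂.integrable, fun t ht => ?_⟩
  simp only [h₁.eq t ht, h₂.eq t ht, map_add]
  rw [intervalIntegral.integral_add
    (hW.intervalIntegrable hs ht.2 le_rfl ht.1 le_rfl h₁.integrable)
    (hW.intervalIntegrable hs ht.2 le_rfl ht.1 le_rfl h₂.integrable)]
  abel

theorem continuousOn_Ioc (hu : IsMildFor W s T g x u) (hW : IsContractionEvolution T W)
    (hs : 0 ≤ s) : ContinuousOn u (Ioc s T) :=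
  ((hW.continuousOn_orbit hs x).add
    ((hW.continuousOn_convolution hs hu.integrable).mono Ioc_subset_Icc_self)).congr
    fun t ht => hu.eq t (Ioc_subset_Icc_self ht)

theorem continuousOn_Icc (hu : IsMildFor W s T g x u) (hW : IsContractionEvolution T W)
    (hs : 0 ≤ s) (hx : ContinuousOn (fun t => W t s x) (Icc s T)) : ContinuousOn u (Icc s T) :=
  (hx.add (hW.continuousOn_convolution hs hu.integrable)).congr hu.eq

theorem exists_bound [CompleteSpace V] (hu : IsMildFor W s T g x u)
    (hW : IsContractionEvolution T W) (hs : 0 ≤ s) :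
    ∃ C, ∀ t ∈ Icc s T, ‖u t‖ ≤ C :=
  ⟨_, hW.norm_le_bound hs hu.integrable hu.eq⟩

end IsMildFor

end MildEquation

theorem tendsto_inner_of_dense {E H : Type*} [NormedAddCommGroup E] [NormedSpace ℝ E]
    [NormedAddCommGroup H] [InnerProductSpace ℝ H] {ι : E →L[ℝ] H} {y : ℕ → H} {h : H} {C : ℝ}
    (hd : DenseRange ι) (hC : ∀ n, ‖y n‖ ≤ C)
    (hlim : ∀ z : E, Tendsto (fun n => inner ℝ (y n) (ι z)) atTop (𝓝 (inner ℝ h (ι z)))) (w : H) :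
    Tendsto (fun n => inner ℝ (y n) w) atTop (𝓝 (inner ℝ h w)) := by
  rw [Metric.tendsto_atTop]
  intro ε hε
  have hC0 : 0 ≤ C := (norm_nonneg _).trans (hC 0)
  have hδ : 0 < ε / (2 * (C + ‖h‖ + 1)) := by positivity
  obtain ⟨z, hz⟩ := hd.exists_dist_lt w hδ
  obtain ⟨N, hN⟩ := Metric.tendsto_atTop.1 (hlim z) (ε / 2) (by positivity)
  refine ⟨N, fun n hn => ?_⟩
  have h1 := hN n hn
  rw [Real.dist_eq] at h1 ⊢
  have h2 : inner ℝ (y n) w - inner ℝ h w =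
      inner ℝ (y n - h) (w - ι z) + (inner ℝ (y n) (ι z) - inner ℝ h (ι z)) := by
    simp only [inner_sub_left, inner_sub_right]; ring
  rw [h2]
  have h3 : |inner ℝ (y n - h) (w - ι z)| ≤ ε / 2 := by
    refine (abs_real_inner_le_norm _ _).trans ?_
    rw [dist_eq_norm] at hz
    calc ‖y n - h‖ * ‖w - ι z‖ ≤ (C + ‖h‖ + 1) * (ε / (2 * (C + ‖h‖ + 1))) := by
          refine mul_le_mul ?_ hz.le (norm_nonneg _) (by positivity)
          linarith [norm_sub_le (y n) h, hC n]
      _ = ε / 2 := by field_simp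
  linarith [abs_add_le (inner ℝ (y n - h) (w - ι z)) (inner ℝ (y n) (ι z) - inner ℝ h (ι z))]

section Embedded

variable {E H : Type*} [NormedAddCommGroup E] [NormedSpace ℝ E] [CompleteSpace E]
  [NormedAddCommGroup H] [InnerProductSpace ℝ H] [CompleteSpace H]
  {T s : ℝ} {ι : E →L[ℝ] H} {U : ℝ → ℝ → H →L[ℝ] H} {UE : ℝ → ℝ → E →L[ℝ] E}
  {Un : ℕ → ℝ → ℝ → E →L[ℝ] E} {g : ℝ → E} {x : E} {u : ℝ → E}

theorem IsMildFor.map (hu : IsMildFor UE s T g x u) (hA : ApproximatedEvolution T ι U UE Un)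
    (hs : 0 ≤ s) : IsMildFor U s T (fun r => ι (g r)) (ι x) (fun t => ι (u t)) := by
  refine ⟨ι.integrable_comp hu.integrable, fun t ht => ?_⟩
  simp only [hu.eq t ht, map_add]
  rw [hA.comm _ _ hs ht.1 ht.2, ← ι.intervalIntegral_comp_comm
    (hA.evolE.intervalIntegrable hs ht.2 le_rfl ht.1 le_rfl hu.integrable)]
  congr 1
  refine intervalIntegral.integral_congr_ae (Eventually.of_forall fun r hr => ?_)
  rw [uIoc_of_le ht.1] at hr
  exact hA.comm _ _ (hs.trans hr.1.le) hr.2 ht.2 _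

/-- A mild equation that holds in `H`, with data in `E`, holds in `E`. -/
theorem IsMildFor.of_map (hι : Function.Injective ι) (hA : ApproximatedEvolution T ι U UE Un)
    (hs : 0 ≤ s) (hg : IntegrableOn g (Ioc s T))
    (hu : IsMildFor U s T (fun r => ι (g r)) (ι x) (fun t => ι (u t))) :
    IsMildFor UE s T g x u := by
  refine ⟨hg, fun t ht => hι ?_⟩
  have h : IsMildFor UE s T g x (fun t => UE t s x + ∫ r in s..t, UE t r (g r)) :=
    ⟨hg, fun _ _ => rfl⟩
  exact (hu.eq t ht).trans ((h.map hA hs).eq t ht).symm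

/-- Mild equations pass to the limit when the solutions converge in `H` and the forcing terms
converge weakly in `H`, dominated in the norm of `E`. -/
theorem IsMildFor.of_weak_limit
    (hrefl : Function.Surjective (NormedSpace.inclusionInDoubleDual ℝ E)) (hd : DenseRange ι)
    (hι : Function.Injective ι) (hA : ApproximatedEvolution T ι U UE Un) (hs : 0 ≤ s)
    {gn : ℕ → ℝ → E} {un : ℕ → ℝ → E} (hun : ∀ n, IsMildFor UE s T (gn n) x (un n))
    (hlim : ∀ t ∈ Icc s T, Tendsto (fun n => ι (un n t)) atTop (𝓝 (ι (u t))))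
    {φ : ℝ → ℝ} (hφ : IntegrableOn φ (Ioc s T))
    (hdom : ∀ᵐ r ∂volume.restrict (Ioc s T), ∀ n, ‖gn n r‖ ≤ φ r)
    (hg : AEStronglyMeasurable g (volume.restrict (Ioc s T)))
    (hweak : ∀ᵐ r ∂volume.restrict (Ioc s T), ∀ z : E,
      Tendsto (fun n => inner ℝ (ι (gn n r)) (ι z)) atTop (𝓝 (inner ℝ (ι (g r)) (ι z)))) :
    IsMildFor UE s T g x u := by
  have hgφ : ∀ᵐ r ∂volume.restrict (Ioc s T), ‖g r‖ ≤ φ r := by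
    filter_upwards [hdom, hweak] with r h1 h2
    obtain ⟨y, hy, hyn⟩ := exists_of_tendsto_inner hrefl hd h1 h2
    rwa [← hι hy]
  have hgi : IntegrableOn g (Ioc s T) := Integrable.mono' hφ hg hgφ
  refine IsMildFor.of_map hι hA hs hgi ⟨ι.integrable_comp hgi, fun t ht => ?_⟩
  have hmono : Ioc s t ⊆ Ioc s T := Ioc_subset_Ioc_right ht.2
  refine ext_inner_right ℝ fun h => ?_
  have h1 : Tendsto (fun n => inner ℝ (ι (un n t)) h) atTop (𝓝 (inner ℝ (ι (u t)) h)) :=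
    (hlim t ht).inner tendsto_const_nhds
  have hint : ∀ γ : ℝ → E, IntegrableOn γ (Ioc s T) →
      inner ℝ (U t s (ι x) + ∫ r in s..t, U t r (ι (γ r))) h =
        inner ℝ (U t s (ι x)) h + ∫ r in Ioc s t, inner ℝ (U t r (ι (γ r))) h := by
    intro γ hγ
    have h2 : IntegrableOn (fun r => U t r (ι (γ r))) (Ioc s t) :=
      hA.evolH.integrableOn hs ht.2 (ι.integrable_comp (hγ.mono_set hmono))
    rw [inner_add_left, intervalIntegral.integral_of_le ht.1, real_inner_comm h (∫ r in _, _),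
      ← integral_inner h2]
    simp only [real_inner_comm]
  have h3 : ∀ n, inner ℝ (ι (un n t)) h =
      inner ℝ (U t s (ι x)) h + ∫ r in Ioc s t, inner ℝ (U t r (ι (gn n r))) h := fun n => by
    rw [← hint _ (hun n).integrable]
    exact congrArg (fun y => inner ℝ y h) (((hun n).map hA hs).eq t ht)
  rw [hint g hgi]
  refine tendsto_nhds_unique h1 ?_
  simp only [h3]
  refine tendsto_const_nhds.add ?_
  refine tendsto_integral_of_dominated_convergence (fun r => ‖ι‖ * φ r * ‖h‖) (fun n => ?_)
    (((hφ.mono_set hmono).const_mul _).mul_const _) (fun n => ?_) ?_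
  · have h2 : IntegrableOn (fun r => U t r (ι (gn n r))) (Ioc s t) :=
      hA.evolH.integrableOn hs ht.2 (ι.integrable_comp ((hun n).integrable.mono_set hmono))
    exact (h2.inner_const h).aestronglyMeasurable
  · filter_upwards [ae_restrict_of_ae_restrict_of_subset hmono hdom,
      ae_restrict_mem measurableSet_Ioc] with r hr hrI
    refine (norm_inner_le_norm _ _).trans (mul_le_mul_of_nonneg_right ?_ (norm_nonneg _))
    exact (hA.evolH.contr _ _ (hs.trans hrI.1.le) hrI.2 ht.2 _).trans
      (ι.le_of_opNorm_le_of_le le_rfl (hr n))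
  · filter_upwards [ae_restrict_of_ae_restrict_of_subset hmono hdom,
      ae_restrict_of_ae_restrict_of_subset hmono hweak] with r hr1 hr2
    have h4 := tendsto_inner_of_dense hd (C := ‖ι‖ * φ r)
      (fun n => ι.le_of_opNorm_le_of_le le_rfl (hr1 n)) hr2 (ContinuousLinearMap.adjoint (U t r) h)
    simpa only [ContinuousLinearMap.adjoint_inner_right] using h4

end Embedded

/-! ### Families of dissipative maps and their Yosida approximations -/

theorem integral_exp_mul_le {T s ζ : ℝ} (hs : 0 ≤ s) {m : ℝ → ℝ} (hm : IntegrableOn m (Ioc s T))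
    (hm0 : ∀ r, 0 ≤ m r) {t : ℝ} (ht : t ∈ Icc s T) :
    ∫ r in s..t, Real.exp (ζ * (t - r)) * m r ≤ Real.exp (|ζ| * T) * ∫ r in Ioc s T, m r := by
  have hmono : Ioc s t ⊆ Ioc s T := Ioc_subset_Ioc_right ht.2
  rw [intervalIntegral.integral_of_le ht.1]
  calc ∫ r in Ioc s t, Real.exp (ζ * (t - r)) * m r
      ≤ ∫ r in Ioc s t, Real.exp (|ζ| * T) * m r := by
        refine setIntegral_mono_on ?_ ((hm.mono_set hmono).const_mul _) measurableSet_Ioc ?_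
        · refine (((hm.mono_set hmono).const_mul (Real.exp (|ζ| * T))).mono' ?_ ?_)
          · exact (by fun_prop : Continuous fun r => Real.exp (ζ * (t - r))).aestronglyMeasurable.mul
              (hm.mono_set hmono).aestronglyMeasurable
          · filter_upwards [ae_restrict_mem measurableSet_Ioc] with r hr
            rw [norm_mul, Real.norm_of_nonneg (hm0 r), Real.norm_of_nonneg (Real.exp_pos _).le]
            refine mul_le_mul_of_nonneg_right (Real.exp_le_exp.2 ?_) (hm0 r)
            exact mul_le_mul (le_abs_self _) (by linarith [hr.1, ht.2]) (by linarith [hr.2])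
              (abs_nonneg _)
        · intro r hr
          refine mul_le_mul_of_nonneg_right (Real.exp_le_exp.2 ?_) (hm0 r)
          exact mul_le_mul (le_abs_self _) (by linarith [hr.1, ht.2]) (by linarith [hr.2])
            (abs_nonneg _)
    _ = Real.exp (|ζ| * T) * ∫ r in Ioc s t, m r := integral_const_mul _ _
    _ ≤ _ := mul_le_mul_of_nonneg_left (setIntegral_mono_set hm
        (Eventually.of_forall hm0) hmono.eventuallyLE) (Real.exp_pos _).le

section Family

variable {E H : Type*} [NormedAddCommGroup E] [NormedSpace ℝ E]
  [NormedAddCommGroup H] [InnerProductSpace ℝ H] {ι : E →L[ℝ] H}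

/-- `g : E → E` is continuous from `E` to `H` with its weak topology, along sequences and tested
with vectors of `E`. -/
def Demicontinuous (ι : E →L[ℝ] H) (g : E → E) : Prop :=
  ∀ (v : ℕ → E) (y : E), Tendsto v atTop (𝓝 y) → ∀ z : E,
    Tendsto (fun n => inner ℝ (ι (g (v n))) (ι z)) atTop (𝓝 (inner ℝ (ι (g y)) (ι z)))

/-- The stronger form of demicontinuity in which the sequence is bounded in `E` and converges only
in `H`. -/
def BoundedlyDemicontinuous (ι : E →L[ℝ] H) (g : E → E) : Prop :=
  ∀ (v : ℕ → E) (C : ℝ) (y : E), (∀ n, ‖v n‖ ≤ C) → Tendsto (fun n => ι (v n)) atTop (𝓝 (ι y)) →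
    ∀ z : E, Tendsto (fun n => inner ℝ (ι (g (v n))) (ι z)) atTop (𝓝 (inner ℝ (ι (g y)) (ι z)))

theorem Demicontinuous.recentre {g : E → E} (hg : Demicontinuous ι g) (c : E) :
    Demicontinuous ι (fun v => g (c + v) - g c) := by
  intro v y hv z
  simp only [map_sub, inner_sub_left]
  exact (hg (fun n => c + v n) (c + y) (tendsto_const_nhds.add hv) z).sub_const _

theorem BoundedlyDemicontinuous.recentre {g : E → E} (hg : BoundedlyDemicontinuous ι g) (c : E) :
    BoundedlyDemicontinuous ι (fun v => g (c + v) - g c) := by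
  intro v C y hC hv z
  simp only [map_sub, inner_sub_left]
  refine (hg (fun n => c + v n) (‖c‖ + C) (c + y)
    (fun n => (norm_add_le _ _).trans (by linarith [hC n])) ?_ z).sub_const _
  simpa only [map_add] using hv.const_add (ι c)

theorem IsMDissipativeMap.tendsto_resolvent {g : E → E} (hg : IsMDissipativeMap ι g) (v : E) :
    Tendsto (fun k : ℕ => resolventMap g k v) atTop (𝓝 v) := by
  rw [tendsto_iff_norm_sub_tendsto_zero]
  have h : Tendsto (fun k : ℕ => 1 / (k : ℝ) * ‖g v‖) atTop (𝓝 0) := by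
    simpa using tendsto_one_div_atTop_nhds_zero_nat.mul_const ‖g v‖
  refine squeeze_zero' (Eventually.of_forall fun _ => norm_nonneg _) ?_ h
  filter_upwards [eventually_ge_atTop 1] with k hk
  exact hg.norm_resolvent_sub_self_le hg.dissE (by exact_mod_cast hk) v

/-- The Yosida approximations converge in `H`: they converge weakly by demicontinuity, and their
norms are bounded by that of the limit. -/
theorem IsMDissipativeMap.tendsto_yosida {g : E → E} (hg : IsMDissipativeMap ι g)
    (hdemi : Demicontinuous ι g) (v : E) :
    Tendsto (fun k : ℕ => ι (yosidaApprox g k v)) atTop (𝓝 (ι (g v))) := by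
  have h1 := hdemi _ _ (hg.tendsto_resolvent v) (g v)
  have h2 : Tendsto (fun k : ℕ => 2 * ‖ι (g v)‖ ^ 2 -
      2 * inner ℝ (ι (g (resolventMap g k v))) (ι (g v))) atTop (𝓝 0) := by
    have := (h1.const_mul 2).const_sub (2 * ‖ι (g v)‖ ^ 2)
    rwa [real_inner_self_eq_norm_sq, sub_self] at this
  rw [tendsto_iff_norm_sub_tendsto_zero]
  have h3 : Tendsto (fun k : ℕ => ‖ι (yosidaApprox g k v) - ι (g v)‖ ^ 2) atTop (𝓝 0) := by
    refine squeeze_zero' (Eventually.of_forall fun _ => sq_nonneg _) ?_ h2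
    filter_upwards [eventually_ge_atTop 1] with k hk
    have hk0 : (0 : ℝ) < k := by exact_mod_cast hk
    have h4 := pow_le_pow_left₀ (norm_nonneg _) (hg.norm_yosida_le hg.dissH hk0 v) 2
    rw [norm_sub_sq_real, hg.yosida_eq hk0] at *
    linarith
  have h5 := h3.sqrt
  simpa using h5

/-- A family of everywhere defined m-dissipative maps of `E` that are dissipative in `H`, continuous
in time and with integrable values along continuous paths. -/
structure IsDissipativeFamily (T : ℝ) (ι : E →L[ℝ] H) (G : ℝ → E → E) : Prop where
  mdiss : ∀ t ∈ Icc 0 T, IsMDissipativeMap ι (G t)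
  cont : ∀ x, ContinuousOn (fun t => G t x) (Icc 0 T)
  integrable : ∀ g : ℝ → E, ContinuousOn g (Icc 0 T) → IntegrableOn (fun t => G t (g t)) (Icc 0 T)
  demi : ∀ t ∈ Icc 0 T, Demicontinuous ι (G t)

/-- The family `G`, recentred at the path `c`, so that it vanishes at `0`. -/
def recentred (G : ℝ → E → E) (c : ℝ → E) (t : ℝ) (v : E) : E := G t (c t + v) - G t (c t)

namespace IsDissipativeFamily

variable {T s : ℝ} {G : ℝ → E → E} {c : ℝ → E}

theorem integrableOn_path (hG : IsDissipativeFamily T ι G) (hs : 0 ≤ s)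
    (hc : ContinuousOn c (Icc s T)) : IntegrableOn (fun t => G t (c t)) (Icc s T) := by
  rcases le_or_gt s T with hsT | hsT
  · have h1 : ContinuousOn (fun t => c (max s t)) (Icc 0 T) :=
      hc.comp (by fun_prop) fun t ht => ⟨le_max_left _ _, max_le hsT ht.2⟩
    refine ((hG.integrable _ h1).mono_set (Icc_subset_Icc_left hs)).congr_fun (fun t ht => ?_)
      measurableSet_Icc
    simp only [max_eq_right ht.1]
  · rw [Icc_eq_empty (not_le.2 hsT)]; exact integrableOn_empty

theorem aestronglyMeasurable_path (hG : IsDissipativeFamily T ι G) (hs : 0 ≤ s)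
    (hc : ContinuousOn c (Ioc s T)) :
    AEStronglyMeasurable (fun t => G t (c t)) (volume.restrict (Ioc s T)) := by
  have h : Ioc s T = ⋃ n : ℕ, Icc (s + 1 / ((n : ℝ) + 1)) T := by
    ext t
    simp only [mem_Ioc, mem_iUnion, mem_Icc]
    constructor
    · rintro ⟨h1, h2⟩
      obtain ⟨n, hn⟩ := exists_nat_one_div_lt (sub_pos.2 h1)
      exact ⟨n, by linarith, h2⟩
    · rintro ⟨n, h1, h2⟩
      have : 0 < 1 / ((n : ℝ) + 1) := by positivity
      exact ⟨by linarith, h2⟩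
  rw [h, aestronglyMeasurable_iUnion_iff]
  intro n
  have : 0 < 1 / ((n : ℝ) + 1) := by positivity
  refine (hG.integrableOn_path (by linarith) (hc.mono fun t ht => ?_)).aestronglyMeasurable
  exact ⟨by linarith [ht.1], ht.2⟩

theorem mdiss_recentred (hG : IsDissipativeFamily T ι G) {t : ℝ} (ht : t ∈ Icc 0 T) :
    IsMDissipativeMap ι (recentred G c t) := (hG.mdiss t ht).recentre (c t)

theorem aestronglyMeasurable_yosida_recentred (hG : IsDissipativeFamily T ι G) (hs : 0 ≤ s)
    (hsT : s ≤ T) (hc : AEStronglyMeasurable c (volume.restrict (Ioc s T)))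
    (hGc : AEStronglyMeasurable (fun t => G t (c t)) (volume.restrict (Ioc s T))) {k : ℝ}
    (hk : 0 < k) {v : ℝ → E} (hv : AEStronglyMeasurable v (volume.restrict (Ioc s T))) :
    AEStronglyMeasurable (fun t => yosidaApprox (recentred G c t) k (v t))
      (volume.restrict (Ioc s T)) := by
  have hsub : Ioc s T ⊆ Icc 0 T := fun t ht => ⟨hs.trans ht.1.le, ht.2⟩
  have h1 := aestronglyMeasurable_resolventMap (hs.trans hsT) hG.mdiss hG.cont hk measurableSet_Ioc
    hsub ((hv.add hc).sub (hGc.const_smul (1 / k)))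
  refine (((h1.sub hc).sub hv).const_smul k).congr ?_
  filter_upwards [ae_restrict_mem measurableSet_Ioc] with t ht
  have h2 := (hG.mdiss t (hsub ht)).resolvent_recentre hk (c t) (v t)
  simp only [yosidaApprox, Pi.smul_apply, Pi.sub_apply, Pi.add_apply]
  rw [← h2]; rfl

end IsDissipativeFamily

theorem recentred_zero (G : ℝ → E → E) (c : ℝ → E) (t : ℝ) : recentred G c t 0 = 0 := by
  simp [recentred]

theorem IsMDissipativeMap.yosida_zero {g : E → E} (hg : IsMDissipativeMap ι g) (h0 : g 0 = 0)
    {k : ℝ} (hk : 0 < k) : yosidaApprox g k 0 = 0 := by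
  have h := hg.norm_yosida_le hg.dissE hk 0
  simpa [h0] using h

end Family

section Solutions

variable {E H : Type*} [NormedAddCommGroup E] [NormedSpace ℝ E] [CompleteSpace E]
  [NormedAddCommGroup H] [InnerProductSpace ℝ H] [CompleteSpace H]
  {T s ζ : ℝ} {ι : E →L[ℝ] H} {U : ℝ → ℝ → H →L[ℝ] H} {UE : ℝ → ℝ → E →L[ℝ] E}
  {Un : ℕ → ℝ → ℝ → E →L[ℝ] E} {G : ℝ → E → E} {c q : ℝ → E} {x : E}

/-- Comparison in `H` of two mild solutions. -/
theorem ApproximatedEvolution.norm_sub_le (hA : ApproximatedEvolution T ι U UE Un) (hs : 0 ≤ s)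
    {g₁ g₂ u₁ u₂ : ℝ → H} {x₁ x₂ : H} (h₁ : IsMildFor U s T g₁ x₁ u₁)
    (h₂ : IsMildFor U s T g₂ x₂ u₂) {ω : ℝ} {m : ℝ → ℝ} (hm : IntegrableOn m (Ioc s T))
    (hdiss : ∀ r ∈ Ioc s T, ∀ α > 0,
      (1 - α * ω) * ‖u₁ r - u₂ r‖ ≤ ‖u₁ r - u₂ r - α • (g₁ r - g₂ r)‖ + α * m r)
    {t : ℝ} (ht : t ∈ Icc s T) :
    ‖u₁ t - u₂ t‖ ≤ Real.exp (ω * (t - s)) * ‖x₁ - x₂‖ +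
      ∫ r in s..t, Real.exp (ω * (t - r)) * m r := by
  have h := h₁.sub h₂ hA.evolH hs
  have h3 := hA.evolH.norm_le_of_dissipative hA.leftH hs h.integrable h.eq hm
    ((ae_restrict_mem measurableSet_Ioc).mono hdiss) ht
  rwa [h.apply_left hA.evolH hs (ht.1.trans ht.2)] at h3

/-- The equation with a Yosida approximation of the recentred nonlinearity is solvable in `E`, with
the a priori bound that dissipativity gives. -/
theorem exists_yosida_solution (hA : ApproximatedEvolution T ι U UE Un)
    (hG : IsDissipativeFamily T ι G) (hs : 0 ≤ s) (hsT : s ≤ T)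
    (hc : AEStronglyMeasurable c (volume.restrict (Ioc s T)))
    (hGc : AEStronglyMeasurable (fun t => G t (c t)) (volume.restrict (Ioc s T)))
    (hq : IntegrableOn q (Ioc s T)) (ζ : ℝ) (x : E) {k : ℝ} (hk : 0 < k) :
    ∃ u : ℝ → E,
      IsMildFor UE s T (fun r => ζ • u r + yosidaApprox (recentred G c r) k (u r) + q r) x u ∧
      ∀ t ∈ Icc s T, ‖u t‖ ≤ Real.exp (ζ * (t - s)) * ‖x‖ +
        ∫ r in s..t, Real.exp (ζ * (t - r)) * ‖q r‖ := by
  have hN : ∀ r ∈ Ioc s T, IsMDissipativeMap ι (recentred G c r) := fun r hr =>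
    hG.mdiss_recentred ⟨hs.trans hr.1.le, hr.2⟩
  have hlip : ∀ r ∈ Ioc s T, ∀ a b : E,
      ‖(ζ • a + yosidaApprox (recentred G c r) k a) - (ζ • b + yosidaApprox (recentred G c r) k b)‖ ≤
        (|ζ| + 2 * k) * ‖a - b‖ := by
    intro r hr a b
    have h1 := (hN r hr).norm_yosida_sub_le (hN r hr).dissE hk a b
    simp only [ContinuousLinearMap.id_apply] at h1
    rw [add_sub_add_comm, ← smul_sub, add_mul]
    refine (norm_add_le _ _).trans (add_le_add ?_ h1)
    rw [norm_smul, Real.norm_eq_abs]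
  obtain ⟨u, hu1, -, hu3, hu4⟩ := hA.evolE.exists_mild_of_lipschitz hs hsT
    (Ψ := fun r a => ζ • a + yosidaApprox (recentred G c r) k a + q r) (K := |ζ| + 2 * k)
    (by positivity) (fun r hr a b => by rw [add_sub_add_right_eq_sub]; exact hlip r hr a b)
    (fun u hu => by
      have hu' := hu.aestronglyMeasurable measurableSet_Ioc (μ := volume)
      exact ((hu'.const_smul ζ).add
        (hG.aestronglyMeasurable_yosida_recentred hs hsT hc hGc hk hu')).add
        hq.aestronglyMeasurable)
    (hq.congr_fun (fun r hr => by
      simp only [smul_zero, zero_add]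
      rw [(hN r hr).yosida_zero (recentred_zero G c r) hk, zero_add]) measurableSet_Ioc) x
  refine ⟨u, ⟨hu3, hu4⟩, fun t ht => ?_⟩
  refine hA.norm_le_of_lipschitz hs hu3 hu4 (K := |ζ| + 2 * k) (by positivity) hlip ?_ hq
    (fun r _ => rfl) ht
  intro r hr a α hα
  have h1 := ((hN r hr).dissipative_yosida (hN r hr).dissE hk).shift_le ζ a 0 hα
  rw [(hN r hr).yosida_zero (recentred_zero G c r) hk] at h1
  simpa using h1

/-- The nonlinear term of a mild equation is integrable, since the other terms are. -/
theorem integrableOn_of_isMildFor (hA : ApproximatedEvolution T ι U UE Un) (hs : 0 ≤ s)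
    {N : ℝ → E → E} {v : ℝ → E} (hq : IntegrableOn q (Ioc s T))
    (hv : IsMildFor UE s T (fun r => ζ • v r + N r (v r) + q r) x v) :
    IntegrableOn (fun r => N r (v r)) (Ioc s T) := by
  obtain ⟨C, hC⟩ := hv.exists_bound hA.evolE hs
  have hvi : IntegrableOn v (Ioc s T) := by
    refine Integrable.mono' (g := fun _ => C) (integrableOn_const (by simp))
      ((hv.continuousOn_Ioc hA.evolE hs).aestronglyMeasurable measurableSet_Ioc) ?_
    filter_upwards [ae_restrict_mem measurableSet_Ioc] with r hr
    exact hC r (Ioc_subset_Icc_self hr)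
  refine ((hv.integrable.sub hq).sub (hvi.smul ζ)).congr_fun (fun r _ => ?_) measurableSet_Ioc
  simp only [Pi.sub_apply, Pi.smul_apply]
  abel

/-- The a priori bound in a reflexive space `E`: the Yosida solutions obey it and converge in
`H`. -/
theorem IsMildFor.norm_le_of_reflexive
    (hrefl : Function.Surjective (NormedSpace.inclusionInDoubleDual ℝ E)) (hd : DenseRange ι)
    (hι : Function.Injective ι) (hA : ApproximatedEvolution T ι U UE Un)
    (hG : IsDissipativeFamily T ι G) (hs : 0 ≤ s) (hsT : s ≤ T)
    (hc : AEStronglyMeasurable c (volume.restrict (Ioc s T)))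
    (hGc : AEStronglyMeasurable (fun t => G t (c t)) (volume.restrict (Ioc s T)))
    (hq : IntegrableOn q (Ioc s T)) {v : ℝ → E}
    (hv : IsMildFor UE s T (fun r => ζ • v r + recentred G c r (v r) + q r) x v) {t : ℝ}
    (ht : t ∈ Icc s T) :
    ‖v t‖ ≤ Real.exp (ζ * (t - s)) * ‖x‖ + ∫ r in s..t, Real.exp (ζ * (t - r)) * ‖q r‖ := by
  have hN : ∀ r ∈ Ioc s T, IsMDissipativeMap ι (recentred G c r) := fun r hr =>
    hG.mdiss_recentred ⟨hs.trans hr.1.le, hr.2⟩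
  have hk : ∀ k : ℕ, (0 : ℝ) < ((k + 1 : ℕ) : ℝ) := fun k => by positivity
  choose u hu hub using fun k : ℕ => exists_yosida_solution hA hG hs hsT hc hGc hq ζ x (hk k)
  have hNi := integrableOn_of_isMildFor hA hs hq hv
  have hvm := (hv.continuousOn_Ioc hA.evolE hs).aestronglyMeasurable measurableSet_Ioc (μ := volume)
  set m : ℕ → ℝ → ℝ := fun k r => ‖ι (yosidaApprox (recentred G c r) ((k + 1 : ℕ) : ℝ) (v r)) -
    ι (recentred G c r (v r))‖ with hm
  have hmm : ∀ k, AEStronglyMeasurable (m k) (volume.restrict (Ioc s T)) := fun k =>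
    ((ι.continuous.comp_aestronglyMeasurable (hG.aestronglyMeasurable_yosida_recentred hs hsT hc hGc
      (hk k) hvm)).sub (ι.continuous.comp_aestronglyMeasurable hNi.aestronglyMeasurable)).norm
  have hmb : ∀ k, ∀ᵐ r ∂volume.restrict (Ioc s T), ‖m k r‖ ≤ 2 * ‖ι (recentred G c r (v r))‖ := by
    intro k
    filter_upwards [ae_restrict_mem measurableSet_Ioc] with r hr
    rw [hm, norm_norm, two_mul]
    exact (norm_sub_le _ _).trans
      (add_le_add ((hN r hr).norm_yosida_le (hN r hr).dissH (hk k) _) le_rfl)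
  have hdom : IntegrableOn (fun r => 2 * ‖ι (recentred G c r (v r))‖) (Ioc s T) :=
    (Integrable.norm (ι.integrable_comp hNi)).const_mul 2
  have hmi : ∀ k, IntegrableOn (m k) (Ioc s T) := fun k => Integrable.mono' hdom (hmm k) (hmb k)
  have hlim0 : Tendsto (fun k => ∫ r in Ioc s T, m k r) atTop (𝓝 0) := by
    have := tendsto_integral_of_dominated_convergence (μ := volume.restrict (Ioc s T)) (F := m)
      (f := fun _ => 0) (fun r => 2 * ‖ι (recentred G c r (v r))‖) hmm hdom hmb ?_
    · simpa using this
    · filter_upwards [ae_restrict_mem measurableSet_Ioc] with r hr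
      rw [← tendsto_iff_norm_sub_tendsto_zero]
      exact (tendsto_add_atTop_iff_nat 1).2 ((hN r hr).tendsto_yosida
        ((hG.demi r ⟨hs.trans hr.1.le, hr.2⟩).recentre (c r)) (v r))
  have hcmp : ∀ k, ‖ι (u k t) - ι (v t)‖ ≤ Real.exp (|ζ| * T) * ∫ r in Ioc s T, m k r := by
    intro k
    have h1 := hA.norm_sub_le hs ((hu k).map hA hs) (hv.map hA hs) (ω := ζ) (hmi k) ?_ ht
    · rw [sub_self, norm_zero, mul_zero, zero_add] at h1
      exact h1.trans (integral_exp_mul_le hs (hmi k) (fun r => norm_nonneg _) ht)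
    · intro r hr α hα
      have h2 := ((hN r hr).dissipative_yosida (hN r hr).dissH (hk k)).shift_le ζ (u k r) (v r) hα
      refine le_trans (le_of_eq (by rw [map_sub])) (h2.trans ?_)
      set y := yosidaApprox (recentred G c r) ((k + 1 : ℕ) : ℝ)
      have h3 : ι (u k r - v r - α • ((ζ • u k r + y (u k r)) - (ζ • v r + y (v r)))) =
          (ι (u k r) - ι (v r) - α • (ι (ζ • u k r + y (u k r) + q r) -
            ι (ζ • v r + recentred G c r (v r) + q r))) +
          α • (ι (y (v r)) - ι (recentred G c r (v r))) := by
        simp only [map_sub, map_add, map_smul]; module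
      rw [h3]
      refine (norm_add_le _ _).trans (le_of_eq ?_)
      rw [norm_smul, Real.norm_of_nonneg hα.le]
  have hlim : Tendsto (fun k => ι (u k t)) atTop (𝓝 (ι (v t))) := by
    rw [tendsto_iff_norm_sub_tendsto_zero]
    refine squeeze_zero (fun _ => norm_nonneg _) hcmp ?_
    simpa using hlim0.const_mul (Real.exp (|ζ| * T))
  obtain ⟨y, hy, hyb⟩ := exists_of_tendsto hrefl hd (fun k => hub k t ht) hlim
  rwa [← hι hy]

end Solutions

/-! ### Existence in the reflexive case -/

section Reflexive

/-- An injection of Polish spaces is a measurable embedding, so that measurability may be checked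
in `H`. -/
theorem aestronglyMeasurable_of_map {α E H : Type*} [MeasurableSpace α] {μ : Measure α}
    [NormedAddCommGroup E] [NormedSpace ℝ E] [CompleteSpace E] [TopologicalSpace.SeparableSpace E]
    [NormedAddCommGroup H] [InnerProductSpace ℝ H] {ι : E →L[ℝ] H} (hι : Function.Injective ι)
    {v : α → E} (hv : AEStronglyMeasurable (fun t => ι (v t)) μ) : AEStronglyMeasurable v μ := by
  borelize E
  borelize H
  have := UniformSpace.secondCountable_of_separable E
  have h := ι.continuous.measurableEmbedding hι
  exact (h.aemeasurable_comp_iff.1 hv.aemeasurable).aestronglyMeasurable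

variable {E H : Type*} [NormedAddCommGroup E] [NormedSpace ℝ E] [CompleteSpace E]
  [NormedAddCommGroup H] [InnerProductSpace ℝ H] [CompleteSpace H]
  {T s ζ : ℝ} {ι : E →L[ℝ] H} {U : ℝ → ℝ → H →L[ℝ] H} {UE : ℝ → ℝ → E →L[ℝ] E}
  {Un : ℕ → ℝ → ℝ → E →L[ℝ] E} {G : ℝ → E → E} {c q : ℝ → E} {x : E}

open scoped ENNReal in
/-- In a reflexive space, demicontinuity makes `‖g ·‖` lower semicontinuous for the norm of `E`. -/
theorem enorm_le_liminf_of_demicontinuous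
    (hrefl : Function.Surjective (NormedSpace.inclusionInDoubleDual ℝ E)) (hd : DenseRange ι)
    (hι : Function.Injective ι) {g : E → E} (hg : Demicontinuous ι g) {v : ℕ → E} {y : E}
    (hv : Tendsto v atTop (𝓝 y)) : ‖g y‖ₑ ≤ liminf (fun n => ‖g (v n)‖ₑ) atTop := by
  refine le_of_forall_gt fun b hb => ?_
  obtain ⟨b', hb1, hb2⟩ := exists_between hb
  obtain ⟨φ, hφ, hφb⟩ := extraction_of_frequently_atTop
    (frequently_lt_of_liminf_lt (by isBoundedDefault) hb1)
  have hb' : b' ≠ ∞ := (hb2.trans_le le_top).ne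
  obtain ⟨z, hz, hzC⟩ := exists_of_tendsto_inner hrefl hd (x := fun n => g (v (φ n)))
    (C := b'.toReal) (fun n => by
      rw [← toReal_enorm]
      exact ENNReal.toReal_mono hb' (hφb n).le)
    (hg (fun n => v (φ n)) y (hv.comp hφ.tendsto_atTop))
  rw [hι hz] at hzC
  refine lt_of_le_of_lt ?_ hb2
  rw [← ofReal_norm, ← ENNReal.ofReal_toReal hb']
  exact ENNReal.ofReal_le_ofReal hzC

/-- Small continuous perturbations of a continuous path have a common integrable bound for the
values of the recentred family. -/
theorem IsDissipativeFamily.exists_dominating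
    (hrefl : Function.Surjective (NormedSpace.inclusionInDoubleDual ℝ E)) (hd : DenseRange ι)
    (hι : Function.Injective ι) (hG : IsDissipativeFamily T ι G) (hs : 0 ≤ s) (hsT : s ≤ T)
    (hc : ContinuousOn c (Icc s T)) :
    ∃ ρ > 0, ∀ u : ℕ → ℝ → E, (∀ k, ContinuousOn (u k) (Icc s T)) →
      (∀ k, ∀ t ∈ Icc s T, ‖u k t‖ ≤ ρ) →
      ∃ φ : ℝ → ℝ, IntegrableOn φ (Ioc s T) ∧ (∀ r, 0 ≤ φ r) ∧
        ∀ᵐ r ∂volume.restrict (Ioc s T), ∀ k, ‖recentred G c r (u k r)‖ ≤ φ r := by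
  obtain ⟨ρ, hρ, M, hM, hbd⟩ := exists_lintegral_iSup_bound (Φ := fun t a => G t (c t + a)) hsT
    (fun g hg => hG.integrableOn_path hs (hc.add hg.continuousOn))
    (fun t ht v y hv => enorm_le_liminf_of_demicontinuous hrefl hd hι
      (hG.demi t ⟨hs.trans ht.1, ht.2⟩) (tendsto_const_nhds.add hv))
  refine ⟨ρ, hρ, fun u hu huρ => ?_⟩
  set S : ℝ → ENNReal := fun t => ⨆ k, ‖G t (c t + u k t)‖ₑ with hS
  have hSm : AEMeasurable S (volume.restrict (Icc s T)) := AEMeasurable.iSup fun k =>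
    (hG.integrableOn_path hs (hc.add (hu k))).aestronglyMeasurable.enorm
  have hSi : ∫⁻ t in Icc s T, S t ≠ ⊤ := ne_top_of_le_ne_top hM (hbd u hu huρ)
  have h1 : IntegrableOn (fun t => (S t).toReal) (Ioc s T) :=
    IntegrableOn.mono_set (integrable_toReal_of_lintegral_ne_top hSm hSi) Ioc_subset_Icc_self
  have h2 : IntegrableOn (fun t => ‖G t (c t)‖) (Ioc s T) :=
    Integrable.norm ((hG.integrableOn_path hs hc).mono_set Ioc_subset_Icc_self)
  refine ⟨fun t => (S t).toReal + ‖G t (c t)‖, h1.add h2, fun r => by positivity, ?_⟩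
  filter_upwards [ae_restrict_of_ae_restrict_of_subset Ioc_subset_Icc_self (ae_lt_top' hSm hSi)]
    with r hr k
  refine (norm_sub_le _ _).trans (add_le_add ?_ le_rfl)
  rw [← toReal_enorm]
  exact ENNReal.toReal_mono hr.ne (le_iSup (fun k => ‖G r (c r + u k r)‖ₑ) k)

theorem resolventMap_zero {g : E → E} (hg : IsMDissipativeMap ι g) (h0 : g 0 = 0) {k : ℝ}
    (hk : 0 < k) : resolventMap g k 0 = 0 :=
  hg.resolvent_unique hk (by simp [h0])

/-- The monotonicity argument for two Yosida approximations. -/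
theorem IsMDissipativeMap.inner_yosida_sub_le {g : E → E} (hg : IsMDissipativeMap ι g) {k m : ℝ}
    (hk : 0 < k) (hm : 0 < m) (a b : E) :
    inner ℝ (ι (yosidaApprox g k a) - ι (yosidaApprox g m b)) (ι a - ι b) ≤
      (‖ι (yosidaApprox g k a)‖ + ‖ι (yosidaApprox g m b)‖) *
        (‖ι (resolventMap g k a - a)‖ + ‖ι (resolventMap g m b - b)‖) := by
  have h1 := hg.dissH.inner_nonpos (resolventMap g k a) (resolventMap g m b)
  rw [← hg.yosida_eq hk, ← hg.yosida_eq hm, map_sub] at h1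
  set n := ι (yosidaApprox g k a) - ι (yosidaApprox g m b) with hn
  have h2 : ι a - ι b = ι (resolventMap g k a - resolventMap g m b) -
      (ι (resolventMap g k a - a) - ι (resolventMap g m b - b)) := by
    simp only [map_sub]; abel
  rw [h2, inner_sub_right]
  have h3 : -inner ℝ n (ι (resolventMap g k a - a) - ι (resolventMap g m b - b)) ≤
      ‖n‖ * ‖ι (resolventMap g k a - a) - ι (resolventMap g m b - b)‖ :=
    (neg_le_abs _).trans (abs_real_inner_le_norm _ _)
  have h4 : ‖n‖ * ‖ι (resolventMap g k a - a) - ι (resolventMap g m b - b)‖ ≤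
      (‖ι (yosidaApprox g k a)‖ + ‖ι (yosidaApprox g m b)‖) *
        (‖ι (resolventMap g k a - a)‖ + ‖ι (resolventMap g m b - b)‖) :=
    mul_le_mul (norm_sub_le _ _) (norm_sub_le _ _) (norm_nonneg _) (by positivity)
  linarith

/-- Around a continuous path the recentred equation is solvable for small forcing terms: the Yosida
solutions stay in the ball on which the nonlinearity has a common integrable bound, and therefore
they converge in `H`. -/
theorem exists_small_solution [TopologicalSpace.SeparableSpace E]
    (hrefl : Function.Surjective (NormedSpace.inclusionInDoubleDual ℝ E)) (hd : DenseRange ι)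
    (hι : Function.Injective ι) (hA : ApproximatedEvolution T ι U UE Un)
    (hG : IsDissipativeFamily T ι G) (hGb : ∀ t ∈ Icc 0 T, BoundedlyDemicontinuous ι (G t))
    (hs : 0 ≤ s) (hsT : s ≤ T) (ζ : ℝ) (hc : ContinuousOn c (Icc s T)) :
    ∃ ρ > 0, ∀ q : ℝ → E, IntegrableOn q (Ioc s T) →
      Real.exp (|ζ| * T) * ∫ r in Ioc s T, ‖q r‖ ≤ ρ →
      ∃ u : ℝ → E, IsMildFor UE s T (fun r => ζ • u r + recentred G c r (u r) + q r) 0 u := by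
  obtain ⟨ρ, hρ, hdom⟩ := hG.exists_dominating hrefl hd hι hs hsT hc
  refine ⟨ρ, hρ, fun q hq hqρ => ?_⟩
  have hsub : ∀ {r}, r ∈ Ioc s T → r ∈ Icc 0 T := fun hr => ⟨hs.trans hr.1.le, hr.2⟩
  have hN : ∀ r ∈ Ioc s T, IsMDissipativeMap ι (recentred G c r) := fun r hr =>
    hG.mdiss_recentred (hsub hr)
  have hcm : AEStronglyMeasurable c (volume.restrict (Ioc s T)) :=
    (hc.mono Ioc_subset_Icc_self).aestronglyMeasurable measurableSet_Ioc
  have hGc : AEStronglyMeasurable (fun t => G t (c t)) (volume.restrict (Ioc s T)) :=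
    ((hG.integrableOn_path hs hc).mono_set Ioc_subset_Icc_self).aestronglyMeasurable
  have hk : ∀ k : ℕ, (0 : ℝ) < ((k + 1 : ℕ) : ℝ) := fun k => by positivity
  choose u hu hub using fun k : ℕ => exists_yosida_solution hA hG hs hsT hcm hGc hq ζ 0 (hk k)
  have hqn : IntegrableOn (fun r => ‖q r‖) (Ioc s T) := Integrable.norm hq
  have huρ : ∀ k, ∀ t ∈ Icc s T, ‖u k t‖ ≤ ρ := by
    intro k t ht
    have h1 := hub k t ht
    rw [norm_zero, mul_zero, zero_add] at h1
    exact h1.trans ((integral_exp_mul_le hs hqn (fun r => norm_nonneg _) ht).trans hqρ)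
  have huc : ∀ k, ContinuousOn (u k) (Icc s T) := fun k =>
    (hu k).continuousOn_Icc hA.evolE hs (by simpa using continuousOn_const)
  obtain ⟨φ, hφ, hφ0, hφb⟩ := hdom u huc huρ
  set n : ℕ → ℝ → E := fun k r => yosidaApprox (recentred G c r) ((k + 1 : ℕ) : ℝ) (u k r) with hn
  set J : ℕ → ℝ → E := fun k r => resolventMap (recentred G c r) ((k + 1 : ℕ) : ℝ) (u k r) with hJ
  set C : ℝ := ‖ι‖ with hC
  -- the bound `φ / k` for `‖J_k u_k - u_k‖` is capped, as `φ ^ 2` need not be integrable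
  set b : ℕ → ℝ → ℝ := fun k r => min (φ r / ((k + 1 : ℕ) : ℝ)) (2 * ρ) with hb
  have hnb : ∀ᵐ r ∂volume.restrict (Ioc s T), ∀ k, ‖n k r‖ ≤ φ r := by
    filter_upwards [hφb, ae_restrict_mem measurableSet_Ioc] with r hr hrI k
    exact ((hN r hrI).norm_yosida_le (hN r hrI).dissE (hk k) _).trans (hr k)
  have hJρ : ∀ k, ∀ r ∈ Ioc s T, ‖J k r‖ ≤ ρ := by
    intro k r hr
    have h1 := (hN r hr).norm_resolvent_sub_le (hN r hr).dissE (hk k) (u k r) 0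
    rw [resolventMap_zero (hN r hr) (recentred_zero G c r) (hk k), sub_zero, sub_zero] at h1
    exact h1.trans (huρ k r (Ioc_subset_Icc_self hr))
  have hJu : ∀ᵐ r ∂volume.restrict (Ioc s T), ∀ k, ‖J k r - u k r‖ ≤ b k r := by
    filter_upwards [hφb, ae_restrict_mem measurableSet_Ioc] with r hr hrI k
    refine le_min ?_ ?_
    · refine ((hN r hrI).norm_resolvent_sub_self_le (hN r hrI).dissE (hk k) _).trans ?_
      rw [one_div, inv_mul_eq_div]
      exact div_le_div_of_nonneg_right (hr k) (hk k).le
    · exact (norm_sub_le _ _).trans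
        (by linarith [hJρ k r hrI, huρ k r (Ioc_subset_Icc_self hrI)])
  have hb0 : ∀ k r, 0 ≤ b k r := fun k r => le_min (div_nonneg (hφ0 r) (hk k).le) (by positivity)
  have hφbm : ∀ k, AEStronglyMeasurable (fun r => φ r * b k r) (volume.restrict (Ioc s T)) :=
    fun k => hφ.aestronglyMeasurable.mul
      ((AEStronglyMeasurable.div₀ hφ.aestronglyMeasurable aestronglyMeasurable_const).inf
        aestronglyMeasurable_const)
  have hφb' : ∀ k, ∀ᵐ r ∂volume.restrict (Ioc s T), ‖φ r * b k r‖ ≤ φ r * (2 * ρ) := by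
    intro k
    filter_upwards with r
    rw [Real.norm_of_nonneg (mul_nonneg (hφ0 r) (hb0 k r))]
    exact mul_le_mul_of_nonneg_left (min_le_right _ _) (hφ0 r)
  have hφbi : ∀ k, IntegrableOn (fun r => φ r * b k r) (Ioc s T) := fun k =>
    Integrable.mono' (Integrable.mul_const hφ _) (hφbm k) (hφb' k)
  set a : ℕ → ℝ := fun k => ∫ r in Ioc s T, φ r * b k r with ha
  have hdivlim : ∀ r, Tendsto (fun k : ℕ => φ r / ((k + 1 : ℕ) : ℝ)) atTop (𝓝 0) := fun r =>
    (tendsto_add_atTop_iff_nat 1).2 (tendsto_const_div_atTop_nhds_zero_nat (φ r))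
  have ha0 : Tendsto a atTop (𝓝 0) := by
    have h1 := tendsto_integral_of_dominated_convergence (μ := volume.restrict (Ioc s T))
      (F := fun k r => φ r * b k r) (f := fun _ => 0) (fun r => φ r * (2 * ρ)) hφbm
      (Integrable.mul_const hφ _) hφb' ?_
    · simpa using h1
    · filter_upwards with r
      have h2 := (squeeze_zero (fun k => hb0 k r) (fun k => min_le_left _ _) (hdivlim r)).const_mul
        (φ r)
      simpa using h2
  -- the Yosida solutions form a Cauchy sequence in `H`
  have hcmp : ∀ k m, ∀ t ∈ Icc s T, ‖ι (u k t) - ι (u m t)‖ ^ 2 ≤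
      Real.exp (|2 * ζ| * T) * (4 * C ^ 2) * (a k + a m) := by
    intro k m t ht
    have hw := ((hu k).map hA hs).sub ((hu m).map hA hs) hA.evolH hs
    have hmi : IntegrableOn (fun r => 2 * C ^ 2 * (φ r * b k r + φ r * b m r)) (Ioc s T) :=
      ((hφbi k).add (hφbi m)).const_mul _
    have h1 := hA.evolH.norm_sq_le_of_inner_le hA.leftH hs hw.integrable hw.eq (ω := ζ) hmi ?_ ht
    · have h2 := hw.apply_left hA.evolH hs hsT
      simp only [sub_self] at h2
      rw [h2, norm_zero, zero_pow two_ne_zero, mul_zero, zero_add] at h1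
      refine h1.trans ((integral_exp_mul_le hs (hmi.const_mul 2) (fun r => ?_) ht).trans
        (le_of_eq ?_))
      · have := mul_nonneg (hφ0 r) (hb0 k r)
        have := mul_nonneg (hφ0 r) (hb0 m r)
        positivity
      · rw [integral_const_mul, integral_const_mul, integral_add (hφbi k) (hφbi m)]
        ring
    · filter_upwards [hnb, hJu, ae_restrict_mem measurableSet_Ioc] with r h2 h3 hr
      have h4 : ι (ζ • u k r + n k r + q r) - ι (ζ • u m r + n m r + q r) =
          ζ • (ι (u k r) - ι (u m r)) + (ι (n k r) - ι (n m r)) := by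
        simp only [map_add, map_smul]; module
      have h5 := (hN r hr).inner_yosida_sub_le (hk k) (hk m) (u k r) (u m r)
      have hι' : ∀ (e : E) (d : ℝ), ‖e‖ ≤ d → ‖ι e‖ ≤ C * d := fun e d hed =>
        ι.le_of_opNorm_le_of_le le_rfl hed
      have h6 : (‖ι (n k r)‖ + ‖ι (n m r)‖) * (‖ι (J k r - u k r)‖ + ‖ι (J m r - u m r)‖) ≤
          (C * φ r + C * φ r) * (C * b k r + C * b m r) :=
        mul_le_mul (add_le_add (hι' _ _ (h2 k)) (hι' _ _ (h2 m)))
          (add_le_add (hι' _ _ (h3 k)) (hι' _ _ (h3 m))) (by positivity)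
          (by have := hφ0 r; positivity)
      show inner ℝ (ι (ζ • u k r + n k r + q r) - ι (ζ • u m r + n m r + q r))
        (ι (u k r) - ι (u m r)) ≤ _
      rw [h4, inner_add_left, inner_smul_left, real_inner_self_eq_norm_sq]
      refine add_le_add le_rfl (h5.trans (h6.trans (le_of_eq ?_)))
      ring
  have hcauchy : ∀ t ∈ Icc s T, CauchySeq fun k => ι (u k t) := by
    intro t ht
    set K := Real.exp (|2 * ζ| * T) * (4 * C ^ 2)
    have hlim2 : Tendsto (fun p : ℕ × ℕ => K * (a p.1 + a p.2)) atTop (𝓝 0) := by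
      rw [← prod_atTop_atTop_eq]
      have := ((ha0.comp tendsto_fst).add (ha0.comp (tendsto_snd (f := atTop)))).const_mul K
      simpa using this
    rw [cauchySeq_iff_tendsto_dist_atTop_0]
    have h1 : Tendsto (fun p : ℕ × ℕ => ‖ι (u p.1 t) - ι (u p.2 t)‖ ^ 2) atTop (𝓝 0) :=
      squeeze_zero (fun _ => sq_nonneg _) (fun p => hcmp p.1 p.2 t ht) hlim2
    simpa [dist_eq_norm] using h1.sqrt
  have hex : ∀ t ∈ Icc s T, ∃ y : E, ‖y‖ ≤ ρ ∧ Tendsto (fun k => ι (u k t)) atTop (𝓝 (ι y)) := by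
    intro t ht
    obtain ⟨h, hh⟩ := cauchySeq_tendsto_of_complete (hcauchy t ht)
    obtain ⟨y, rfl, hy⟩ := exists_of_tendsto hrefl hd (fun k => huρ k t ht) hh
    exact ⟨y, hy, hh⟩
  choose! v hvρ hv using hex
  have hvm : AEStronglyMeasurable v (volume.restrict (Ioc s T)) := by
    refine aestronglyMeasurable_of_map hι (aestronglyMeasurable_of_tendsto_ae atTop
      (f := fun k t => ι (u k t)) (fun k => ?_) ?_)
    · exact (ι.continuous.comp_continuousOn
        ((huc k).mono Ioc_subset_Icc_self)).aestronglyMeasurable measurableSet_Ioc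
    · filter_upwards [ae_restrict_mem measurableSet_Ioc] with t ht
      exact hv t (Ioc_subset_Icc_self ht)
  -- `t ↦ G t (c t + v t)` is the limit in `H` of Yosida approximations, which are measurable
  have hNvm : AEStronglyMeasurable (fun r => recentred G c r (v r)) (volume.restrict (Ioc s T)) := by
    refine aestronglyMeasurable_of_map hι (aestronglyMeasurable_of_tendsto_ae atTop
      (f := fun (k : ℕ) t => ι (yosidaApprox (recentred G c t) ((k + 1 : ℕ) : ℝ) (v t)))
      (fun k => ?_) ?_)
    · exact ι.continuous.comp_aestronglyMeasurable
        (hG.aestronglyMeasurable_yosida_recentred hs hsT hcm hGc (hk k) hvm)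
    · filter_upwards [ae_restrict_mem measurableSet_Ioc] with r hr
      exact (tendsto_add_atTop_iff_nat 1).2 ((hN r hr).tendsto_yosida
        ((hG.demi r (hsub hr)).recentre (c r)) (v r))
  refine ⟨v, IsMildFor.of_weak_limit hrefl hd hι hA hs hu hv
    (φ := fun r => |ζ| * ρ + φ r + ‖q r‖)
    (((integrableOn_const (by simp)).add hφ).add hqn) ?_
    (((hvm.const_smul ζ).add hNvm).add hq.aestronglyMeasurable) ?_⟩
  · filter_upwards [hnb, ae_restrict_mem measurableSet_Ioc] with r hr hrI k
    refine (norm_add_le _ _).trans (add_le_add ((norm_add_le _ _).trans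
      (add_le_add ?_ (hr k))) le_rfl)
    rw [norm_smul, Real.norm_eq_abs]
    exact mul_le_mul_of_nonneg_left (huρ k r (Ioc_subset_Icc_self hrI)) (abs_nonneg _)
  · filter_upwards [hJu, ae_restrict_mem measurableSet_Ioc] with r hr hrI z
    have hvr := hv r (Ioc_subset_Icc_self hrI)
    have hJlim : Tendsto (fun k => ι (J k r)) atTop (𝓝 (ι (v r))) := by
      have h1 : Tendsto (fun k => ι (J k r - u k r)) atTop (𝓝 0) := by
        rw [tendsto_zero_iff_norm_tendsto_zero]
        refine squeeze_zero (fun _ => norm_nonneg _)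
          (fun k => (ι.le_of_opNorm_le_of_le le_rfl ((hr k).trans (min_le_left _ _)))) ?_
        simpa using (hdivlim r).const_mul ‖ι‖
      have h2 := h1.add hvr
      simpa only [map_sub, sub_add_cancel, zero_add] using h2
    have hweak := (hGb r (hsub hrI)).recentre (c r) (fun k => J k r) ρ (v r)
      (fun k => hJρ k r hrI) hJlim z
    have hy : ∀ k, yosidaApprox (recentred G c r) ((k + 1 : ℕ) : ℝ) (u k r) =
        recentred G c r (J k r) := fun k => (hN r hrI).yosida_eq (hk k) _
    simp only [map_add, map_smul, inner_add_left, hy]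
    refine ((?_ : Tendsto _ _ _).add hweak).add_const _
    exact (hvr.const_smul ζ).inner tendsto_const_nhds

end Reflexive

section Continuation

variable {E H : Type*} [NormedAddCommGroup E] [NormedSpace ℝ E] [CompleteSpace E]
  [NormedAddCommGroup H] [InnerProductSpace ℝ H] [CompleteSpace H]
  {T s ζ : ℝ} {ι : E →L[ℝ] H} {U : ℝ → ℝ → H →L[ℝ] H} {UE : ℝ → ℝ → E →L[ℝ] E}
  {Un : ℕ → ℝ → ℝ → E →L[ℝ] E} {G : ℝ → E → E} {c q : ℝ → E} {x : E}

theorem recentred_add (G : ℝ → E → E) (c v : ℝ → E) (t : ℝ) (w : E) :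
    recentred G c t (v t + w) = recentred G c t (v t) + recentred G (fun r => c r + v r) t w := by
  simp only [recentred, add_assoc]; abel

/-- The solutions for the forcing terms `θ q` depend Lipschitz continuously on `θ`, because
differences of solutions solve a recentred equation. -/
theorem norm_sub_le_of_forcing
    (hrefl : Function.Surjective (NormedSpace.inclusionInDoubleDual ℝ E)) (hd : DenseRange ι)
    (hι : Function.Injective ι) (hA : ApproximatedEvolution T ι U UE Un)
    (hG : IsDissipativeFamily T ι G) (hs : 0 ≤ s) (hsT : s ≤ T) (hc : ContinuousOn c (Icc s T))
    (hq : IntegrableOn q (Ioc s T)) {θ θ' : ℝ} {v w : ℝ → E}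
    (hv : IsMildFor UE s T (fun r => ζ • v r + recentred G c r (v r) + θ • q r) 0 v)
    (hw : IsMildFor UE s T (fun r => ζ • w r + recentred G c r (w r) + θ' • q r) 0 w) {t : ℝ}
    (ht : t ∈ Icc s T) :
    ‖v t - w t‖ ≤ Real.exp (|ζ| * T) * (∫ r in Ioc s T, ‖q r‖) * |θ - θ'| := by
  have hwc : ContinuousOn w (Icc s T) :=
    hw.continuousOn_Icc hA.evolE hs (by simpa using continuousOn_const)
  have hcw : ContinuousOn (fun r => c r + w r) (Icc s T) := hc.add hwc
  have hd' := hv.sub hw hA.evolE hs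
  rw [sub_zero] at hd'
  have hqi : IntegrableOn (fun r => (θ - θ') • q r) (Ioc s T) := Integrable.smul (θ - θ') hq
  have h1 := IsMildFor.norm_le_of_reflexive hrefl hd hι hA hG hs hsT (c := fun r => c r + w r)
    (ζ := ζ) ((hcw.mono Ioc_subset_Icc_self).aestronglyMeasurable measurableSet_Ioc)
    ((hG.integrableOn_path hs hcw).mono_set Ioc_subset_Icc_self).aestronglyMeasurable hqi
    (hd'.congr fun r _ => ?_) ht
  · rw [norm_zero, mul_zero, zero_add] at h1
    refine h1.trans ((integral_exp_mul_le hs (Integrable.norm hqi) (fun r => norm_nonneg _)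
      ht).trans (le_of_eq ?_))
    simp only [norm_smul, Real.norm_eq_abs]
    rw [integral_const_mul]; ring
  · have h2 := recentred_add G c w r (v r - w r)
    rw [add_sub_cancel] at h2
    rw [h2]; module

/-- Solvability of the recentred equation in the reflexive case, by the method of continuity in the
size of the forcing term. -/
theorem exists_recentred_solution [TopologicalSpace.SeparableSpace E]
    (hrefl : Function.Surjective (NormedSpace.inclusionInDoubleDual ℝ E)) (hd : DenseRange ι)
    (hι : Function.Injective ι) (hA : ApproximatedEvolution T ι U UE Un)
    (hG : IsDissipativeFamily T ι G) (hGb : ∀ t ∈ Icc 0 T, BoundedlyDemicontinuous ι (G t))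
    (hs : 0 ≤ s) (hsT : s ≤ T) (ζ : ℝ) (hc : ContinuousOn c (Icc s T))
    (hq : IntegrableOn q (Ioc s T)) :
    ∃ v : ℝ → E, IsMildFor UE s T (fun r => ζ • v r + recentred G c r (v r) + q r) 0 v := by
  have hqi : ∀ θ : ℝ, IntegrableOn (fun r => θ • q r) (Ioc s T) := fun θ => Integrable.smul θ hq
  have hcont : ∀ {g : ℝ → E} {v : ℝ → E}, IsMildFor UE s T g 0 v → ContinuousOn v (Icc s T) :=
    fun hv => hv.continuousOn_Icc hA.evolE hs (by simpa using continuousOn_const)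
  set S : Set ℝ := {θ | ∃ v : ℝ → E,
    IsMildFor UE s T (fun r => ζ • v r + recentred G c r (v r) + θ • q r) 0 v} with hS
  set K : ℝ := Real.exp (|ζ| * T) * ∫ r in Ioc s T, ‖q r‖ with hK
  have hK0 : 0 ≤ K := mul_nonneg (Real.exp_pos _).le (integral_nonneg fun r => norm_nonneg _)
  have h0 : (0 : ℝ) ∈ S := by
    refine ⟨fun _ => 0, ?_, fun t ht => ?_⟩
    · simp only [smul_zero, recentred_zero, zero_smul, add_zero]
      exact integrableOn_zero
    · simp [recentred_zero]
  -- a solution at `θ` serves as the new centre for a small increase of the forcing term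
  have hopen : ∀ θ ∈ S ∩ Ico 0 1, ∀ y ∈ Ioi θ, (S ∩ Ioc θ y).Nonempty := by
    rintro θ ⟨⟨v, hv⟩, -⟩ y hy
    have hcv : ContinuousOn (fun r => c r + v r) (Icc s T) := hc.add (hcont hv)
    obtain ⟨ρ, hρ, hsol⟩ := exists_small_solution hrefl hd hι hA hG hGb hs hsT ζ hcv
    set δ := min (y - θ) (ρ / (K + 1)) with hδ
    have hδ0 : 0 < δ := lt_min (sub_pos.2 hy) (by positivity)
    obtain ⟨u, hu⟩ := hsol (fun r => δ • q r) (hqi δ) (by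
      simp only [norm_smul, Real.norm_of_nonneg hδ0.le]
      rw [integral_const_mul]
      calc Real.exp (|ζ| * T) * (δ * ∫ r in Ioc s T, ‖q r‖) = δ * K := by rw [hK]; ring
        _ ≤ ρ / (K + 1) * (K + 1) := by
          refine mul_le_mul (min_le_right _ _) (by linarith) hK0 (by positivity)
        _ = ρ := by field_simp)
    refine ⟨θ + δ, ⟨fun r => v r + u r, ?_⟩, by linarith,
      by linarith [min_le_left (y - θ) (ρ / (K + 1))]⟩
    have h1 := hv.add hu hA.evolE hs
    rw [add_zero] at h1
    refine h1.congr fun r _ => ?_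
    rw [recentred_add]
    module
  have hclosed : IsClosed S := by
    refine IsSeqClosed.isClosed fun θn θ hθn hθ => ?_
    choose vn hvn using hθn
    have hdiff : ∀ n m, ∀ t ∈ Icc s T, ‖vn n t - vn m t‖ ≤ K * |θn n - θn m| := fun n m t ht =>
      norm_sub_le_of_forcing hrefl hd hι hA hG hs hsT hc hq (hvn n) (hvn m) ht
    have hlimex : ∀ t ∈ Icc s T, ∃ y, Tendsto (fun n => vn n t) atTop (𝓝 y) := by
      intro t ht
      refine cauchySeq_tendsto_of_complete ?_
      rw [cauchySeq_iff_tendsto_dist_atTop_0]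
      have h1 := (cauchySeq_iff_tendsto_dist_atTop_0.1 hθ.cauchySeq).const_mul K
      rw [mul_zero] at h1
      refine squeeze_zero (fun _ => dist_nonneg) (fun p => ?_) h1
      rw [dist_eq_norm, Real.dist_eq]
      exact hdiff p.1 p.2 t ht
    choose! v hv using hlimex
    have hvb : ∀ n, ∀ t ∈ Icc s T, ‖vn n t - v t‖ ≤ K * |θn n - θ| := fun n t ht =>
      le_of_tendsto_of_tendsto' ((tendsto_const_nhds.sub (hv t ht)).norm)
        ((tendsto_const_nhds.sub hθ).abs.const_mul K) fun m => hdiff n m t ht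
    have hbound0 : Tendsto (fun n => K * |θn n - θ|) atTop (𝓝 0) := by
      have h1 := ((tendsto_sub_nhds_zero_iff.2 hθ).abs).const_mul K
      simpa using h1
    have hvc : ContinuousOn v (Icc s T) := by
      have hunif : TendstoUniformlyOn vn v atTop (Icc s T) := by
        rw [Metric.tendstoUniformlyOn_iff]
        intro ε hε
        filter_upwards [hbound0.eventually_lt_const hε] with n hn t ht
        rw [dist_comm, dist_eq_norm]
        exact (hvb n t ht).trans_lt hn
      exact hunif.continuousOn (Frequently.of_forall fun n => hcont (hvn n))
    have hcv : ContinuousOn (fun r => c r + v r) (Icc s T) := hc.add hvc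
    -- the solutions close to their limit `v` have a common integrable bound for the nonlinearity
    obtain ⟨ρ, hρ, hdom⟩ := hG.exists_dominating hrefl hd hι hs hsT hcv
    obtain ⟨n₀, hn₀⟩ := eventually_atTop.1 ((hbound0.eventually_lt_const hρ).and
      ((hθ.abs).eventually_lt_const (lt_add_one |θ|)))
    have hclose : ∀ n, ∀ t ∈ Icc s T, ‖vn (n + n₀) t - v t‖ ≤ ρ := fun n t ht =>
      (hvb _ t ht).trans (hn₀ _ (Nat.le_add_left _ _)).1.le
    obtain ⟨φ, hφ, -, hφb⟩ := hdom (fun n t => vn (n + n₀) t - v t)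
      (fun n => (hcont (hvn _)).sub hvc) hclose
    have hNv : IntegrableOn (fun r => recentred G c r (v r)) (Ioc s T) :=
      ((hG.integrableOn_path hs hcv).sub (hG.integrableOn_path hs hc)).mono_set Ioc_subset_Icc_self
    have hvi : IntegrableOn v (Ioc s T) :=
      (hvc.integrableOn_Icc).mono_set Ioc_subset_Icc_self
    refine ⟨v, IsMildFor.of_weak_limit hrefl hd hι hA hs (un := fun n => vn (n + n₀))
      (fun n => hvn (n + n₀)) (fun t ht => ?_)
      (φ := fun r => |ζ| * (‖v r‖ + ρ) + (‖recentred G c r (v r)‖ + φ r) + (|θ| + 1) * ‖q r‖)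
      (((((Integrable.norm hvi).add (integrableOn_const (by simp))).const_mul _).add
        ((Integrable.norm hNv).add hφ)).add ((Integrable.norm hq).const_mul _)) ?_
      (((hvi.aestronglyMeasurable.const_smul ζ).add hNv.aestronglyMeasurable).add
        (hqi θ).aestronglyMeasurable) ?_⟩
    · exact (ι.continuous.tendsto _).comp ((tendsto_add_atTop_iff_nat n₀).2 (hv t ht))
    · filter_upwards [hφb, ae_restrict_mem measurableSet_Ioc] with r hr hrI n
      refine (norm_add_le _ _).trans (add_le_add ((norm_add_le _ _).trans (add_le_add ?_ ?_)) ?_)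
      · rw [norm_smul, Real.norm_eq_abs]
        refine mul_le_mul_of_nonneg_left ?_ (abs_nonneg _)
        have h1 := norm_add_le (v r) (vn (n + n₀) r - v r)
        rw [add_sub_cancel] at h1
        linarith [hclose n r (Ioc_subset_Icc_self hrI)]
      · have h1 := recentred_add G c v r (vn (n + n₀) r - v r)
        rw [add_sub_cancel] at h1
        rw [h1]
        exact (norm_add_le _ _).trans (add_le_add le_rfl (hr n))
      · rw [norm_smul, Real.norm_eq_abs]
        exact mul_le_mul_of_nonneg_right (hn₀ _ (Nat.le_add_left _ _)).2.le (norm_nonneg _)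
    · filter_upwards [ae_restrict_mem measurableSet_Ioc] with r hr z
      have hvr : Tendsto (fun n => vn (n + n₀) r) atTop (𝓝 (v r)) :=
        (tendsto_add_atTop_iff_nat n₀).2 (hv r (Ioc_subset_Icc_self hr))
      have hweak := (hG.demi r ⟨hs.trans hr.1.le, hr.2⟩).recentre (c r) _ _ hvr z
      simp only [map_add, map_smul, inner_add_left]
      refine ((?_ : Tendsto _ _ _).add hweak).add ?_
      · exact (((ι.continuous.tendsto _).comp hvr).const_smul ζ).inner tendsto_const_nhds
      · exact ((((tendsto_add_atTop_iff_nat n₀).2 hθ).smul_const _).inner tendsto_const_nhds)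
  have h1 := (hclosed.inter isClosed_Icc).Icc_subset_of_forall_exists_gt h0 hopen
    (right_mem_Icc.2 zero_le_one)
  obtain ⟨v, hv⟩ := h1
  exact ⟨v, by simpa only [one_smul] using hv⟩

end Continuation

/-! ### Solutions in `E` and their estimates -/

section SolutionsE

variable {E H : Type*} [NormedAddCommGroup E] [NormedSpace ℝ E] [CompleteSpace E]
  [NormedAddCommGroup H] [InnerProductSpace ℝ H] [CompleteSpace H]
  {T s ζ : ℝ} {ι : E →L[ℝ] H} {U : ℝ → ℝ → H →L[ℝ] H} {UE : ℝ → ℝ → E →L[ℝ] E}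
  {Un : ℕ → ℝ → ℝ → E →L[ℝ] E} {G : ℝ → E → E} {c q f : ℝ → E} {x : E}

/-- Existence in the reflexive case: the solution is sought near the orbit of the linear part. -/
theorem exists_solution_of_reflexive [TopologicalSpace.SeparableSpace E]
    (hrefl : Function.Surjective (NormedSpace.inclusionInDoubleDual ℝ E)) (hd : DenseRange ι)
    (hι : Function.Injective ι) (hA : ApproximatedEvolution T ι U UE Un)
    (hG : IsDissipativeFamily T ι G) (hGb : ∀ t ∈ Icc 0 T, BoundedlyDemicontinuous ι (G t))
    (hs : 0 ≤ s) (hsT : s ≤ T) (ζ : ℝ) (hf : ContinuousOn f (Icc s T)) (x : E) :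
    ∃ y : ℝ → E, IsMildFor UE s T (fun r => ζ • (y r + f r) + G r (y r + f r)) x y := by
  have hw : IsMildFor UE s T (fun _ => 0) x (fun t => UE t s x) :=
    ⟨integrableOn_zero, fun t _ => by simp⟩
  have hc : ContinuousOn (fun t => UE t s x + f t) (Icc s T) :=
    (hA.continuousOn_orbit_of_reflexive hrefl hd hι hs x).add hf
  have hq : IntegrableOn (fun r => ζ • (UE r s x + f r) + G r (UE r s x + f r)) (Ioc s T) :=
    ((Integrable.smul ζ hc.integrableOn_Icc).add (hG.integrableOn_path hs hc)).mono_measure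
      (Measure.restrict_mono Ioc_subset_Icc_self le_rfl)
  obtain ⟨v, hv⟩ := exists_recentred_solution hrefl hd hι hA hG hGb hs hsT ζ hc hq
  refine ⟨fun t => UE t s x + v t, ?_⟩
  have h1 := hw.add hv hA.evolE hs
  rw [add_zero] at h1
  refine h1.congr fun r _ => ?_
  have h2 : UE r s x + v r + f r = UE r s x + f r + v r := by abel
  simp only [recentred, h2]
  module

/-- Composing a map that is dissipative at `0` with the radial retraction keeps this property, since
the retraction only rescales its argument. -/
theorem le_norm_sub_radialRetraction {g : E → E}
    (hg : ∀ b : E, ∀ α : ℝ, 0 < α → ‖b‖ ≤ ‖b - α • g b‖) {M : ℝ} (hM : 0 < M) (ω : ℝ) (a : E)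
    {α : ℝ} (hα : 0 < α) :
    (1 - α * ω) * ‖a‖ ≤ ‖a - α • (ω • a + g (radialRetraction M a))‖ := by
  rcases le_or_gt (1 - α * ω) 0 with h | h
  · exact (mul_nonpos_of_nonpos_of_nonneg h (norm_nonneg _)).trans (norm_nonneg _)
  · set l := M / max M ‖a‖ with hl
    have hl0 : 0 < l := div_pos hM (lt_max_of_lt_left hM)
    have h1 : ∀ β : ℝ, 0 < β → ‖a‖ ≤ ‖a - β • g (radialRetraction M a)‖ := by
      intro β hβ
      have h2 := hg (radialRetraction M a) (l * β) (by positivity)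
      have h3 : radialRetraction M a - (l * β) • g (radialRetraction M a) =
          l • (a - β • g (radialRetraction M a)) := by
        rw [smul_sub, mul_smul]; rfl
      have h4 : ‖radialRetraction M a‖ = l * ‖a‖ := by
        rw [radialRetraction, norm_smul, Real.norm_of_nonneg hl0.le]
      rw [h3, h4, norm_smul, Real.norm_of_nonneg hl0.le] at h2
      exact le_of_mul_le_mul_left h2 hl0
    have h2 : a - α • (ω • a + g (radialRetraction M a)) =
        (1 - α * ω) • (a - (α / (1 - α * ω)) • g (radialRetraction M a)) := by
      rw [smul_sub (1 - α * ω), smul_smul, mul_div_cancel₀ _ h.ne']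
      module
    rw [h2, norm_smul, Real.norm_of_nonneg h.le]
    exact mul_le_mul_of_nonneg_left (h1 _ (div_pos hα h)) h.le

theorem IsMDissipativeMap.le_norm_sub {g : E → E} (hg : IsMDissipativeMap ι g) (h0 : g 0 = 0)
    (b : E) {α : ℝ} (hα : 0 < α) : ‖b‖ ≤ ‖b - α • g b‖ := by
  simpa [h0] using hg.dissE b 0 α hα

/-- `G t` is Lipschitz continuous in `E` on bounded sets, uniformly in `t ∈ [0, T]`. -/
def LocallyLipschitzFamily (T : ℝ) (G : ℝ → E → E) : Prop :=
  ∀ R : ℝ, ∃ L : ℝ, 0 ≤ L ∧ ∀ t ∈ Icc 0 T, ∀ a b : E, ‖a‖ ≤ R → ‖b‖ ≤ R →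
    ‖G t a - G t b‖ ≤ L * ‖a - b‖

/-- The nonlinearity is globally Lipschitz continuous after composition with the retraction. -/
theorem LocallyLipschitzFamily.exists_lipschitz_radial (hL : LocallyLipschitzFamily T G)
    (hs : 0 ≤ s) {R : ℝ} (hc : ∀ r ∈ Ioc s T, ‖c r‖ ≤ R) {M : ℝ} (hM : 0 < M) (ζ : ℝ) :
    ∃ K : ℝ, 0 ≤ K ∧ ∀ r ∈ Ioc s T, ∀ a b : E,
      ‖(ζ • a + recentred G c r (radialRetraction M a)) -
        (ζ • b + recentred G c r (radialRetraction M b))‖ ≤ K * ‖a - b‖ := by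
  obtain ⟨L, hL0, hL⟩ := hL (R + M)
  refine ⟨|ζ| + L * 2, by positivity, fun r hr a b => ?_⟩
  rw [add_sub_add_comm, ← smul_sub, add_mul]
  refine (norm_add_le _ _).trans (add_le_add ?_ ?_)
  · rw [norm_smul, Real.norm_eq_abs]
  · have hcb : ∀ a : E, ‖c r + radialRetraction M a‖ ≤ R + M := fun a =>
      (norm_add_le _ _).trans (add_le_add (hc r hr) (norm_radialRetraction_le hM a))
    have h1 := hL r ⟨hs.trans hr.1.le, hr.2⟩ _ _ (hcb a) (hcb b)
    rw [add_sub_add_left_eq_sub] at h1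
    rw [recentred, recentred, sub_sub_sub_cancel_right, mul_assoc]
    exact h1.trans (mul_le_mul_of_nonneg_left (norm_radialRetraction_sub_le hM a b) hL0)

/-- The a priori bound in the locally Lipschitz case. -/
theorem IsMildFor.norm_le_of_locallyLipschitz (hA : ApproximatedEvolution T ι U UE Un)
    (hG : IsDissipativeFamily T ι G) (hL : LocallyLipschitzFamily T G) (hs : 0 ≤ s)
    {R : ℝ} (hc : ∀ r ∈ Ioc s T, ‖c r‖ ≤ R) (hq : IntegrableOn q (Ioc s T)) {v : ℝ → E}
    (hv : IsMildFor UE s T (fun r => ζ • v r + recentred G c r (v r) + q r) x v) {t : ℝ}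
    (ht : t ∈ Icc s T) :
    ‖v t‖ ≤ Real.exp (ζ * (t - s)) * ‖x‖ + ∫ r in s..t, Real.exp (ζ * (t - r)) * ‖q r‖ := by
  obtain ⟨C, hC⟩ := hv.exists_bound hA.evolE hs
  have hM : 0 < |C| + 1 := by positivity
  obtain ⟨K, hK0, hK⟩ := hL.exists_lipschitz_radial hs hc hM ζ
  refine hA.norm_le_of_lipschitz hs hv.integrable hv.eq hK0 hK ?_ hq (fun r hr => ?_) ht
  · intro r hr a α hα
    exact le_norm_sub_radialRetraction (fun b β hβ => (hG.mdiss_recentred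
      ⟨hs.trans hr.1.le, hr.2⟩).le_norm_sub (recentred_zero G c r) b hβ) hM ζ a hα
  · rw [radialRetraction_of_norm_le hM]
    linarith [hC r (Ioc_subset_Icc_self hr), le_abs_self C]

/-- Existence in the locally Lipschitz case: the a priori bound `M` holds for the equation with the
retraction onto the ball of radius `M`, so that its solution does not see the retraction. -/
theorem exists_solution_of_locallyLipschitz (hA : ApproximatedEvolution T ι U UE Un)
    (hG : IsDissipativeFamily T ι G) (hL : LocallyLipschitzFamily T G) (hs : 0 ≤ s) (hsT : s ≤ T)
    (ζ : ℝ) (hf : ContinuousOn f (Icc s T)) (x : E) :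
    ∃ y : ℝ → E, IsMildFor UE s T (fun r => ζ • (y r + f r) + G r (y r + f r)) x y := by
  obtain ⟨R, hR⟩ := isCompact_Icc.exists_bound_of_continuousOn hf
  have hR' : ∀ r ∈ Ioc s T, ‖f r‖ ≤ R := fun r hr => hR r (Ioc_subset_Icc_self hr)
  set q : ℝ → E := fun r => ζ • f r + G r (f r) with hq_def
  have hq : IntegrableOn q (Ioc s T) :=
    ((Integrable.smul ζ hf.integrableOn_Icc).add (hG.integrableOn_path hs hf)).mono_measure
      (Measure.restrict_mono Ioc_subset_Icc_self le_rfl)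
  have hqn : IntegrableOn (fun r => ‖q r‖) (Ioc s T) := Integrable.norm hq
  set M : ℝ := Real.exp (|ζ| * T) * ‖x‖ + Real.exp (|ζ| * T) * (∫ r in Ioc s T, ‖q r‖) + 1 with hM
  have hI : 0 ≤ ∫ r in Ioc s T, ‖q r‖ := integral_nonneg fun r => norm_nonneg _
  have hM0 : 0 < M := by positivity
  obtain ⟨K, hK0, hK⟩ := hL.exists_lipschitz_radial hs hR' hM0 ζ
  have hπ0 : radialRetraction M (0 : E) = 0 := by simp [radialRetraction]
  obtain ⟨y, hy1, -, hy3, hy4⟩ := hA.evolE.exists_mild_of_lipschitz hs hsT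
    (Ψ := fun r a => ζ • a + recentred G f r (radialRetraction M a) + q r) hK0
    (fun r hr a b => by rw [add_sub_add_right_eq_sub]; exact hK r hr a b)
    (fun u hu => by
      refine (((hu.aestronglyMeasurable measurableSet_Ioc).const_smul ζ).add
        (AEStronglyMeasurable.sub ?_ ?_)).add hq.aestronglyMeasurable
      · exact hG.aestronglyMeasurable_path hs ((hf.mono Ioc_subset_Icc_self).add
          ((continuous_radialRetraction hM0).comp_continuousOn hu))
      · exact hG.aestronglyMeasurable_path hs (hf.mono Ioc_subset_Icc_self))
    (hq.congr_fun (fun r _ => by simp [hπ0, recentred_zero]) measurableSet_Ioc) x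
  have hyM : ∀ t ∈ Icc s T, ‖y t‖ ≤ M := by
    intro t ht
    have h1 := hA.norm_le_of_lipschitz (ω := ζ) hs hy3 hy4 hK0 hK (fun r hr a α hα =>
      le_norm_sub_radialRetraction (fun b β hβ => (hG.mdiss_recentred
        ⟨hs.trans hr.1.le, hr.2⟩).le_norm_sub (recentred_zero G f r) b hβ) hM0 ζ a hα) hq
      (fun r _ => rfl) ht
    have h2 := integral_exp_mul_le (ζ := ζ) hs hqn (fun r => norm_nonneg _) ht
    have h3 : Real.exp (ζ * (t - s)) ≤ Real.exp (|ζ| * T) := Real.exp_le_exp.2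
      (mul_le_mul (le_abs_self _) (by linarith [ht.2]) (by linarith [ht.1]) (abs_nonneg _))
    have h4 := mul_le_mul_of_nonneg_right h3 (norm_nonneg x)
    linarith
  refine ⟨y, IsMildFor.congr ⟨hy3, hy4⟩ fun r hr => ?_⟩
  rw [radialRetraction_of_norm_le hM0 (hyM r (Ioc_subset_Icc_self hr))]
  simp only [hq_def, recentred, add_comm (f r) (y r)]
  module

/-! ### Convergence of the solutions of the Yosida approximations -/

/-- The Yosida approximation of `ζ + G t`, that is `ζ + G t` composed with the resolvent of
`G t`. -/
def shiftedYosida (G : ℝ → E → E) (ζ k t : ℝ) (v : E) : E :=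
  ζ • resolventMap (G t) k v + yosidaApprox (G t) k v

variable {V : Type*} [NormedAddCommGroup V] [NormedSpace ℝ V] {k : ℝ}

theorem norm_shiftedYosida_sub_le {t : ℝ} (hg : IsMDissipativeMap ι (G t)) {L : E →L[ℝ] V}
    (hL : DissipativeAlong L (G t)) (hk : 0 < k) (a b : E) :
    ‖L (shiftedYosida G ζ k t a - shiftedYosida G ζ k t b)‖ ≤ (|ζ| + 2 * k) * ‖L (a - b)‖ := by
  rw [shiftedYosida, shiftedYosida, add_sub_add_comm, ← smul_sub, add_mul, map_add, map_smul]
  refine (norm_add_le _ _).trans (add_le_add ?_ (hg.norm_yosida_sub_le hL hk a b))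
  rw [norm_smul, Real.norm_eq_abs]
  exact mul_le_mul_of_nonneg_left (hg.norm_resolvent_sub_le hL hk a b) (abs_nonneg _)

theorem norm_shiftedYosida_le {t : ℝ} (hg : IsMDissipativeMap ι (G t)) {L : E →L[ℝ] V}
    (hL : DissipativeAlong L (G t)) (hk : 1 ≤ k) (a : E) :
    ‖L (shiftedYosida G ζ k t a)‖ ≤ |ζ| * ‖L a‖ + (|ζ| + 1) * ‖L (G t a)‖ := by
  have hk0 : 0 < k := one_pos.trans_le hk
  have h1 := hg.norm_resolvent_sub_self_le hL hk0 a
  have h2 := hg.norm_yosida_le hL hk0 a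
  have h3 : ‖L (resolventMap (G t) k a)‖ ≤ ‖L a‖ + ‖L (G t a)‖ := by
    have h4 : L (resolventMap (G t) k a) = L a + L (resolventMap (G t) k a - a) := by
      rw [map_sub]; abel
    rw [h4]
    refine (norm_add_le _ _).trans (add_le_add le_rfl (h1.trans ?_))
    exact mul_le_of_le_one_left (norm_nonneg _) ((div_le_one hk0).2 hk)
  rw [shiftedYosida, map_add, map_smul]
  refine (norm_add_le _ _).trans ?_
  rw [norm_smul, Real.norm_eq_abs]
  have h5 := mul_le_mul_of_nonneg_left h3 (abs_nonneg ζ)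
  linarith

theorem IsDissipativeFamily.aestronglyMeasurable_shiftedYosida (hG : IsDissipativeFamily T ι G)
    (hs : 0 ≤ s) (hsT : s ≤ T) (hk : 0 < k) {p : ℝ → E}
    (hp : AEStronglyMeasurable p (volume.restrict (Ioc s T))) :
    AEStronglyMeasurable (fun r => shiftedYosida G ζ k r (p r)) (volume.restrict (Ioc s T)) := by
  have h := aestronglyMeasurable_resolventMap (hs.trans hsT) hG.mdiss hG.cont hk measurableSet_Ioc
    (fun t ht => ⟨hs.trans ht.1.le, ht.2⟩) hp
  exact (h.const_smul ζ).add ((h.sub hp).const_smul k)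

theorem exists_shiftedYosida_solution (hA : ApproximatedEvolution T ι U UE Un)
    (hG : IsDissipativeFamily T ι G) (hs : 0 ≤ s) (hsT : s ≤ T) (ζ : ℝ)
    (hf : ContinuousOn f (Icc s T)) (hk : 1 ≤ k) (x : E) :
    ∃ y : ℝ → E, IsMildFor UE s T (fun r => shiftedYosida G ζ k r (y r + f r)) x y := by
  have hk0 : 0 < k := one_pos.trans_le hk
  have hg : ∀ r ∈ Ioc s T, IsMDissipativeMap ι (G r) := fun r hr =>
    hG.mdiss r ⟨hs.trans hr.1.le, hr.2⟩
  have hfi : IntegrableOn f (Ioc s T) := hf.integrableOn_Icc.mono_set Ioc_subset_Icc_self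
  have hGf : IntegrableOn (fun r => G r (f r)) (Ioc s T) :=
    (hG.integrableOn_path hs hf).mono_set Ioc_subset_Icc_self
  obtain ⟨y, -, -, hy3, hy4⟩ := hA.evolE.exists_mild_of_lipschitz hs hsT
    (Ψ := fun r a => shiftedYosida G ζ k r (a + f r)) (K := |ζ| + 2 * k) (by positivity)
    (fun r hr a b => by
      have h := norm_shiftedYosida_sub_le (ζ := ζ) (hg r hr) (hg r hr).dissE hk0 (a + f r) (b + f r)
      simpa using h)
    (fun u hu => hG.aestronglyMeasurable_shiftedYosida hs hsT hk0
      ((hu.aestronglyMeasurable measurableSet_Ioc).add hfi.aestronglyMeasurable))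
    (by
      refine Integrable.mono' (((Integrable.norm hfi).const_mul |ζ|).add
        ((Integrable.norm hGf).const_mul (|ζ| + 1)))
        (hG.aestronglyMeasurable_shiftedYosida hs hsT hk0
          (aestronglyMeasurable_const.add hfi.aestronglyMeasurable)) ?_
      filter_upwards [ae_restrict_mem measurableSet_Ioc] with r hr
      have h := norm_shiftedYosida_le (ζ := ζ) (hg r hr) (hg r hr).dissE hk (f r)
      simpa using h) x
  exact ⟨y, hy3, hy4⟩

/-- The consistency error of the Yosida approximation along a path. -/
theorem tendsto_integral_shiftedYosida_sub (hG : IsDissipativeFamily T ι G) (hs : 0 ≤ s)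
    (hsT : s ≤ T) {p : ℝ → E} (hp : IntegrableOn p (Ioc s T))
    (hGp : IntegrableOn (fun r => G r (p r)) (Ioc s T)) {L : E →L[ℝ] V}
    (hL : ∀ r ∈ Ioc s T, DissipativeAlong L (G r))
    (hconv : ∀ r ∈ Ioc s T,
      Tendsto (fun k : ℕ => L (yosidaApprox (G r) k (p r))) atTop (𝓝 (L (G r (p r))))) :
    (∀ k : ℕ, 1 ≤ k → IntegrableOn
      (fun r => L (shiftedYosida G ζ k r (p r) - (ζ • p r + G r (p r)))) (Ioc s T)) ∧
    Tendsto (fun k : ℕ => ∫ r in Ioc s T,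
      ‖L (shiftedYosida G ζ k r (p r) - (ζ • p r + G r (p r)))‖) atTop (𝓝 0) := by
  have hg : ∀ r ∈ Ioc s T, IsMDissipativeMap ι (G r) := fun r hr =>
    hG.mdiss r ⟨hs.trans hr.1.le, hr.2⟩
  set b : ℝ → ℝ := fun r => (|ζ| * ‖L (p r)‖ + (|ζ| + 1) * ‖L (G r (p r))‖) +
    (|ζ| * ‖L (p r)‖ + ‖L (G r (p r))‖) with hb
  have hpn : IntegrableOn (fun r => ‖L (p r)‖) (Ioc s T) := Integrable.norm (L.integrable_comp hp)
  have hGn : IntegrableOn (fun r => ‖L (G r (p r))‖) (Ioc s T) :=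
    Integrable.norm (L.integrable_comp hGp)
  have hbi : IntegrableOn b (Ioc s T) :=
    ((hpn.const_mul _).add (hGn.const_mul _)).add ((hpn.const_mul _).add hGn)
  have hm : ∀ k : ℕ, 1 ≤ k → AEStronglyMeasurable
      (fun r => L (shiftedYosida G ζ k r (p r) - (ζ • p r + G r (p r))))
      (volume.restrict (Ioc s T)) := fun k hk =>
    L.continuous.comp_aestronglyMeasurable
      ((hG.aestronglyMeasurable_shiftedYosida hs hsT (by exact_mod_cast hk)
        hp.aestronglyMeasurable).sub ((hp.aestronglyMeasurable.const_smul ζ).add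
          hGp.aestronglyMeasurable))
  have hdom : ∀ k : ℕ, 1 ≤ k → ∀ᵐ r ∂volume.restrict (Ioc s T),
      ‖L (shiftedYosida G ζ k r (p r) - (ζ • p r + G r (p r)))‖ ≤ b r := by
    intro k hk
    filter_upwards [ae_restrict_mem measurableSet_Ioc] with r hr
    rw [map_sub]
    refine (norm_sub_le _ _).trans (add_le_add
      (norm_shiftedYosida_le (hg r hr) (hL r hr) (by exact_mod_cast hk) _) ?_)
    rw [map_add, map_smul]
    refine (norm_add_le _ _).trans (le_of_eq ?_)
    rw [norm_smul, Real.norm_eq_abs]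
  refine ⟨fun k hk => Integrable.mono' hbi (hm k hk) (hdom k hk), ?_⟩
  have h := tendsto_integral_filter_of_dominated_convergence (μ := volume.restrict (Ioc s T))
    (F := fun (k : ℕ) r => ‖L (shiftedYosida G ζ k r (p r) - (ζ • p r + G r (p r)))‖)
    (f := fun _ => 0) (l := atTop) b ((eventually_ge_atTop 1).mono fun k hk => (hm k hk).norm)
    ((eventually_ge_atTop 1).mono fun k hk => by simpa only [norm_norm] using hdom k hk) hbi ?_
  · simpa using h
  · filter_upwards [ae_restrict_mem measurableSet_Ioc] with r hr
    have h1 : Tendsto (fun k : ℕ => L (resolventMap (G r) k (p r))) atTop (𝓝 (L (p r))) :=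
      (L.continuous.tendsto _).comp ((hg r hr).tendsto_resolvent (p r))
    have h2 := (((h1.const_smul ζ).add (hconv r hr)).sub_const (ζ • L (p r) + L (G r (p r)))).norm
    rw [sub_self, norm_zero] at h2
    refine h2.congr fun k => ?_
    rw [shiftedYosida, map_sub, map_add, map_add, map_smul, map_smul]

end SolutionsE

/-! ### The standing hypothesis -/

section Standing

variable {E H : Type*} [NormedAddCommGroup E] [NormedSpace ℝ E]
  [NormedAddCommGroup H] [InnerProductSpace ℝ H]
  {T ζ : ℝ} {ι : E →L[ℝ] H} {D : Set H} {F : ℝ → H → H}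
  {A : ℝ → H →ₗ.[ℝ] H} {U : ℝ → ℝ → H →L[ℝ] H}

/-- The everywhere defined dissipative map `x ↦ F_E(t, x) - ζ x` of `E`. -/
def dissipativePart (ι : E →L[ℝ] H) (F : ℝ → H → H) (ζ t : ℝ) (x : E) : E :=
  partMap ι (F t) x - ζ • x

theorem smul_add_dissipativePart (ι : E →L[ℝ] H) (F : ℝ → H → H) (ζ t : ℝ) (x : E) :
    ζ • x + dissipativePart ι F ζ t x = partMap ι (F t) x := by
  rw [dissipativePart, add_sub_cancel]

namespace StandingHypothesis

theorem map_partMap (hS : StandingHypothesis T ι D F ζ A U) {t : ℝ} (ht : t ∈ Icc 0 T) (x : E) :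
    ι (partMap ι (F t) x) = F t (ι x) :=
  Function.invFun_eq (hS.F_mem t ht x)

theorem map_dissipativePart (hS : StandingHypothesis T ι D F ζ A U) {t : ℝ} (ht : t ∈ Icc 0 T)
    (x : E) : ι (dissipativePart ι F ζ t x) = F t (ι x) - ζ • ι x := by
  rw [dissipativePart, map_sub, map_smul, hS.map_partMap ht]

theorem isMDissipativeMap [CompleteSpace E] (hS : StandingHypothesis T ι D F ζ A U) {t : ℝ}
    (ht : t ∈ Icc 0 T) : IsMDissipativeMap ι (dissipativePart ι F ζ t) := by
  have hgraph : ∀ x, (ι x, ι (dissipativePart ι F ζ t x)) ∈ shiftedGraph D (F t) ζ := fun x =>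
    ⟨hS.range_subset (mem_range_self x), hS.map_dissipativePart ht x⟩
  have hE := hS.F_part_mdissipative t ht
  have hdE : DissipativeAlong (ContinuousLinearMap.id ℝ E) (dissipativePart ι F ζ t) :=
    fun a b α hα => hE.1 (a, _) (hgraph a) (b, _) (hgraph b) α hα
  refine ⟨hdE, fun a b α hα => ?_, hdE.surjective_of_exists ?_⟩
  · have h := (hS.F_mdissipative t ht).1 _ (hgraph a) _ (hgraph b) α hα
    simpa only [map_sub, map_smul] using h
  · obtain ⟨l, hl, h⟩ := hE.2
    refine ⟨l, hl, fun v => ?_⟩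
    obtain ⟨⟨z, w⟩, ⟨-, hw⟩, hv⟩ := h v
    refine ⟨z, ?_⟩
    have : w = dissipativePart ι F ζ t z :=
      hS.embedding_injective (hw.trans (hS.map_dissipativePart ht z).symm)
    rw [← this]; exact hv

theorem isDissipativeFamily [CompleteSpace E] (hS : StandingHypothesis T ι D F ζ A U)
    (hdemi : ∀ t ∈ Icc 0 T, Demicontinuous ι (dissipativePart ι F ζ t)) :
    IsDissipativeFamily T ι (dissipativePart ι F ζ) := by
  refine ⟨fun t ht => hS.isMDissipativeMap ht, fun x => ?_, fun g hg => ?_, hdemi⟩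
  · exact (hS.F_cont x).sub continuousOn_const
  · exact (hS.F_integrable g hg).sub (Integrable.smul ζ hg.integrableOn_Icc)

/-- At points of `E`, the resolvent of `F(t, ·) - ζ` in `H` is the resolvent in `E`, because
solutions of the resolvent equation in `H` are unique. -/
theorem yosidaMap_eq [CompleteSpace E] (hS : StandingHypothesis T ι D F ζ A U) {t : ℝ}
    (ht : t ∈ Icc 0 T) {k : ℕ} (hk : 1 ≤ k) (v : E) :
    yosidaMap D (F t) ζ k (ι v) = ι (shiftedYosida (dissipativePart ι F ζ) ζ k t v) := by
  have hk0 : (0 : ℝ) < k := by exact_mod_cast hk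
  have hg := hS.isMDissipativeMap ht
  set J := resolventMap (dissipativePart ι F ζ t) k v with hJ
  set f : H → H := fun z => z - (1 / (k : ℝ)) • (F t z - ζ • z) with hf
  have hJD : ι J ∈ D := hS.range_subset (mem_range_self J)
  have hJf : f (ι J) = ι v := by
    rw [hf]
    simp only
    rw [← hS.map_dissipativePart ht, ← map_smul, ← map_sub, hg.resolvent_spec hk0]
  have hex : ∃ z ∈ D, f z = ι v := ⟨_, hJD, hJf⟩
  have hz : yosidaResolvent D (F t) ζ k (ι v) = ι J := by
    have h1 : yosidaResolvent D (F t) ζ k (ι v) ∈ D := Function.invFunOn_mem hex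
    have h2 : f (yosidaResolvent D (F t) ζ k (ι v)) = ι v := Function.invFunOn_eq hex
    set z := yosidaResolvent D (F t) ζ k (ι v)
    have h3 := (hS.F_mdissipative t ht).1 (z, F t z - ζ • z) ⟨h1, rfl⟩
      (ι J, F t (ι J) - ζ • ι J) ⟨hJD, rfl⟩ (1 / k)
      (by positivity)
    have h4 : z - ι J - (1 / (k : ℝ)) • ((F t z - ζ • z) - (F t (ι J) - ζ • ι J)) =
        f z - f (ι J) := by
      simp only [hf, smul_sub]; abel
    simp only at h3
    rw [h4, h2, hJf, sub_self, norm_zero] at h3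
    exact sub_eq_zero.1 (norm_le_zero_iff.1 h3)
  rw [yosidaMap, hz, shiftedYosida, hg.yosida_eq hk0, map_add, map_smul, hS.map_dissipativePart ht]
  abel

end StandingHypothesis

theorem BoundedlyDemicontinuous.demicontinuous {g : E → E} (hg : BoundedlyDemicontinuous ι g) :
    Demicontinuous ι g := by
  intro v y hv
  obtain ⟨C, hC⟩ := (Metric.isBounded_range_of_tendsto v hv).exists_norm_le
  exact hg v C y (fun n => hC _ (mem_range_self n)) ((ι.continuous.tendsto y).comp hv)

theorem ReflexiveCase.boundedlyDemicontinuous (hR : ReflexiveCase T ι F ζ)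
    (hS : StandingHypothesis T ι D F ζ A U) {t : ℝ} (ht : t ∈ Icc 0 T) :
    BoundedlyDemicontinuous ι (dissipativePart ι F ζ t) := by
  intro v C y hC hv z
  have hb : Bornology.IsBounded (range v) :=
    isBounded_iff_forall_norm_le.2 ⟨C, by rintro _ ⟨n, rfl⟩; exact hC n⟩
  have h1 := (tendsto_zero_iff_abs_tendsto_zero _).2 (hR.weak_cont v y hb hv t ht z)
  have h2 := ((h1.add_const (inner ℝ (F t (ι y)) (ι z))).sub
    ((hv.const_smul ζ).inner (tendsto_const_nhds (x := ι z))))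
  simp only [hS.map_dissipativePart ht, inner_sub_left]
  simpa only [zero_add, inner_sub_left, sub_add_cancel] using h2

theorem LipschitzCase.locallyLipschitzFamily (hL : LipschitzCase T ι F) :
    LocallyLipschitzFamily T (dissipativePart ι F ζ) := by
  intro R
  obtain ⟨L, hL0, hL⟩ := hL.lipschitz (Metric.closedBall 0 R) Metric.isBounded_closedBall
  refine ⟨L + |ζ|, by positivity, fun t ht a b ha hb => ?_⟩
  have h1 := hL t ht a (by simpa using ha) b (by simpa using hb)
  have h2 : dissipativePart ι F ζ t a - dissipativePart ι F ζ t b =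
      (partMap ι (F t) a - partMap ι (F t) b) - ζ • (a - b) := by
    simp only [dissipativePart]; module
  rw [h2, add_mul]
  refine (norm_sub_le _ _).trans (add_le_add h1 ?_)
  rw [norm_smul, Real.norm_eq_abs]

theorem LocallyLipschitzFamily.continuous {G : ℝ → E → E} (hL : LocallyLipschitzFamily T G)
    {t : ℝ} (ht : t ∈ Icc 0 T) : Continuous (G t) := by
  refine continuous_iff_continuousAt.2 fun y => ?_
  obtain ⟨L, -, hL⟩ := hL (‖y‖ + 1)
  rw [ContinuousAt, tendsto_iff_norm_sub_tendsto_zero]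
  have h1 : Tendsto (fun a => L * ‖a - y‖) (𝓝 y) (𝓝 0) := by
    have := (tendsto_iff_norm_sub_tendsto_zero.1 (tendsto_id (x := 𝓝 y))).const_mul L
    simpa using this
  refine squeeze_zero' (Eventually.of_forall fun _ => norm_nonneg _) ?_ h1
  filter_upwards [(continuous_norm.tendsto y).eventually_lt_const (lt_add_one ‖y‖)] with a ha
  exact hL t ht a y ha.le (by linarith)

theorem LocallyLipschitzFamily.demicontinuous {G : ℝ → E → E} (hL : LocallyLipschitzFamily T G)
    {t : ℝ} (ht : t ∈ Icc 0 T) : Demicontinuous ι (G t) := fun _ y hv _ =>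
  ((ι.continuous.tendsto _).comp (((hL.continuous ht).tendsto y).comp hv)).inner tendsto_const_nhds

end Standing

/-! ### Mild solutions in the class `C([s, T]; H) ∩ C_b((s, T]; E)` -/

section Mild

variable {E H : Type*} [NormedAddCommGroup E] [NormedSpace ℝ E] [CompleteSpace E]
  [NormedAddCommGroup H] [InnerProductSpace ℝ H] [CompleteSpace H]
  {T s ζ : ℝ} {ι : E →L[ℝ] H} {U : ℝ → ℝ → H →L[ℝ] H} {UE : ℝ → ℝ → E →L[ℝ] E}
  {Un : ℕ → ℝ → ℝ → E →L[ℝ] E} {f g : ℝ → E} {x : E} {y : ℝ → E} {Φ : ℝ → H → H}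

theorem IsMildFor.isMildSolution (hy : IsMildFor UE s T g x y)
    (hA : ApproximatedEvolution T ι U UE Un) (hs : 0 ≤ s)
    (hΦ : ∀ r ∈ Ioc s T, ι (g r) = Φ r (ι (y r + f r))) : IsMildSolution ι U Φ f s T x y := by
  have h := (hy.map hA hs).congr hΦ
  obtain ⟨C, hC⟩ := hy.exists_bound hA.evolE hs
  refine ⟨h.continuousOn_Icc hA.evolH hs (hA.orbitH s hs _), hy.continuousOn_Ioc hA.evolE hs,
    isBounded_iff_forall_norm_le.2 ⟨C, ?_⟩, h.integrable, h.eq⟩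
  rintro _ ⟨t, ht, rfl⟩
  exact hC t (Ioc_subset_Icc_self ht)

/-- Uniqueness holds in the weak sense of the definition of mild solutions, since the comparison
only takes place in `H`. -/
theorem IsMildSolution.isUniqueMildSolution (hy : IsMildSolution ι U Φ f s T x y)
    (hA : ApproximatedEvolution T ι U UE Un) (hι : Function.Injective ι) (hs : 0 ≤ s) {ω : ℝ}
    (hΦ : ∀ r ∈ Ioc s T, ∀ a b : E, ∀ α > 0,
      (1 - α * ω) * ‖ι a - ι b‖ ≤ ‖ι a - ι b - α • (Φ r (ι a) - Φ r (ι b))‖) :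
    IsUniqueMildSolution ι U Φ f s T x y := by
  refine ⟨hy, fun v hv t ht => hι ?_⟩
  have h := hA.norm_sub_le hs (u₁ := fun t => ι (v t)) (u₂ := fun t => ι (y t))
    ⟨hv.integrable, hv.mild⟩ ⟨hy.integrable, hy.mild⟩ (ω := ω) (m := fun _ => 0) integrableOn_zero
    (fun r hr α hα => ?_) ht
  · simp only [sub_self, norm_zero, mul_zero, intervalIntegral.integral_zero, add_zero] at h
    exact sub_eq_zero.1 (norm_le_zero_iff.1 h)
  · have h1 := hΦ r hr (v r + f r) (y r + f r) α hα
    have h2 : ι (v r + f r) - ι (y r + f r) = ι (v r) - ι (y r) := by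
      rw [← map_sub, ← map_sub, add_sub_add_right_eq_sub]
    rw [h2] at h1
    simpa using h1

/-- Dissipativity gives the estimates with `‖F(r, f(r))‖` alone under the integral; this compares
with the weaker form that has the constant `3`. -/
theorem intervalIntegral_exp_mul_le_three {a b : ℝ → ℝ} (ha : IntegrableOn a (Ioc s T))
    (hb : IntegrableOn b (Ioc s T)) (ha0 : ∀ r, 0 ≤ a r) (hb0 : ∀ r, 0 ≤ b r) {t : ℝ}
    (ht : t ∈ Icc s T) :
    ∫ r in s..t, Real.exp (ζ * (t - r)) * a r ≤
      3 * ∫ r in s..t, Real.exp (ζ * (t - r)) * (a r + max 0 ζ * b r) := by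
  have hmono : Ioc s t ⊆ Ioc s T := Ioc_subset_Ioc_right ht.2
  have hint : ∀ d : ℝ → ℝ, IntegrableOn d (Ioc s T) →
      IntervalIntegrable (fun r => Real.exp (ζ * (t - r)) * d r) volume s t := fun d hd => by
    have h1 : IntervalIntegrable d volume s t :=
      (intervalIntegrable_iff_integrableOn_Ioc_of_le ht.1).2 (hd.mono_set hmono)
    exact h1.continuousOn_mul (by fun_prop)
  have h1 : ∫ r in s..t, Real.exp (ζ * (t - r)) * a r ≤
      ∫ r in s..t, Real.exp (ζ * (t - r)) * (a r + max 0 ζ * b r) := by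
    refine intervalIntegral.integral_mono_on ht.1 (hint a ha)
      (hint _ (ha.add (hb.const_mul _))) fun r _ => ?_
    refine mul_le_mul_of_nonneg_left ?_ (Real.exp_pos _).le
    exact le_add_of_nonneg_right (mul_nonneg (le_max_left _ _) (hb0 r))
  have h2 : 0 ≤ ∫ r in s..t, Real.exp (ζ * (t - r)) * a r :=
    intervalIntegral.integral_nonneg ht.1 fun r _ => mul_nonneg (Real.exp_pos _).le (ha0 r)
  linarith

variable {G : ℝ → E → E} {x₁ x₂ : E} {y₁ y₂ : ℝ → E}

/-- In `H`, the solution for the Yosida approximation differs from the solution of the equation by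
at most a multiple of the consistency error. -/
theorem norm_map_sub_le_of_shiftedYosida (hA : ApproximatedEvolution T ι U UE Un)
    (hG : IsDissipativeFamily T ι G) (hs : 0 ≤ s) {k : ℝ} (hk : 0 < k) (hζ : 0 ≤ k + ζ)
    (hy : IsMildFor UE s T (fun r => ζ • (y r + f r) + G r (y r + f r)) x y) {z : ℝ → E}
    (hz : IsMildFor UE s T (fun r => shiftedYosida G ζ k r (z r + f r)) x z)
    (hm : IntegrableOn (fun r => ι (shiftedYosida G ζ k r (y r + f r) -
      (ζ • (y r + f r) + G r (y r + f r)))) (Ioc s T)) {t : ℝ} (ht : t ∈ Icc s T) :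
    ‖ι (z t) - ι (y t)‖ ≤ Real.exp (|ζ| * T) * ∫ r in Ioc s T,
      ‖ι (shiftedYosida G ζ k r (y r + f r) - (ζ • (y r + f r) + G r (y r + f r)))‖ := by
  have hmn := Integrable.norm hm
  have h := hA.norm_sub_le hs (hz.map hA hs) (hy.map hA hs) (ω := ζ) hmn (fun r hr α hα => ?_) ht
  · rw [sub_self, norm_zero, mul_zero, zero_add] at h
    exact h.trans (integral_exp_mul_le hs hmn (fun r => norm_nonneg _) ht)
  · have hg := hG.mdiss r ⟨hs.trans hr.1.le, hr.2⟩
    have h1 := hg.resolvent_shift_le hg.dissH hk hζ (z r + f r) (y r + f r) hα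
    change _ ≤ ‖ι (_ - α • (shiftedYosida G ζ k r (z r + f r) -
      shiftedYosida G ζ k r (y r + f r)))‖ at h1
    rw [add_sub_add_right_eq_sub] at h1
    rw [← map_sub]
    refine h1.trans ?_
    set p := shiftedYosida G ζ k r (y r + f r)
    have h2 : ι (z r - y r - α • (shiftedYosida G ζ k r (z r + f r) - p)) =
        (ι (z r - y r) - α • (ι (shiftedYosida G ζ k r (z r + f r)) -
          ι (ζ • (y r + f r) + G r (y r + f r)))) +
        α • ι (p - (ζ • (y r + f r) + G r (y r + f r))) := by
      simp only [map_sub, map_smul, map_add]; module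
    rw [h2]
    refine (norm_add_le _ _).trans (le_of_eq ?_)
    rw [norm_smul, Real.norm_of_nonneg hα.le]

/-- The analogous estimate in `E`; the Yosida approximation is globally Lipschitz. -/
theorem norm_sub_le_of_shiftedYosida (hA : ApproximatedEvolution T ι U UE Un)
    (hG : IsDissipativeFamily T ι G) (hs : 0 ≤ s) {k : ℝ} (hk : 0 < k) (hζ : 0 ≤ k + ζ)
    (hy : IsMildFor UE s T (fun r => ζ • (y r + f r) + G r (y r + f r)) x y) {z : ℝ → E}
    (hz : IsMildFor UE s T (fun r => shiftedYosida G ζ k r (z r + f r)) x z)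
    (hm : IntegrableOn (fun r => shiftedYosida G ζ k r (y r + f r) -
      (ζ • (y r + f r) + G r (y r + f r))) (Ioc s T)) {t : ℝ} (ht : t ∈ Icc s T) :
    ‖z t - y t‖ ≤ Real.exp (|ζ| * T) * ∫ r in Ioc s T,
      ‖shiftedYosida G ζ k r (y r + f r) - (ζ • (y r + f r) + G r (y r + f r))‖ := by
  have hd := hz.sub hy hA.evolE hs
  rw [sub_self] at hd
  have hmn := Integrable.norm hm
  have hg : ∀ r ∈ Ioc s T, IsMDissipativeMap ι (G r) := fun r hr =>
    hG.mdiss r ⟨hs.trans hr.1.le, hr.2⟩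
  have h := hA.norm_le_of_lipschitz hs hd.integrable hd.eq (ω := ζ) (K := |ζ| + 2 * k)
    (B := fun r a => shiftedYosida G ζ k r (a + (y r + f r)) - shiftedYosida G ζ k r (y r + f r))
    (by positivity) (fun r hr a b => ?_) (fun r hr a α hα => ?_) hm (fun r hr => ?_) ht
  · rw [norm_zero, mul_zero, zero_add] at h
    exact h.trans (integral_exp_mul_le hs hmn (fun r => norm_nonneg _) ht)
  · have h1 := norm_shiftedYosida_sub_le (ζ := ζ) (hg r hr) (hg r hr).dissE hk
      (a + (y r + f r)) (b + (y r + f r))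
    simpa using h1
  · have h1 := (hg r hr).resolvent_shift_le (hg r hr).dissE hk hζ (a + (y r + f r)) (y r + f r) hα
    simpa [shiftedYosida] using h1
  · have h1 : z r - y r + (y r + f r) = z r + f r := by abel
    simp only [h1]
    abel

end Mild

/-! ### The well-posedness theorem -/

/-- Solvability in `E`, and the a priori bound for the recentred equations, hold in both cases. -/
theorem StandingHypothesis.exists_solution_and_bound {E H : Type*} [NormedAddCommGroup E]
    [NormedSpace ℝ E] [CompleteSpace E] [TopologicalSpace.SeparableSpace E]
    [NormedAddCommGroup H] [InnerProductSpace ℝ H] [CompleteSpace H]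
    {T ζ : ℝ} {ι : E →L[ℝ] H} {D : Set H} {F : ℝ → H → H}
    {A : ℝ → H →ₗ.[ℝ] H} {U : ℝ → ℝ → H →L[ℝ] H} (hS : StandingHypothesis T ι D F ζ A U)
    (hcase : ReflexiveCase T ι F ζ ∨ LipschitzCase T ι F) {UE : ℝ → ℝ → E →L[ℝ] E}
    {Un : ℕ → ℝ → ℝ → E →L[ℝ] E} (hA : ApproximatedEvolution T ι U UE Un) {s : ℝ} (hs : 0 ≤ s)
    (hsT : s ≤ T) :
    IsDissipativeFamily T ι (dissipativePart ι F ζ) ∧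
    (∀ (f : ℝ → E) (_ : ContinuousOn f (Icc s T)) (x : E), ∃ y : ℝ → E,
      IsMildFor UE s T (fun r => ζ • (y r + f r) + dissipativePart ι F ζ r (y r + f r)) x y) ∧
    ∀ (c q : ℝ → E) (x : E) (v : ℝ → E) (R : ℝ), ContinuousOn c (Ioc s T) →
      (∀ r ∈ Ioc s T, ‖c r‖ ≤ R) → IntegrableOn q (Ioc s T) →
      IsMildFor UE s T
        (fun r => ζ • v r + recentred (dissipativePart ι F ζ) c r (v r) + q r) x v →
      ∀ t ∈ Icc s T,
        ‖v t‖ ≤ Real.exp (ζ * (t - s)) * ‖x‖ + ∫ r in s..t, Real.exp (ζ * (t - r)) * ‖q r‖ := by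
  rcases hcase with hR | hL
  · have hGb : ∀ t ∈ Icc 0 T, BoundedlyDemicontinuous ι (dissipativePart ι F ζ t) := fun t ht =>
      hR.boundedlyDemicontinuous hS ht
    have hG := hS.isDissipativeFamily fun t ht => (hGb t ht).demicontinuous
    refine ⟨hG, fun f hf x => exists_solution_of_reflexive hR.reflexive hS.embedding_dense
      hS.embedding_injective hA hG hGb hs hsT ζ hf x, fun c q x v R hc _ hq hv t ht => ?_⟩
    exact hv.norm_le_of_reflexive hR.reflexive hS.embedding_dense hS.embedding_injective hA hG hs
      hsT (hc.aestronglyMeasurable measurableSet_Ioc) (hG.aestronglyMeasurable_path hs hc) hq ht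
  · have hLG : LocallyLipschitzFamily T (dissipativePart ι F ζ) := hL.locallyLipschitzFamily
    have hG := hS.isDissipativeFamily fun t ht => hLG.demicontinuous ht
    exact ⟨hG, fun f hf x => exists_solution_of_locallyLipschitz hA hG hLG hs hsT ζ hf x,
      fun c q x v R hc hcR hq hv t ht => hv.norm_le_of_locallyLipschitz hA hG hLG hs hcR hq ht⟩

theorem tendstoUniformlyOn_of_norm_le {V : Type*} [NormedAddCommGroup V] {S : Set ℝ}
    {yn : ℕ → ℝ → V} {y : ℝ → V} {a : ℕ → ℝ} (ha : Tendsto a atTop (𝓝 0))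
    (h : ∀ᶠ k in atTop, ∀ t ∈ S, ‖yn k t - y t‖ ≤ a k) : TendstoUniformlyOn yn y atTop S := by
  rw [Metric.tendstoUniformlyOn_iff]
  intro ε hε
  filter_upwards [h, ha.eventually_lt_const hε] with k hk1 hk2 t ht
  rw [dist_comm, dist_eq_norm]
  exact (hk1 t ht).trans_lt hk2

end

theorem theorem3p6 {E H : Type*} [NormedAddCommGroup E] [NormedSpace ℝ E] [CompleteSpace E]
    [TopologicalSpace.SeparableSpace E]
    [NormedAddCommGroup H] [InnerProductSpace ℝ H] [CompleteSpace H]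
    [TopologicalSpace.SeparableSpace H]
    (T : ℝ) (hT : 0 < T) (ι : E →L[ℝ] H) (D : Set H) (F : ℝ → H → H) (ζ : ℝ)
    (A : ℝ → H →ₗ.[ℝ] H) (U : ℝ → ℝ → H →L[ℝ] H)
    (hS : StandingHypothesis T ι D F ζ A U)
    (hcase : ReflexiveCase T ι F ζ ∨ LipschitzCase T ι F)
    (s : ℝ) (hs : s ∈ Ico 0 T) (f : ℝ → E) (hf : ContinuousOn f (Icc s T)) :
    ∃ (y : E → ℝ → E) (yk : ℕ → E → ℝ → E),
      (∀ x : E, IsUniqueMildSolution ι U F f s T x (y x)) ∧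
      (∀ k : ℕ, 1 ≤ k → ζ < k → ∀ x : E,
        IsUniqueMildSolution ι U (fun t => yosidaMap D (F t) ζ k) f s T x (yk k x)) ∧
      (∀ x : E,
        TendstoUniformlyOn (fun k t => ι (yk k x t)) (fun t => ι (y x t)) atTop (Icc s T)) ∧
      (∀ x : E, ∀ t ∈ Icc s T,
        ‖ι (y x t)‖ ≤ Real.exp (ζ * (t - s)) * ‖ι x‖ +
          3 * ∫ r in s..t, Real.exp (ζ * (t - r)) *
            (‖F r (ι (f r))‖ + max 0 ζ * ‖ι (f r)‖)) ∧
      (∀ x : E, ∀ t ∈ Icc s T,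
        ‖y x t‖ ≤ Real.exp (ζ * (t - s)) * ‖x‖ +
          3 * ∫ r in s..t, Real.exp (ζ * (t - r)) *
            (‖partMap ι (F r) (f r)‖ + max 0 ζ * ‖f r‖)) ∧
      (∀ x z : E, ∀ t ∈ Icc s T,
        ‖ι (y x t) - ι (y z t)‖ ≤ Real.exp (ζ * (t - s)) * ‖ι x - ι z‖) ∧
      (∀ x z : E, ∀ t ∈ Icc s T,
        ‖y x t - y z t‖ ≤ Real.exp (ζ * (t - s)) * ‖x - z‖) ∧
      (LipschitzCase T ι F → ∀ x : E, ∀ ε : ℝ, 0 < ε →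
        TendstoUniformlyOn (fun k t => yk k x t) (y x) atTop (Icc (s + ε) T)) := by
  obtain ⟨UE, Un, hA⟩ := hS.exists_approximatedEvolution
  have hs0 : 0 ≤ s := hs.1
  have hsT : s ≤ T := hs.2.le
  have hι := hS.embedding_injective
  have hsub : ∀ {r}, r ∈ Ioc s T → r ∈ Icc 0 T := fun hr => ⟨hs0.trans hr.1.le, hr.2⟩
  obtain ⟨hG, hsol, hbound⟩ := hS.exists_solution_and_bound hcase hA hs0 hsT
  set G := dissipativePart ι F ζ with hGdef
  have hg : ∀ r ∈ Ioc s T, IsMDissipativeMap ι (G r) := fun r hr => hG.mdiss r (hsub hr)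
  have hFG : ∀ r ∈ Ioc s T, ∀ a : E, ι (ζ • a + G r a) = F r (ι a) := fun r hr a => by
    rw [smul_add_dissipativePart, hS.map_partMap (hsub hr)]
  choose y hy using hsol f hf
  have hyk' : ∀ (k : ℕ) (x : E), ∃ z : ℝ → E, 1 ≤ k →
      IsMildFor UE s T (fun r => shiftedYosida G ζ k r (z r + f r)) x z := by
    intro k x
    by_cases hk : 1 ≤ k
    · obtain ⟨z, hz⟩ := exists_shiftedYosida_solution hA hG hs0 hsT ζ hf (k := k)
        (by exact_mod_cast hk) x
      exact ⟨z, fun _ => hz⟩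
    · exact ⟨0, fun h => absurd h hk⟩
  choose yk hyk using hyk'
  have hfi : IntegrableOn f (Ioc s T) := hf.integrableOn_Icc.mono_set Ioc_subset_Icc_self
  have hfc : ContinuousOn f (Ioc s T) := hf.mono Ioc_subset_Icc_self
  obtain ⟨Rf, hRf⟩ := isCompact_Icc.exists_bound_of_continuousOn hf
  have hFf : IntegrableOn (fun r => ζ • f r + G r (f r)) (Ioc s T) :=
    (Integrable.smul ζ hfi).add ((hG.integrableOn_path hs0 hf).mono_set Ioc_subset_Icc_self)
  have hFfE : IntegrableOn (fun r => partMap ι (F r) (f r)) (Ioc s T) := by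
    simpa only [hGdef, smul_add_dissipativePart] using hFf
  have hFfH : IntegrableOn (fun r => ‖F r (ι (f r))‖) (Ioc s T) :=
    (Integrable.norm (ι.integrable_comp hFf)).congr
      ((ae_restrict_mem measurableSet_Ioc).mono fun r hr => by
        show ‖ι (ζ • f r + G r (f r))‖ = _
        rw [hFG r hr])
  have hpath : ∀ x, IntegrableOn (fun r => y x r + f r) (Ioc s T) ∧
      IntegrableOn (fun r => G r (y x r + f r)) (Ioc s T) := by
    intro x
    obtain ⟨C, hC⟩ := (hy x).exists_bound hA.evolE hs0
    have hyi : IntegrableOn (y x) (Ioc s T) := by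
      refine Integrable.mono' (g := fun _ => C) (integrableOn_const (by simp))
        (((hy x).continuousOn_Ioc hA.evolE hs0).aestronglyMeasurable measurableSet_Ioc) ?_
      filter_upwards [ae_restrict_mem measurableSet_Ioc] with r hr
      exact hC r (Ioc_subset_Icc_self hr)
    have hp : IntegrableOn (fun r => y x r + f r) (Ioc s T) := hyi.add hfi
    refine ⟨hp, ((hy x).integrable.sub (Integrable.smul ζ hp)).congr (Eventually.of_forall
      fun r => ?_)⟩
    simp
  have hshift : ∀ r ∈ Ioc s T, ∀ a b : E, ∀ α > 0, (1 - α * ζ) * ‖ι a - ι b‖ ≤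
      ‖ι a - ι b - α • (ι (ζ • a + G r a) - ι (ζ • b + G r b))‖ := by
    intro r hr a b α hα
    simpa only [map_sub, map_smul, map_add] using (hg r hr).dissH.shift_le ζ a b hα
  have hlarge : ∀ᶠ k : ℕ in atTop, 1 ≤ k ∧ 0 ≤ (k : ℝ) + ζ := by
    filter_upwards [eventually_ge_atTop 1, tendsto_natCast_atTop_atTop.eventually_ge_atTop (-ζ)]
      with k h1 h2
    exact ⟨h1, by linarith⟩
  refine ⟨y, yk, fun x => ?_, fun k hk _ x => ?_, fun x => ?_, fun x t ht => ?_, fun x t ht => ?_,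
    fun x z t ht => ?_, fun x z t ht => ?_, fun hL x ε hε => ?_⟩
  · refine ((hy x).isMildSolution hA hs0 fun r hr => hFG r hr _).isUniqueMildSolution hA hι hs0
      (ω := ζ) fun r hr a b α hα => ?_
    simpa only [hFG r hr] using hshift r hr a b α hα
  · have hk0 : (0 : ℝ) < k := by exact_mod_cast hk
    refine ((hyk k x hk).isMildSolution hA hs0 fun r hr =>
      (hS.yosidaMap_eq (hsub hr) hk _).symm).isUniqueMildSolution hA hι hs0
      (ω := |ζ| + 2 * k) fun r hr a b α hα => ?_
    -- a Lipschitz map is dissipative up to its Lipschitz constant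
    rw [hS.yosidaMap_eq (hsub hr) hk, hS.yosidaMap_eq (hsub hr) hk, ← map_sub, ← map_sub]
    have h1 := norm_shiftedYosida_sub_le (ζ := ζ) (hg r hr) (hg r hr).dissH hk0 a b
    have h2 := norm_sub_norm_le (ι (a - b))
      (α • ι (shiftedYosida G ζ k r a - shiftedYosida G ζ k r b))
    rw [norm_smul, Real.norm_of_nonneg (le_of_lt hα)] at h2
    have h3 := mul_le_mul_of_nonneg_left h1 (le_of_lt hα)
    linarith
  · obtain ⟨hm, hlim⟩ := tendsto_integral_shiftedYosida_sub (ζ := ζ) hG hs0 hsT (hpath x).1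
      (hpath x).2 (L := ι) (fun r hr => (hg r hr).dissH)
      (fun r hr => (hg r hr).tendsto_yosida (hG.demi r (hsub hr)) _)
    refine tendstoUniformlyOn_of_norm_le (a := fun k => Real.exp (|ζ| * T) * _)
      (by simpa only [mul_zero] using hlim.const_mul _) ?_
    filter_upwards [hlarge] with k hk t ht
    exact norm_map_sub_le_of_shiftedYosida hA hG hs0 (by exact_mod_cast hk.1) hk.2 (hy x)
      (hyk k x hk.1) (hm k hk.1) ht
  · have hzero : IsMildFor U s T (fun _ => 0) 0 (fun _ => (0 : H)) :=
      ⟨integrableOn_zero, fun t _ => by simp⟩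
    have h := hA.norm_sub_le hs0 ((hy x).map hA hs0) hzero (ω := ζ) hFfH
      (fun r hr α hα => ?_) ht
    · rw [sub_zero, sub_zero] at h
      exact h.trans (add_le_add le_rfl (intervalIntegral_exp_mul_le_three hFfH
        (Integrable.norm (ι.integrable_comp hfi)) (fun _ => norm_nonneg _)
        (fun _ => norm_nonneg _) ht))
    · have h1 := hshift r hr (y x r + f r) (f r) α hα
      have h2 : ι (y x r + f r) - ι (f r) = ι (y x r) := by rw [map_add, add_sub_cancel_right]
      rw [h2] at h1
      rw [sub_zero, sub_zero, ← hFG r hr]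
      refine h1.trans ?_
      have h3 : ι (y x r) - α • (ι (ζ • (y x r + f r) + G r (y x r + f r)) -
          ι (ζ • f r + G r (f r))) =
          (ι (y x r) - α • ι (ζ • (y x r + f r) + G r (y x r + f r))) +
            α • ι (ζ • f r + G r (f r)) := by module
      rw [h3]
      refine (norm_add_le _ _).trans (le_of_eq ?_)
      rw [norm_smul, Real.norm_of_nonneg (le_of_lt hα)]
  -- the bound in `E` is the a priori bound for the family recentred at `f`
  · have h := hbound f (fun r => partMap ι (F r) (f r)) x (y x) Rf hfc
      (fun r hr => hRf r (Ioc_subset_Icc_self hr)) hFfE ((hy x).congr fun r _ => ?_) t ht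
    · exact h.trans (add_le_add le_rfl (intervalIntegral_exp_mul_le_three (Integrable.norm hFfE)
        (Integrable.norm hfi) (fun _ => norm_nonneg _) (fun _ => norm_nonneg _) ht))
    · rw [← smul_add_dissipativePart ι F ζ r (f r), recentred, add_comm (f r)]
      module
  · have h := hA.norm_sub_le hs0 ((hy x).map hA hs0) ((hy z).map hA hs0) (ω := ζ) (m := fun _ => 0)
      integrableOn_zero (fun r hr α hα => ?_) ht
    · simpa only [mul_zero, intervalIntegral.integral_zero, add_zero] using h
    · have h1 := hshift r hr (y x r + f r) (y z r + f r) α hα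
      have h2 : ι (y x r + f r) - ι (y z r + f r) = ι (y x r) - ι (y z r) := by
        rw [← map_sub, ← map_sub, add_sub_add_right_eq_sub]
      rw [h2] at h1
      simpa only [mul_zero, add_zero] using h1
  -- the difference of two solutions solves the equation recentred at `y z + f`
  · obtain ⟨C, hC⟩ := (hy z).exists_bound hA.evolE hs0
    have h := hbound (fun r => y z r + f r) (fun _ => 0) (x - z) (fun r => y x r - y z r) (C + Rf)
      (((hy z).continuousOn_Ioc hA.evolE hs0).add hfc)
      (fun r hr => (norm_add_le _ _).trans
        (add_le_add (hC r (Ioc_subset_Icc_self hr)) (hRf r (Ioc_subset_Icc_self hr))))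
      integrableOn_zero (((hy x).sub (hy z) hA.evolE hs0).congr fun r _ => ?_) t ht
    · simpa only [norm_zero, mul_zero, intervalIntegral.integral_zero, add_zero] using h
    · have h1 : y z r + f r + (y x r - y z r) = y x r + f r := by abel
      rw [recentred, h1]
      module
  · have hLG : LocallyLipschitzFamily T G := hL.locallyLipschitzFamily
    obtain ⟨hm, hlim⟩ := tendsto_integral_shiftedYosida_sub (ζ := ζ) hG hs0 hsT (hpath x).1
      (hpath x).2 (L := ContinuousLinearMap.id ℝ E) (fun r hr => (hg r hr).dissE)
      (fun r hr => by
        refine (((hLG.continuous (hsub hr)).tendsto _).comp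
          ((hg r hr).tendsto_resolvent (y x r + f r))).congr' ?_
        filter_upwards [eventually_ge_atTop 1] with k hk
        exact ((hg r hr).yosida_eq (by exact_mod_cast hk) _).symm)
    refine TendstoUniformlyOn.mono (s := Icc s T) ?_ (Icc_subset_Icc_left (by linarith))
    refine tendstoUniformlyOn_of_norm_le (a := fun k => Real.exp (|ζ| * T) * _)
      (by simpa only [mul_zero] using hlim.const_mul _) ?_
    filter_upwards [hlarge] with k hk t ht
    exact norm_sub_le_of_shiftedYosida hA hG hs0 (by exact_mod_cast hk.1) hk.2 (hy x)
      (hyk k x hk.1) (hm k hk.1) ht
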